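/- **Setting.** There are $K$ potential users. The random set $\mathcal K_a\subset[K]$ of active users has an arbitrary known law; ${\rm K}_a=|\mathcal K_a|$ and $P_{{\rm K}_a}(k)=\mathbb P[{\rm K}_a=k]$. All users share a codebook of $M\ge 2$ codewords $\mathbf x_1,\dots,\mathbf x_M\in\mathbb C^n$, $n\ge1$. User $k$ has a message $W_k$ uniform on $[M]$; the receiver has $L\ge1$ antennas and observes $\mathbf Y=[\mathbf y_1,\dots,\mathbf y_L]$, $\mathbf y_l=\sum_{k\in\mathcal K_a}h_{k,l}\mathbf x_{W_k}+\mathbf z_l$, with $h_{k,l}$ i.i.d. $\mathcal{CN}(0,1)$, $\mathbf z_l$ i.i.d. $\mathcal{CN}(\mathbf 0,\mathbf I_n)$, everything independent. An $(n,M,\epsilon_{\rm MD},\epsilon_{\rm FA},P)$ code consists of common randomness $U$ known to the users and the receiver, an encoder $(U,m)\mapsto\mathbf x_m$ with $\|\mathbf x_m\|_2^2\le nP$ for all $m$, and a decoder $(U,\mathbf Y)\mapsto\hat{\mathcal W}\subset[M]$, $|\hat{\mathcal W}|\le K$, such that, with $\mathcal W=\{W_k:k\in\mathcal K_a\}$,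 $$P_{\rm MD}=\mathbb E\Big[1[{\rm K}_a\ge1]\tfrac1{{\rm K}_a}\sum_{k\in\mathcal K_a}1[W_k\notin\hat{\mathcal W}]\Big]\le\epsilon_{\rm MD},\qquad P_{\rm FA}=\mathbb E\Big[1[|\hat{\mathcal W}|\ge1]\tfrac1{|\hat{\mathcal W}|}\sum_{\hat w\in\hat{\mathcal W}}1[\hat w\notin\mathcal W]\Big]\le\epsilon_{\rm FA}.$$ **Theorem.** Let $0\le P'\le P$, $0\le K_l\le K_u\le K$, $K_u\le M$, $r'\in\mathbb N$, and let the codeword law be either $\mathcal{CN}(\mathbf 0,P'\mathbf I_n)$ or the uniform law on the sphere of radius $\sqrt{nP'}$ in $\mathbb C^n$. There is an $(n,M,\epsilon_{\rm MD},\epsilon_{\rm FA},P)$ code of the following two-stage form. $U$ determines a codebook $\mathbf c_1,\dots,\mathbf c_M$ drawn i.i.d. from the codeword law; $\mathbf x_m=\mathbf c_m1[\|\mathbf c_m\|_2^2\le nP]$; the decoder takes an estimate $K_a'\in[K_l:K_u]$ that minimizes $\big|\frac1{nL}\|\mathbf Y\|_F^2-(1+kP')\big|$ over $k\in[K_l:K_u]$,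 and outputs a set $\hat{\mathcal W}$ that minimizes $$g(S)=L\ln|\mathbf I_n+\mathbf C_S\mathbf C_S^H|+\operatorname{tr}\big(\mathbf Y^H(\mathbf I_n+\mathbf C_S\mathbf C_S^H)^{-1}\mathbf Y\big)-\ln P_{{\rm K}_a}(|S|)+\ln\tbinom M{|S|}$$ over all $S\subset[M]$ with $|S|\in[K'_{a,l}:K'_{a,u}]$, where $K'_{a,l}=\max\{K_l,K'_a-r'\}$, $K'_{a,u}=\min\{K_u,K'_a+r'\}$, $\mathbf C_S$ is the matrix of the $\mathbf c_i$, $i\in S$, and $-\ln0=+\infty$. Moreover $\epsilon_{\rm MD}$ and $\epsilon_{\rm FA}$ can be taken to be $$\epsilon_{\rm MD}=p_0+\sum_{K_a=\max\{K_l,1\}}^{K_u}P_{{\rm K}_a}(K_a)\sum_{K_a'=K_l}^{K_u}\sum_{t\in\mathcal T_{K'_a}}\frac{t+d_1}{K_a}\min\Big\{1,\sum_{t'\in\bar{\mathcal T}_{K'_a,t}}p_{K'_a,t,t'},\;p_{K_a,K'_a,P'}\Big\},$$ $$\epsilon_{\rm FA}=p_0+\sum_{K_a=K_l}^{K_u}P_{{\rm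 K}_a}(K_a)\sum_{K_a'=K_l}^{K_u}\sum_{t\in\mathcal T_{K'_a}}\sum_{t'\in\mathcal T_{K'_a,t}}\frac{t'+d_2}{\hat K_a}\min\{1,p_{K'_a,t,t'},p_{K_a,K'_a,P'}\},$$ with $d_1=(K_a-K'_{a,u})^+$, $d_2=(K'_{a,l}-K_a)^+$, $\hat K_a=K_a-t-d_1+t'+d_2$ and the following terms. *Change of measure.* $p_0=\sum_{K_a=0}^KP_{{\rm K}_a}(K_a)p_{0,K_a}+\sum_{K_a\notin[K_l:K_u]}P_{{\rm K}_a}(K_a)+\sum_{K_a=0}^KP_{{\rm K}_a}(K_a)\binom{K_a}2/M$, where $p_{0,K_a}=K_a\Gamma(n,nP/P')/\Gamma(n)$ for Gaussian codewords ($0$ if $P'=0$) and $p_{0,K_a}=0$ for spherical ones. *Index sets* (intervals of integers). $\mathcal T_{K'_a}=[0:\min\{K_a,K'_{a,u},M-K'_{a,l}-d_1\}]$; $\bar{\mathcal T}_{K'_a,t}=[(d_1-(K_a-K'_{a,l})^++t)^+:T_{upper}]$; $\mathcal T_{K'_a,t}=[(d_1-d_2+\max\{K'_{a,l},1\}-K_a+t)^+:T_{upper}]$;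 $T_{upper}=\min\{(K'_{a,u}-K_a)^+-d_2+t,\;M-\max\{K_a,K'_{a,l}\}\}$. *Matrices.* $\mathcal W=[K_a]$, $\mathcal W_{1,1}=[d_1]$, $\mathcal W_1=[d_1+t]$, $\mathcal W_{2,1}=[K_a+1:K_a+d_2]$, $\mathcal W_2=[K_a+1:K_a+d_2+t']$; $\mathbf F,\mathbf F_1,\mathbf F',\mathbf F''$ are $\mathbf I_n+\mathbf C_S\mathbf C_S^H$ with $S=\mathcal W$, $\mathcal W\setminus\mathcal W_1$, $(\mathcal W\setminus\mathcal W_1)\cup\mathcal W_2$, $(\mathcal W\setminus\mathcal W_{1,1})\cup\mathcal W_{2,1}$ respectively; $\mathbf B=(1+r)\mathbf I_n-u(\mathbf F'')^{-1}\mathbf F+u(\mathbf F')^{-1}\mathbf F-r\omega\mathbf F_1^{-1}\mathbf F$. Expectations are over the codebook. All minima over real parameters are infima. *Estimation.* Let $\lambda_1'$ be the largest eigenvalue of $\mathbf F-\mathbf I_n$, and $$p_1=\mathbb E\Big[\min_{\rho\ge0}e^{\rho nL(1+(K'_a+\frac12)P')-L\ln|\mathbf I_n+\rho\mathbf F|}\Big],\quad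 p_2=\mathbb E\Big[\min_{0\le\rho<1/(1+\lambda'_1)}e^{-\rho nL(1+(K'_a-\frac12)P')-L\ln|\mathbf I_n-\rho\mathbf F|}\Big].$$ For spherical codewords $p_{K_a,K'_a,P'}=\min\{p_1,p_2\}$; for Gaussian codewords the same, except that $p_1$ is replaced by $1$ if $K'_a=K_u$ and $p_2$ is replaced by $1$ if $K'_a=K_l$. *Decoding.* Let $\beta(k)=\ln P_{{\rm K}_a}(k)-\ln\binom Mk$, $b=\beta(K_a)$, $b_1=\beta(K_a-t-d_1)$, $b'=\beta(\hat K_a)$, $b''=\beta(K_a-d_1+d_2)$, $b_{u,r}=-ub''+rb+ub'-r\omega b_1$. Then $$p_{K'_a,t,t'}=\min_{0\le\omega\le1,\,\nu\ge0}\big\{q_1(\omega,\nu)+1[t+d_1>0]\,q_2(\omega,\nu)+1[t+d_1=0]\,q_{2,0}(\omega,\nu)\big\},$$ $$q_1=\tbinom{K_a}{t+d_1}\tbinom{M-K_a}{t'+d_2}\,\mathbb E\Big[\min_{u,r\ge0,\,\lambda_{\min}(\mathbf B)>0}e^{Lrn\nu+b_{u,r}+L(u\ln|\mathbf F''|-r\ln|\mathbf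 F|-u\ln|\mathbf F'|+r\omega\ln|\mathbf F_1|-\ln|\mathbf B|)}\Big],$$ $$q_2=\tbinom{K_a}{t+d_1}\min_{\delta\ge0}\Big\{\tfrac{\Gamma(nL,nL(1+\delta))}{\Gamma(nL)}+\mathbb E\Big[\tfrac1{\Gamma(Lm)}\gamma\Big(Lm,\tfrac{nL(1+\delta)(1-\omega)-\omega(L\ln|\mathbf F_1|-b_1)+L\ln|\mathbf F|-b-nL\nu}{\omega\prod_{i=1}^m\lambda_i^{1/m}}\Big)\Big]\Big\},$$ $$q_{2,0}=\mathbb E\Big[\tfrac1{\Gamma(nL)}\Gamma\Big(nL,\tfrac{nL\nu}{1-\omega}-L\ln|\mathbf F|+b\Big)\Big],$$ where $m=\min\{n,t+d_1\}$ and $\lambda_1,\dots,\lambda_m$ are the non-zero eigenvalues of $\mathbf F_1^{-1}\mathbf C_{\mathcal W_1}\mathbf C_{\mathcal W_1}^H$ (the product is $0$ if there are fewer than $m$). *Conventions.* $\gamma(a,y)=\int_0^yz^{a-1}e^{-z}dz$ and $\Gamma(a,y)=\int_y^\infty z^{a-1}e^{-z}dz$ for $y\ge0$, $\gamma(a,y)=0$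 and $\Gamma(a,y)=\Gamma(a)$ for $y<0$. If the denominator in the argument of $\gamma$ is $0$, the argument is $+\infty$ or $0$ according to whether the numerator is positive or not; $\frac{nL\nu}{1-\omega}$ is $+\infty$ at $\omega=1$. $\ln0=-\infty$, $0\cdot(-\infty)=0$, and in $q_1$ pairs $(u,r)$ with $u>0$ and $b''=-\infty$, or $r\omega>0$ and $b_1=-\infty$, are excluded from the minimum. Terms with $P_{{\rm K}_a}(K_a)=0$ are $0$. -/

import Mathlib

open MeasureTheory ProbabilityTheory
open scoped NNReal ENNReal Matrix

noncomputable section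

namespace URA

/-! ### Channel model and codes -/

/-- Squared Euclidean norm of a vector of `ℂⁿ`. -/
def energy {n : ℕ} (x : Fin n → ℂ) : ℝ := ∑ i, ‖x i‖ ^ 2

/-- The circularly symmetric complex Gaussian law `CN(0, v)`: independent real and imaginary parts
of variance `v / 2` each. -/
def complexGaussian (v : ℝ≥0) : Measure ℂ :=
  ((gaussianReal 0 (v / 2)).prod (gaussianReal 0 (v / 2))).map
    (fun p : ℝ × ℝ => (p.1 : ℂ) + (p.2 : ℂ) * Complex.I)

/-- A `p × q` array with independent `CN(0, 1)` entries. -/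
def gaussianArray (p q : ℕ) : Measure (Fin p → Fin q → ℂ) :=
  Measure.pi fun _ => Measure.pi fun _ => complexGaussian 1

/-- Probability that exactly `k` users are active, where `Q` is the law of the random set of active
users. -/
def numActive {K : ℕ} (Q : PMF (Finset (Fin K))) (k : ℕ) : ℝ :=
  ∑ A : Finset (Fin K), if A.card = k then (Q A).toReal else 0

/-- The received signal (row: channel use, column: antenna): active users `A`, transmitted messages
`w`, fading `h`, noise `z`, codebook `x`. -/
def received {n L M K : ℕ} (x : Fin M → Fin n → ℂ) (A : Finset (Fin K)) (w : Fin K → Fin M)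
    (h : Fin K → Fin L → ℂ) (z : Fin n → Fin L → ℂ) : Fin n → Fin L → ℂ :=
  fun i l => ∑ k ∈ A, h k l * x (w k) i + z i l

/-- A random-access code with common codebook of `M` codewords, blocklength `n`, maximal power `P`,
for `K` potential users and `L` receive antennas. The element `u : 𝒰`, drawn from `law`, is the
common randomness that is revealed to the transmitters and to the receiver. -/
structure Code (n L M K : ℕ) (P : ℝ) where
  𝒰 : Type
  [mU : MeasurableSpace 𝒰]
  law : Measure 𝒰
  [isProb : IsProbabilityMeasure law]
  enc : 𝒰 → Fin M → Fin n → ℂ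
  enc_measurable : Measurable enc
  power : ∀ u m, energy (enc u m) ≤ n * P
  dec : 𝒰 → (Fin n → Fin L → ℂ) → Finset (Fin M)
  dec_measurable : ∀ S, MeasurableSet {p : 𝒰 × (Fin n → Fin L → ℂ) | dec p.1 p.2 = S}
  dec_card : ∀ u Y, (dec u Y).card ≤ K

attribute [instance] Code.mU Code.isProb

namespace Code

variable {n L M K : ℕ} {P : ℝ}

/-- Expectation of a function `φ` of the active set, of the messages and of the decoded list: the
active set has law `Q`, the messages are i.i.d. uniform on `M` elements, the fading coefficients and
the noise are i.i.d. `CN(0, 1)`, and all these and the common randomness are independent. -/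
def expect (c : Code n L M K P) (Q : PMF (Finset (Fin K)))
    (φ : Finset (Fin K) → (Fin K → Fin M) → Finset (Fin M) → ℝ) : ℝ :=
  ∑ A : Finset (Fin K), (Q A).toReal * ∑ w : Fin K → Fin M, (1 / (M : ℝ) ^ K) *
    ∫ q : c.𝒰 × (Fin K → Fin L → ℂ) × (Fin n → Fin L → ℂ),
      φ A w (c.dec q.1 (received (c.enc q.1) A w q.2.1 q.2.2))
      ∂(c.law.prod ((gaussianArray K L).prod (gaussianArray n L)))

/-- Per-user probability of misdetection. -/
def probMD (c : Code n L M K P) (Q : PMF (Finset (Fin K))) : ℝ :=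
  c.expect Q fun A w D =>
    if 1 ≤ A.card then (1 / (A.card : ℝ)) * ∑ k ∈ A, (if w k ∉ D then 1 else 0) else 0

/-- Per-user probability of false alarm. -/
def probFA (c : Code n L M K P) (Q : PMF (Finset (Fin K))) : ℝ :=
  c.expect Q fun A w D =>
    if 1 ≤ D.card then (1 / (D.card : ℝ)) * ∑ m ∈ D, (if m ∉ A.image w then 1 else 0) else 0

/-- `c` is an `(n, M, εMD, εFA, P)` code. -/
def Achieves (c : Code n L M K P) (Q : PMF (Finset (Fin K))) (εMD εFA : ℝ) : Prop :=
  c.probMD Q ≤ εMD ∧ c.probFA Q ≤ εFA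

end Code

/-! ### Random codebooks -/

/-- The two codebook ensembles. -/
inductive Ensemble
  | gaussian
  | spherical

/-- Law of one codeword: `CN(0, P' Iₙ)`, or uniform on the sphere of radius `√(n P')` in `ℂⁿ` (the
radial projection of the uniform law on the unit ball). -/
def codewordLaw (n : ℕ) (P' : ℝ) : Ensemble → Measure (Fin n → ℂ)
  | .gaussian => Measure.pi fun _ => complexGaussian P'.toNNReal
  | .spherical => (ProbabilityTheory.cond volume {x : Fin n → ℂ | energy x ≤ 1}).map
      (fun x i => ((Real.sqrt (n * P') / Real.sqrt (energy x) : ℝ) : ℂ) * x i)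

/-- Parameters of the two-stage scheme: blocklength `n`, antennas `L`, codebook size `M`, potential
users `K`, typical range `[Kl : Ku]` of the number of active users, decoding radius `rad`, power
constraint `P`, codebook power `P'`, codebook ensemble. -/
structure Params where
  n : ℕ
  L : ℕ
  M : ℕ
  K : ℕ
  Kl : ℕ
  Ku : ℕ
  rad : ℕ
  P : ℝ
  P' : ℝ
  ens : Ensemble

variable (s : Params)

/-- Codebooks, as families of codewords. -/
abbrev Params.Codebook : Type := Fin s.M → Fin s.n → ℂ

/-- The codebook law: i.i.d. codewords. -/
def Params.codebookLaw : Measure s.Codebook :=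
  Measure.pi fun _ => codewordLaw s.n s.P' s.ens

/-- `K'_{a,l}` (natural subtraction is harmless since `0 ≤ Kl`). -/
def Params.lo (K' : ℕ) : ℕ := max s.Kl (K' - s.rad)

/-- `K'_{a,u}`. -/
def Params.hi (K' : ℕ) : ℕ := min s.Ku (K' + s.rad)

/-! ### Matrices -/

/-- The concatenation `C_S` of the codewords with index in `S`. -/
def subCode {n M : ℕ} (C : Fin M → Fin n → ℂ) (S : Finset (Fin M)) : Matrix (Fin n) S ℂ :=
  Matrix.of fun i j => C j i

/-- `Iₙ + C_S C_Sᴴ`. -/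
def cov {n M : ℕ} (C : Fin M → Fin n → ℂ) (S : Finset (Fin M)) : Matrix (Fin n) (Fin n) ℂ :=
  1 + subCode C S * (subCode C S)ᴴ

/-- `ln |A|`, only used for matrices with real positive determinant. -/
def logDet {n : ℕ} (A : Matrix (Fin n) (Fin n) ℂ) : ℝ := Real.log A.det.re

/-- Largest eigenvalue of `C_S C_Sᴴ`. -/
def maxEig {n M : ℕ} (C : Fin M → Fin n → ℂ) (S : Finset (Fin M)) : ℝ :=
  ⨆ i, (Matrix.isHermitian_mul_conjTranspose_self (subCode C S)).eigenvalues i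

/-- `λ_min(B) > 0` for a matrix with real eigenvalues. -/
def EigPos {n : ℕ} (B : Matrix (Fin n) (Fin n) ℂ) : Prop := ∀ μ ∈ spectrum ℂ B, 0 < μ.re

open Classical in
/-- `∏ i ≤ m, λ_i ^ (1 / m)` where `λ₁, …, λ_m` are the non-zero eigenvalues (with multiplicity) of a
matrix of rank at most `m` with real nonnegative eigenvalues; it is `0` if there are fewer than `m`
of them. -/
def geomEig {n : ℕ} (m : ℕ) (A : Matrix (Fin n) (Fin n) ℂ) : ℝ :=
  if Multiset.card (A.charpoly.roots.filter (fun z => z ≠ 0)) = m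
  then (A.charpoly.roots.filter (fun z => z ≠ 0)).prod.re ^ (1 / (m : ℝ)) else 0

/-! ### The two-stage scheme -/

/-- The metric of the energy detector. -/
def Params.energyMetric (Y : Fin s.n → Fin s.L → ℂ) (k : ℕ) : ℝ :=
  |(1 / ((s.n : ℝ) * s.L)) * (∑ i, ∑ l, ‖Y i l‖ ^ 2) - (1 + k * s.P')|

/-- The MAP metric of a list `S` of messages, where `π` is the law of the number of active users; it
is `+∞` if lists of that size have prior probability `0`. -/
def Params.mapMetric (π : ℕ → ℝ) (C : s.Codebook) (Y : Fin s.n → Fin s.L → ℂ)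
    (S : Finset (Fin s.M)) : EReal :=
  ((s.L * logDet (cov C S)
      + ((Matrix.of Y)ᴴ * (cov C S)⁻¹ * Matrix.of Y).trace.re : ℝ) : EReal)
    + (if π S.card = 0 then ⊤
       else ((- Real.log (π S.card) + Real.log (s.M.choose S.card) : ℝ) : EReal))

/-- The code draws the codebook `C` from the ensemble, transmits a codeword if it meets the power
constraint and `0` otherwise, estimates the number of active users in `[Kl : Ku]` with the energy
detector, and outputs a list that is optimal for the MAP metric among all lists of size
between `lo` and `hi`. -/
def Params.IsTwoStage (π : ℕ → ℝ) (c : Code s.n s.L s.M s.K s.P) : Prop :=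
  ∃ C : c.𝒰 → s.Codebook, Measurable C ∧ c.law.map C = s.codebookLaw ∧
    (∀ u m, c.enc u m = if energy (C u m) ≤ s.n * s.P then C u m else 0) ∧
    ∀ u Y, ∃ K' ∈ Finset.Icc s.Kl s.Ku,
      (∀ k ∈ Finset.Icc s.Kl s.Ku, s.energyMetric Y K' ≤ s.energyMetric Y k) ∧
      (c.dec u Y).card ∈ Finset.Icc (s.lo K') (s.hi K') ∧
      ∀ S : Finset (Fin s.M), S.card ∈ Finset.Icc (s.lo K') (s.hi K') →
        s.mapMetric π (C u) Y (c.dec u Y) ≤ s.mapMetric π (C u) Y S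

/-! ### Incomplete gamma functions -/

/-- Lower incomplete gamma function; `0` for `y ≤ 0`. -/
def lowerGamma (a y : ℝ) : ℝ := ∫ z in Set.Ioc 0 y, z ^ (a - 1) * Real.exp (-z)

/-- Upper incomplete gamma function; `Γ(a)` for `y ≤ 0`. -/
def upperGamma (a y : ℝ) : ℝ := ∫ z in Set.Ioi (max y 0), z ^ (a - 1) * Real.exp (-z)

/-- `γ(a, x / y) / Γ(a)` for `y ≥ 0`, with the value `1` or `0` at `y = 0` according to
whether `x > 0` or not (that is, `x / 0` is `+∞` or `≤ 0`). -/
def lowerGammaRatio (a x y : ℝ) : ℝ :=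
  if y = 0 then (if 0 < x then 1 else 0) else lowerGamma a (x / y) / Real.Gamma a

/-! ### Terms of the bounds -/

/-- The messages numbered `a + 1, …, b` (indices start from `0` in `Fin M`). -/
def msgs (M a b : ℕ) : Finset (Fin M) := Finset.univ.filter fun i => a ≤ i.val ∧ i.val < b

/-- Power violation term for `Ka` active users. -/
def Params.p0Ka (Ka : ℕ) : ℝ :=
  match s.ens with
  | .gaussian => if s.P' = 0 then 0
      else Ka * upperGamma s.n (s.n * s.P / s.P') / Real.Gamma s.n
  | .spherical => 0

/-- The change of measure term. -/
def Params.p0 (π : ℕ → ℝ) : ℝ :=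
  ∑ Ka ∈ Finset.Icc 0 s.K, π Ka * s.p0Ka Ka
    + ∑ Ka ∈ (Finset.Icc 0 s.K).filter (fun k => k ∉ Finset.Icc s.Kl s.Ku), π Ka
    + ∑ Ka ∈ Finset.Icc 0 s.K, π Ka * ((Ka.choose 2 : ℝ) / s.M)

/-- First bound on the probability of estimating `Ka` as `K'` (comparison with `K' + 1`). -/
def Params.pEst1 (Ka K' : ℕ) : ℝ :=
  ∫ C, ⨅ ρ : {ρ : ℝ // 0 ≤ ρ},
    Real.exp (ρ.1 * (s.n * s.L * (1 + ((K' : ℝ) + 1 / 2) * s.P'))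
      - s.L * logDet (1 + (ρ.1 : ℂ) • cov C (msgs s.M 0 Ka))) ∂s.codebookLaw

/-- Second bound on the probability of estimating `Ka` as `K'` (comparison with `K' - 1`). -/
def Params.pEst2 (Ka K' : ℕ) : ℝ :=
  ∫ C, ⨅ ρ : {ρ : ℝ // 0 ≤ ρ ∧ ρ < 1 / (1 + maxEig C (msgs s.M 0 Ka))},
    Real.exp (-ρ.1 * (s.n * s.L * (1 + ((K' : ℝ) - 1 / 2) * s.P'))
      - s.L * logDet (1 - (ρ.1 : ℂ) • cov C (msgs s.M 0 Ka))) ∂s.codebookLaw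

/-- Bound on the probability of estimating `Ka` as `K'`. For Gaussian codewords a comparison with
`K' ± 1` is only used if `K' ± 1` is a candidate of the estimator, that is, lies in `[Kl : Ku]`. -/
def Params.pEst (Ka K' : ℕ) : ℝ :=
  match s.ens with
  | .spherical => min (s.pEst1 Ka K') (s.pEst2 Ka K')
  | .gaussian => min (if K' = s.Ku then 1 else s.pEst1 Ka K')
      (if K' = s.Kl then 1 else s.pEst2 Ka K')

/-- `exp b`, the prior probability of any given list of size `k`. -/
def Params.listPrior (π : ℕ → ℝ) (k : ℕ) : ℝ := π k / (s.M.choose k : ℝ)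

/-- `(Ka - K'_{a,u})⁺`. -/
def Params.missed (Ka K' : ℕ) : ℕ := Ka - s.hi K'

/-- `(K'_{a,l} - Ka)⁺`. -/
def Params.extra (Ka K' : ℕ) : ℕ := s.lo K' - Ka

/-- The decoded list size with `t` additional misdetections, `t'` additional false alarms. -/
def Params.listSize (Ka K' t t' : ℕ) : ℕ :=
  (Ka + t' + s.extra Ka K') - (t + s.missed Ka K')

/-- `𝓦 = [Ka]`. -/
def Params.W (Ka : ℕ) : Finset (Fin s.M) := msgs s.M 0 Ka

/-- `𝓦₁ = [(Ka - K'_{a,u})⁺ + t]`. -/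
def Params.W₁ (Ka K' t : ℕ) : Finset (Fin s.M) := msgs s.M 0 (s.missed Ka K' + t)

/-- `𝓦₁₁ = [(Ka - K'_{a,u})⁺]`. -/
def Params.W₁₁ (Ka K' : ℕ) : Finset (Fin s.M) := msgs s.M 0 (s.missed Ka K')

/-- `𝓦₂ = [Ka + 1 : Ka + (K'_{a,l} - Ka)⁺ + t']`. -/
def Params.W₂ (Ka K' t' : ℕ) : Finset (Fin s.M) := msgs s.M Ka (Ka + s.extra Ka K' + t')

/-- `𝓦₂₁ = [Ka + 1 : Ka + (K'_{a,l} - Ka)⁺]`. -/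
def Params.W₂₁ (Ka K' : ℕ) : Finset (Fin s.M) := msgs s.M Ka (Ka + s.extra Ka K')

/-- The matrix `𝐅`. -/
def Params.F (C : s.Codebook) (Ka : ℕ) : Matrix (Fin s.n) (Fin s.n) ℂ := cov C (s.W Ka)

/-- The matrix `𝐅₁`. -/
def Params.F₁ (C : s.Codebook) (Ka K' t : ℕ) : Matrix (Fin s.n) (Fin s.n) ℂ :=
  cov C (s.W Ka \ s.W₁ Ka K' t)

/-- The matrix `𝐅'`. -/
def Params.F' (C : s.Codebook) (Ka K' t t' : ℕ) : Matrix (Fin s.n) (Fin s.n) ℂ :=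
  cov C ((s.W Ka \ s.W₁ Ka K' t) ∪ s.W₂ Ka K' t')

/-- The matrix `𝐅''`. -/
def Params.F'' (C : s.Codebook) (Ka K' : ℕ) : Matrix (Fin s.n) (Fin s.n) ℂ :=
  cov C ((s.W Ka \ s.W₁₁ Ka K') ∪ s.W₂₁ Ka K')

/-- The matrix `𝐁`. -/
def Params.B (C : s.Codebook) (Ka K' t t' : ℕ) (ω u r : ℝ) : Matrix (Fin s.n) (Fin s.n) ℂ :=
  ((1 + r : ℝ) : ℂ) • (1 : Matrix (Fin s.n) (Fin s.n) ℂ)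
    - (u : ℂ) • ((s.F'' C Ka K')⁻¹ * s.F C Ka)
    + (u : ℂ) • ((s.F' C Ka K' t t')⁻¹ * s.F C Ka)
    - ((r * ω : ℝ) : ℂ) • ((s.F₁ C Ka K' t)⁻¹ * s.F C Ka)

/-- `exp b`, with `b` as in the definition of the metric of the transmitted list. -/
def Params.eb (π : ℕ → ℝ) (Ka : ℕ) : ℝ := s.listPrior π Ka

/-- `exp b₁`. -/
def Params.eb₁ (π : ℕ → ℝ) (Ka K' t : ℕ) : ℝ := s.listPrior π (Ka - (t + s.missed Ka K'))

/-- `exp b'`. -/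
def Params.eb' (π : ℕ → ℝ) (Ka K' t t' : ℕ) : ℝ := s.listPrior π (s.listSize Ka K' t t')

/-- `exp b''`. -/
def Params.eb'' (π : ℕ → ℝ) (Ka K' : ℕ) : ℝ :=
  s.listPrior π (Ka - s.missed Ka K' + s.extra Ka K')

/-- `exp b_{u,r}`, where `b_{u,r} = -u b'' + r b + u b' - r ω b₁`. -/
def Params.expb (π : ℕ → ℝ) (Ka K' t t' : ℕ) (ω u r : ℝ) : ℝ :=
  s.eb'' π Ka K' ^ (-u) * s.eb π Ka ^ r * s.eb' π Ka K' t t' ^ u * s.eb₁ π Ka K' t ^ (-(r * ω))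

/-- The set of `(u, r)` over which the minimum in `q₁` is taken. The conditions on `eb''` and `eb₁`
exclude the negative powers of `0`, whose value is `+∞`. -/
def Params.Feasible (π : ℕ → ℝ) (C : s.Codebook) (Ka K' t t' : ℕ) (ω u r : ℝ) : Prop :=
  0 ≤ u ∧ 0 ≤ r ∧ EigPos (s.B C Ka K' t t' ω u r) ∧
    (u = 0 ∨ s.eb'' π Ka K' ≠ 0) ∧ (r * ω = 0 ∨ s.eb₁ π Ka K' t ≠ 0)

/-- The term `q₁`. -/
def Params.q1 (π : ℕ → ℝ) (Ka K' t t' : ℕ) (ω ν : ℝ) : ℝ :=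
  (Ka.choose (t + s.missed Ka K') : ℝ) * ((s.M - Ka).choose (t' + s.extra Ka K') : ℝ) *
    ∫ C, ⨅ x : {x : ℝ × ℝ // s.Feasible π C Ka K' t t' ω x.1 x.2},
      Real.exp (s.L * x.1.2 * s.n * ν
        + s.L * (x.1.1 * logDet (s.F'' C Ka K') - x.1.2 * logDet (s.F C Ka)
          - x.1.1 * logDet (s.F' C Ka K' t t') + x.1.2 * ω * logDet (s.F₁ C Ka K' t)
          - logDet (s.B C Ka K' t t' ω x.1.1 x.1.2)))
        * s.expb π Ka K' t t' ω x.1.1 x.1.2 ∂s.codebookLaw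

/-- `m`. -/
def Params.m (Ka K' t : ℕ) : ℕ := min s.n (t + s.missed Ka K')

/-- The term `q₂` when there is some misdetection. If `ω > 0` and `b₁ = -∞` then the argument of the
incomplete gamma function is `-∞` and its value is `0`. -/
def Params.q2 (π : ℕ → ℝ) (Ka K' t : ℕ) (ω ν : ℝ) : ℝ :=
  (Ka.choose (t + s.missed Ka K') : ℝ) * ⨅ δ : {δ : ℝ // 0 ≤ δ},
    (upperGamma (s.n * s.L) (s.n * s.L * (1 + δ.1)) / Real.Gamma (s.n * s.L)
      + ∫ C, (if 0 < ω ∧ s.eb₁ π Ka K' t = 0 then 0 else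
          lowerGammaRatio (s.L * s.m Ka K' t)
            (s.n * s.L * (1 + δ.1) * (1 - ω)
              - ω * (s.L * logDet (s.F₁ C Ka K' t) - Real.log (s.eb₁ π Ka K' t))
              + s.L * logDet (s.F C Ka) - Real.log (s.eb π Ka) - s.n * s.L * ν)
            (ω * geomEig (s.m Ka K' t) ((s.F₁ C Ka K' t)⁻¹ *
              (subCode C (s.W₁ Ka K' t) * (subCode C (s.W₁ Ka K' t))ᴴ)))) ∂s.codebookLaw)

/-- The term `q₂` when there is no misdetection; it vanishes at `ω = 1`, where the argument of the
incomplete gamma function is read as `+∞`. -/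
def Params.q20 (π : ℕ → ℝ) (Ka : ℕ) (ω ν : ℝ) : ℝ :=
  if ω = 1 then 0 else
    ∫ C, upperGamma (s.n * s.L)
      (s.n * s.L * ν / (1 - ω) - s.L * logDet (s.F C Ka) + Real.log (s.eb π Ka))
      / Real.Gamma (s.n * s.L) ∂s.codebookLaw

/-- The bound on the probability of `t` additional misdetections and `t'` additional false alarms,
given that there are `Ka` active users and the estimate is `K'`. -/
def Params.pErr (π : ℕ → ℝ) (Ka K' t t' : ℕ) : ℝ :=
  ⨅ x : {x : ℝ × ℝ // 0 ≤ x.1 ∧ x.1 ≤ 1 ∧ 0 ≤ x.2},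
    (s.q1 π Ka K' t t' x.1.1 x.1.2
      + if 0 < t + s.missed Ka K' then s.q2 π Ka K' t x.1.1 x.1.2 else s.q20 π Ka x.1.1 x.1.2)

/-! The index sets. All differences below are either positive parts, for which natural subtraction
is meant, or nonnegative whenever `Ka, Ku ≤ M`. -/

/-- The range of `t`. -/
def Params.T (Ka K' : ℕ) : Finset ℕ :=
  Finset.Icc 0 (min (min Ka (s.hi K')) (s.M - s.lo K' - s.missed Ka K'))

/-- Upper end of the range of `t'`. -/
def Params.Tupper (Ka K' t : ℕ) : ℕ :=
  min ((s.hi K' - Ka) - s.extra Ka K' + t) (s.M - max Ka (s.lo K'))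

/-- The range of `t'` for misdetection. -/
def Params.TMD (Ka K' t : ℕ) : Finset ℕ :=
  Finset.Icc ((s.missed Ka K' + t) - (Ka - s.lo K')) (s.Tupper Ka K' t)

/-- The range of `t'` for false alarm. -/
def Params.TFA (Ka K' t : ℕ) : Finset ℕ :=
  Finset.Icc ((s.missed Ka K' + max (s.lo K') 1 + t) - (s.extra Ka K' + Ka)) (s.Tupper Ka K' t)

/-- The bound on the misdetection probability. -/
def Params.boundMD (π : ℕ → ℝ) : ℝ :=
  s.p0 π + ∑ Ka ∈ Finset.Icc (max s.Kl 1) s.Ku, π Ka * ∑ K' ∈ Finset.Icc s.Kl s.Ku,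
    ∑ t ∈ s.T Ka K', ((t + s.missed Ka K' : ℕ) : ℝ) / Ka *
      min 1 (min (∑ t' ∈ s.TMD Ka K' t, s.pErr π Ka K' t t') (s.pEst Ka K'))

/-- The bound on the false-alarm probability. -/
def Params.boundFA (π : ℕ → ℝ) : ℝ :=
  s.p0 π + ∑ Ka ∈ Finset.Icc s.Kl s.Ku, π Ka * ∑ K' ∈ Finset.Icc s.Kl s.Ku,
    ∑ t ∈ s.T Ka K', ∑ t' ∈ s.TFA Ka K' t,
      ((t' + s.extra Ka K' : ℕ) : ℝ) / (s.listSize Ka K' t t' : ℕ) *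
        min 1 (min (s.pErr π Ka K' t t') (s.pEst Ka K'))

end URA

end

noncomputable section

namespace URA

open scoped ComplexOrder

/-! The codebook is itself the common randomness, so no good realization has to be selected: both
error measures are averages over the ensemble, and it suffices to bound them. The term `p0` pays for
three idealizations: the transmitted codewords satisfy the power constraint, the number of active
users lies in `[Kl : Ku]`, and the active users send distinct messages. Under these idealizations
the list of transmitted messages is a set `W` with `Ka` elements.

Given the codebook, the columns of the received signal are then independent complex Gaussian vectors
with covariance `F`, the `cov` of `W`. One formula drives the analysis: for Hermitian `Q` with `F⁻¹
- Q` positive definite, the exponential of tr(Yᴴ Q Y) has mean det(1 - Q F)^(-L)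
(`lintegral_exp_quad_received`). It yields every Chernoff bound. Evaluated along real multiples of a
fixed `Q` it also determines the law of the quadratic form, because exponential moments near 0
determine a law (`ext_of_expMoment`). For `Q = F⁻¹` this law is Gamma with shape nL. For `Q = F₁⁻¹ -
F⁻¹` it is a sum of independent exponentials whose means are the nonzero eigenvalues of `F₁⁻¹ (F -
F₁)`, each repeated L times. Among such sums with a given product of the means, the distribution
function is largest when all means agree (`expSum_Iic_le`); hence the lower incomplete gamma
function of the geometric mean in `q2`.

The energy detector outputs `K'` only if the energy is on the correct side of the midpoints towards
the neighbouring candidates, and Chernoff bounds with multiples of the identity give `pEst`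
(`fullLaw_isEstimate_le`). For the decoder, an error pattern is a pair of missed messages `T₁` and
extra messages `T₂`. Following Fano, one splits according to the event `Good`, which compares the
metric of `W` with ω times that of `W \ T₁` plus a threshold. On `Good`, the decoded list also beats
a reference list of admissible size; u times the latter inequality plus r times the former is a
single quadratic inequality, whose Chernoff bound is `q1` (`fullLaw_prefer_le`). Off `Good`, either
the Gamma variable is atypically large or the excess form is atypically small, which gives `q2`
(`fullLaw_not_good_le`). Exchangeability of the codewords reduces each pattern to the canonical one,
and a union bound over patterns gives `pErr` (`fullLaw_err_le`). Finally the error fractions, which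
are fixed by the numbers of missed and extra messages, are averaged against these probabilities. -/

/-! ### Sums of independent exponential variables -/

/-- The exponential moment of a measure on the line. -/
def expMoment (μ : Measure ℝ) (θ : ℝ) : ℝ≥0∞ := ∫⁻ x, ENNReal.ofReal (Real.exp (θ * x)) ∂μ

theorem mem_integrableExpSet_of_expMoment_ne_top {μ : Measure ℝ} {θ : ℝ}
    (h : expMoment μ θ ≠ ∞) : θ ∈ integrableExpSet id μ := by
  refine ⟨by fun_prop, ?_⟩
  rw [hasFiniteIntegral_iff_ofReal (by filter_upwards with x using (Real.exp_pos _).le)]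
  exact lt_top_iff_ne_top.2 h

theorem mgf_id_eq_toReal_expMoment (μ : Measure ℝ) (θ : ℝ) :
    mgf id μ θ = (expMoment μ θ).toReal :=
  integral_eq_lintegral_of_nonneg_ae (by filter_upwards with x using (Real.exp_pos _).le)
    (by fun_prop)

/-- Finite moments near 0 make both complex moment generating functions analytic on the strip |Re z|
< ε. They agree on a real interval, hence on the strip by the identity theorem, and on the imaginary
axis they are the characteristic functions. -/
theorem ext_of_expMoment {μ ν : Measure ℝ} [IsProbabilityMeasure μ] [IsProbabilityMeasure ν]
    {ε : ℝ} (hε : 0 < ε) (hfin : ∀ θ, |θ| < ε → expMoment μ θ ≠ ∞)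
    (h : ∀ θ, |θ| < ε → expMoment μ θ = expMoment ν θ) : μ = ν := by
  have hsub (ρ : Measure ℝ) (hρ : ∀ θ, |θ| < ε → expMoment ρ θ ≠ ∞) :
      Set.Ioo (-ε) ε ⊆ interior (integrableExpSet id ρ) :=
    interior_maximal (fun θ hθ => mem_integrableExpSet_of_expMoment_ne_top (hρ θ (abs_lt.2 hθ)))
      isOpen_Ioo
  have hν : ∀ θ, |θ| < ε → expMoment ν θ ≠ ∞ := fun θ hθ => h θ hθ ▸ hfin θ hθ
  have hana (ρ : Measure ℝ) (hρ : ∀ θ, |θ| < ε → expMoment ρ θ ≠ ∞) :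
      AnalyticOnNhd ℂ (complexMGF id ρ) {z | z.re ∈ Set.Ioo (-ε) ε} :=
    analyticOnNhd_complexMGF.mono fun z hz => hsub ρ hρ hz
  have heq : Set.EqOn (complexMGF id μ) (complexMGF id ν) {z | z.re ∈ Set.Ioo (-ε) ε} := by
    refine AnalyticOnNhd.eqOn_of_preconnected_of_frequently_eq (hana μ hfin) (hana ν hν)
      ((convex_Ioo (-ε) ε).linear_preimage Complex.reLm).isPreconnected
      (z₀ := 0) (by simp [hε]) ?_
    have hreal : ∃ᶠ x : ℝ in nhdsWithin 0 {0}ᶜ, complexMGF id μ x = complexMGF id ν x := by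
      refine Filter.Eventually.frequently ?_
      filter_upwards [mem_nhdsWithin_of_mem_nhds (Ioo_mem_nhds (neg_lt_zero.2 hε) hε)] with x hx
      rw [complexMGF_ofReal, complexMGF_ofReal, mgf_id_eq_toReal_expMoment,
        mgf_id_eq_toReal_expMoment, h x (abs_lt.2 hx)]
    have htend : Filter.Tendsto (fun x : ℝ => (x : ℂ)) (nhdsWithin 0 {0}ᶜ)
        (nhdsWithin 0 {0}ᶜ) := by
      refine tendsto_nhdsWithin_iff.2 ⟨?_, ?_⟩
      · exact (Complex.continuous_ofReal.tendsto' 0 0 (by simp)).mono_left nhdsWithin_le_nhds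
      · filter_upwards [self_mem_nhdsWithin] with x hx
        simpa using hx
    exact htend.frequently hreal
  refine Measure.ext_of_charFun (funext fun t => ?_)
  have := heq (x := t * Complex.I) (by simp [hε])
  simpa [complexMGF, charFun_apply_real, mul_comm, mul_left_comm] using this

/-- The law of a sum of independent exponential variables with the given means. -/
def expSum : List ℝ → Measure ℝ
  | [] => Measure.dirac 0
  | a :: l => (expMeasure a⁻¹).conv (expSum l)

theorem isProbabilityMeasure_expSum {l : List ℝ} (hl : ∀ a ∈ l, 0 < a) :
    IsProbabilityMeasure (expSum l) := by
  induction l with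
  | nil => exact inferInstanceAs (IsProbabilityMeasure (Measure.dirac (0 : ℝ)))
  | cons a l ih =>
    have := ih fun b hb => hl b (by simp [hb])
    have := isProbabilityMeasure_expMeasure (inv_pos.2 (hl a (by simp)))
    exact inferInstanceAs (IsProbabilityMeasure ((expMeasure a⁻¹).conv (expSum l)))

theorem expSum_perm {l l' : List ℝ} (h : l.Perm l') (hl : ∀ a ∈ l, 0 < a) :
    expSum l = expSum l' := by
  induction h with
  | nil => rfl
  | cons a h ih => rw [expSum, expSum, ih fun b hb => hl b (by simp [hb])]
  | swap a b l =>
    have := isProbabilityMeasure_expSum (l := l) fun c hc => hl c (by simp [hc])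
    have := isProbabilityMeasure_expMeasure (inv_pos.2 (hl a (by simp)))
    have := isProbabilityMeasure_expMeasure (inv_pos.2 (hl b (by simp)))
    simp only [expSum]
    rw [← Measure.conv_assoc, ← Measure.conv_assoc, Measure.conv_comm (expMeasure b⁻¹)]
  | trans h₁ h₂ ih₁ ih₂ => rw [ih₁ hl, ih₂ fun a ha => hl a (h₁.mem_iff.2 ha)]

theorem expMoment_conv (μ ν : Measure ℝ) [SFinite μ] [SFinite ν] (θ : ℝ) :
    expMoment (μ.conv ν) θ = expMoment μ θ * expMoment ν θ := by
  unfold expMoment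
  rw [Measure.lintegral_conv (by fun_prop), ← lintegral_mul_const _ (by fun_prop)]
  refine lintegral_congr fun x => ?_
  rw [← lintegral_const_mul _ (by fun_prop)]
  refine lintegral_congr fun y => ?_
  rw [← ENNReal.ofReal_mul (Real.exp_pos _).le, ← Real.exp_add, mul_add]

/-- Exponential tilting maps the Gamma density of rate r to a constant times the one of rate r - θ.
-/
theorem expMoment_gammaMeasure {a r θ : ℝ} (ha : 0 < a) (hr : 0 < r) (hθ : θ < r) :
    expMoment (gammaMeasure a r) θ = ENNReal.ofReal ((r / (r - θ)) ^ a) := by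
  have hpos : 0 < r - θ := sub_pos.2 hθ
  have hpdf : Measurable (gammaPDF a r) := (measurable_gammaPDFReal a r).ennreal_ofReal
  have hpdf' : Measurable (gammaPDF a (r - θ)) :=
    (measurable_gammaPDFReal a (r - θ)).ennreal_ofReal
  unfold expMoment gammaMeasure
  rw [lintegral_withDensity_eq_lintegral_mul _ hpdf (by fun_prop)]
  have key : ∀ x, (gammaPDF a r * fun x => ENNReal.ofReal (Real.exp (θ * x))) x
      = ENNReal.ofReal ((r / (r - θ)) ^ a) * gammaPDF a (r - θ) x := by
    intro x
    simp only [Pi.mul_apply, gammaPDF]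
    rw [← ENNReal.ofReal_mul (gammaPDFReal_nonneg ha hr x), ← ENNReal.ofReal_mul (by positivity)]
    congr 1
    unfold gammaPDFReal
    split_ifs with hx
    · rw [Real.div_rpow hr.le hpos.le]
      have : Real.exp (-((r - θ) * x)) = Real.exp (-(r * x)) * Real.exp (θ * x) := by
        rw [← Real.exp_add]; ring_nf
      rw [this]
      have := (Real.rpow_pos_of_pos hpos a).ne'
      field_simp
    · simp
  simp_rw [key]
  rw [lintegral_const_mul _ hpdf', lintegral_gammaPDF_eq_one ha hpos, mul_one]

theorem expMoment_expSum {l : List ℝ} (hl : ∀ a ∈ l, 0 < a) {θ : ℝ} (hθ : ∀ a ∈ l, θ * a < 1) :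
    expMoment (expSum l) θ = ENNReal.ofReal (l.map fun a => (1 - θ * a)⁻¹).prod := by
  induction l with
  | nil => simp [expSum, expMoment]
  | cons a l ih =>
    have ha := hl a (by simp)
    have := isProbabilityMeasure_expSum (l := l) fun c hc => hl c (by simp [hc])
    have := isProbabilityMeasure_expMeasure (inv_pos.2 ha)
    have h1 := hθ a (by simp)
    have h2 : θ < a⁻¹ := by simpa using (lt_div_iff₀ ha).2 h1
    rw [expSum, expMoment_conv, ih (fun b hb => hl b (by simp [hb]))
      (fun b hb => hθ b (by simp [hb])), expMeasure, expMoment_gammaMeasure one_pos (by positivity) h2,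
      List.map_cons, List.prod_cons, ENNReal.ofReal_mul (inv_nonneg.2 (by linarith))]
    congr 2
    have : a⁻¹ - θ ≠ 0 := by linarith
    rw [Real.rpow_one]
    field_simp

theorem conv_Iic (μ ν : Measure ℝ) [SFinite μ] [SFinite ν] (y : ℝ) :
    (μ.conv ν) (Set.Iic y) = ∫⁻ x, ν (Set.Iic (y - x)) ∂μ := by
  rw [← lintegral_indicator_one measurableSet_Iic,
    Measure.lintegral_conv (measurable_one.indicator measurableSet_Iic)]
  refine lintegral_congr fun x => ?_
  rw [← lintegral_indicator_one measurableSet_Iic]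
  refine lintegral_congr fun z => ?_
  simp [Set.indicator_apply, le_sub_iff_add_le']

/-! ### The distribution function of a sum of two exponential variables -/

/-- `∫ x in 0..y, exp (x (1/b - 1/a))`. -/
def expSumAux (a b y : ℝ) : ℝ := ∫ x in (0 : ℝ)..y, Real.exp (x * (b⁻¹ - a⁻¹))

/-- The density of the sum of two independent exponential variables with means `a` and `b`. -/
def expSumDensity (a b y : ℝ) : ℝ := a⁻¹ * b⁻¹ * (Real.exp (-(y * b⁻¹)) * expSumAux a b y)

/-- The distribution function of the sum of two independent exponential variables with means `a`
and `b`. -/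
def expSumCdf (a b y : ℝ) : ℝ :=
  1 - Real.exp (-(y * a⁻¹)) - a⁻¹ * (Real.exp (-(y * b⁻¹)) * expSumAux a b y)

/-- Leaving this integral unevaluated treats a = b and a ≠ b uniformly; a closed form would divide
by 1/b - 1/a. Only derivatives are needed below. -/
theorem hasDerivAt_expSumAux (a b y : ℝ) :
    HasDerivAt (expSumAux a b) (Real.exp (y * (b⁻¹ - a⁻¹))) y :=
  (by fun_prop : Continuous fun x => Real.exp (x * (b⁻¹ - a⁻¹))).integral_hasStrictDerivAt 0 y
    |>.hasDerivAt

theorem hasDerivAt_exp_neg_mul (b y : ℝ) :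
    HasDerivAt (fun y => Real.exp (-(y * b))) (Real.exp (-(y * b)) * -b) y := by
  simpa using ((hasDerivAt_id y).mul_const b).neg.exp

theorem hasDerivAt_exp_mul_expSumAux (a b y : ℝ) :
    HasDerivAt (fun y => Real.exp (-(y * b⁻¹)) * expSumAux a b y)
      (Real.exp (-(y * a⁻¹)) - b⁻¹ * (Real.exp (-(y * b⁻¹)) * expSumAux a b y)) y := by
  convert! (hasDerivAt_exp_neg_mul b⁻¹ y).mul (hasDerivAt_expSumAux a b y) using 1
  have : Real.exp (-(y * a⁻¹)) = Real.exp (-(y * b⁻¹)) * Real.exp (y * (b⁻¹ - a⁻¹)) := by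
    rw [← Real.exp_add]; ring_nf
  rw [this]; ring

theorem hasDerivAt_expSumCdf (a b y : ℝ) :
    HasDerivAt (expSumCdf a b) (expSumDensity a b y) y := by
  convert! ((hasDerivAt_exp_neg_mul a⁻¹ y).const_sub 1).sub
    ((hasDerivAt_exp_mul_expSumAux a b y).const_mul a⁻¹) using 1
  unfold expSumDensity; ring

theorem hasDerivAt_expSumDensity (a b y : ℝ) :
    HasDerivAt (expSumDensity a b)
      (a⁻¹ * b⁻¹ * Real.exp (-(y * a⁻¹)) - b⁻¹ * expSumDensity a b y) y := by
  convert! (hasDerivAt_exp_mul_expSumAux a b y).const_mul (a⁻¹ * b⁻¹) using 1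
  unfold expSumDensity; ring

theorem expSumDensity_nonneg {a b y : ℝ} (ha : 0 < a) (hb : 0 < b) (hy : 0 ≤ y) :
    0 ≤ expSumDensity a b y := by
  have : 0 ≤ expSumAux a b y :=
    intervalIntegral.integral_nonneg hy fun x _ => (Real.exp_pos _).le
  unfold expSumDensity; positivity

/-- A function with `f 0 = 0` and `f + k f' ≥ 0` is nonnegative. -/
theorem nonneg_of_add_mul_deriv_nonneg {f f' : ℝ → ℝ} {k : ℝ} (hk : 0 < k) (h0 : f 0 = 0)
    (hf : ∀ y, HasDerivAt f (f' y) y) (h : ∀ y, 0 ≤ y → 0 ≤ f y + k * f' y) {y : ℝ} (hy : 0 ≤ y) :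
    0 ≤ f y := by
  -- The integrating factor is e^(y/k), written in the shape of `hasDerivAt_exp_neg_mul`: the
  -- derivative of e^(y/k) f is e^(y/k) k⁻¹ (f + k f').
  have hd : ∀ y, HasDerivAt (fun y => Real.exp (-(y * -k⁻¹)) * f y)
      (Real.exp (-(y * -k⁻¹)) * k⁻¹ * (f y + k * f' y)) y := by
    intro y
    convert! (hasDerivAt_exp_neg_mul (-k⁻¹) y).mul (hf y) using 1
    field_simp
  have hmono : MonotoneOn (fun y => Real.exp (-(y * -k⁻¹)) * f y) (Set.Ici 0) := by
    refine monotoneOn_of_deriv_nonneg (convex_Ici 0)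
      (fun y _ => (hd y).continuousAt.continuousWithinAt)
      (fun y _ => (hd y).differentiableAt.differentiableWithinAt) fun y hy => ?_
    rw [interior_Ici] at hy
    rw [(hd y).deriv]
    have := h y (le_of_lt hy)
    positivity
  have := hmono (Set.self_mem_Ici) hy hy
  simp only [h0, mul_zero] at this
  exact nonneg_of_mul_nonneg_right this (Real.exp_pos _)

theorem expSumCdf_zero (a b : ℝ) : expSumCdf a b 0 = 0 := by simp [expSumCdf, expSumAux]

theorem expSumDensity_zero (a b : ℝ) : expSumDensity a b 0 = 0 := by
  simp [expSumDensity, expSumAux]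

/-- For a fixed product of the means, the distribution function decreases in their sum. -/
theorem expSumCdf_le {a b c d y : ℝ} (ha : 0 < a) (hb : 0 < b) (hc : 0 < c) (hd : 0 < d)
    (hmul : a * b = c * d) (hadd : c + d ≤ a + b) (hy : 0 ≤ y) :
    expSumCdf a b y ≤ expSumCdf c d y := by
  -- With D the derivative, the distribution function G of the sum solves (1 + aD)(1 + bD) G = 1.
  have hode : ∀ {a b : ℝ} (_ : 0 < a) (_ : 0 < b) (y : ℝ),
      expSumCdf a b y + (a + b) * expSumDensity a b y + a * b *
        (a⁻¹ * b⁻¹ * Real.exp (-(y * a⁻¹)) - b⁻¹ * expSumDensity a b y) = 1 := by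
    intro a b ha hb y
    unfold expSumCdf expSumDensity
    field_simp
    ring
  have h0 : ∀ y, HasDerivAt (fun y => expSumCdf c d y - expSumCdf a b y)
      (expSumDensity c d y - expSumDensity a b y) y := fun y =>
    (hasDerivAt_expSumCdf c d y).sub (hasDerivAt_expSumCdf a b y)
  have h1 : ∀ y, HasDerivAt (fun y => expSumDensity c d y - expSumDensity a b y) _ y := fun y =>
    (hasDerivAt_expSumDensity c d y).sub (hasDerivAt_expSumDensity a b y)
  have h2 := fun y => (h0 y).add ((h1 y).const_mul b)
  rw [← sub_nonneg]
  -- Since ab = cd, applying (1 + aD)(1 + bD) to the difference of the two distribution functions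
  -- leaves (a + b - c - d) times the density for c, d, which is nonnegative. The two first-order
  -- factors are then inverted one at a time, each preserving nonnegativity.
  refine nonneg_of_add_mul_deriv_nonneg hb (by simp [expSumCdf_zero]) h0 (fun y hy => ?_) hy
  refine nonneg_of_add_mul_deriv_nonneg ha
    (by simp [expSumCdf_zero, expSumDensity_zero]) h2 (fun y hy => ?_) hy
  have e1 := hode ha hb y
  have e2 := hode hc hd y
  rw [← hmul] at e2
  have := mul_nonneg (sub_nonneg.2 hadd) (expSumDensity_nonneg hc hd hy)
  simp only [Pi.add_apply]
  linear_combination this - e2 + e1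

theorem expMeasure_Iic {a : ℝ} (ha : 0 < a) (y : ℝ) :
    expMeasure a⁻¹ (Set.Iic y) = if 0 ≤ y then ENNReal.ofReal (1 - Real.exp (-(y * a⁻¹))) else 0 := by
  have := isProbabilityMeasure_expMeasure (inv_pos.2 ha)
  rw [← ofReal_cdf, cdf_expMeasure_eq (inv_pos.2 ha)]
  split_ifs <;> simp [mul_comm]

theorem expMeasure_conv_Iic {a b : ℝ} (ha : 0 < a) (hb : 0 < b) (y : ℝ) :
    ((expMeasure a⁻¹).conv (expMeasure b⁻¹)) (Set.Iic y) =
      if 0 ≤ y then ENNReal.ofReal (expSumCdf a b y) else 0 := by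
  have := isProbabilityMeasure_expMeasure (inv_pos.2 ha)
  have := isProbabilityMeasure_expMeasure (inv_pos.2 hb)
  have hpdf : Measurable (exponentialPDF a⁻¹) :=
    (measurable_exponentialPDFReal a⁻¹).ennreal_ofReal
  have hm : expMeasure a⁻¹ = volume.withDensity (exponentialPDF a⁻¹) := rfl
  have hf : Measurable fun x => expMeasure b⁻¹ (Set.Iic (y - x)) :=
    (show Antitone fun x => expMeasure b⁻¹ (Set.Iic (y - x)) from fun x x' hx =>
      measure_mono (Set.Iic_subset_Iic.2 (by linarith))).measurable
  rw [conv_Iic, hm, lintegral_withDensity_eq_lintegral_mul _ hpdf hf]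
  have key : ∀ x, (exponentialPDF a⁻¹ * fun x => expMeasure b⁻¹ (Set.Iic (y - x))) x =
      (Set.Icc 0 y).indicator (fun x => ENNReal.ofReal (a⁻¹ * (Real.exp (-(x * a⁻¹)) -
        Real.exp (-(y * b⁻¹)) * Real.exp (x * (b⁻¹ - a⁻¹))))) x := by
    intro x
    rw [Pi.mul_apply, expMeasure_Iic hb, exponentialPDF_eq, Set.indicator_apply]
    by_cases hx : 0 ≤ x
    · by_cases hxy : x ≤ y
      · rw [if_pos hx, if_pos (sub_nonneg.2 hxy), if_pos ⟨hx, hxy⟩,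
          ← ENNReal.ofReal_mul (by positivity)]
        congr 1
        have : Real.exp (-(y * b⁻¹)) * Real.exp (x * (b⁻¹ - a⁻¹)) =
            Real.exp (-(x * a⁻¹)) * Real.exp (-((y - x) * b⁻¹)) := by
          rw [← Real.exp_add, ← Real.exp_add]; ring_nf
        rw [this, mul_comm a⁻¹ x]; ring
      · rw [if_neg (fun h => hxy (sub_nonneg.1 h)), mul_zero, if_neg (fun h => hxy h.2)]
    · rw [if_neg hx, ENNReal.ofReal_zero, zero_mul, if_neg (fun h => hx h.1)]
  simp_rw [key]
  rw [lintegral_indicator measurableSet_Icc]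
  split_ifs with hy
  · have hcont : Continuous fun x => a⁻¹ * (Real.exp (-(x * a⁻¹)) -
        Real.exp (-(y * b⁻¹)) * Real.exp (x * (b⁻¹ - a⁻¹))) := by fun_prop
    rw [← ofReal_integral_eq_lintegral_ofReal (hcont.integrableOn_Icc)]
    · congr 1
      rw [integral_Icc_eq_integral_Ioc, ← intervalIntegral.integral_of_le hy]
      rw [intervalIntegral.integral_eq_sub_of_hasDerivAt
        (f := fun x => -Real.exp (-(x * a⁻¹)) -
          a⁻¹ * (Real.exp (-(y * b⁻¹)) * expSumAux a b x)) _ (hcont.intervalIntegrable _ _)]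
      · simp [expSumCdf, expSumAux]; ring
      · intro x _
        convert! (hasDerivAt_exp_neg_mul a⁻¹ x).neg.sub
          (((hasDerivAt_expSumAux a b x).const_mul (Real.exp (-(y * b⁻¹)))).const_mul a⁻¹) using 1
        ring
    · filter_upwards [ae_restrict_mem measurableSet_Icc] with x hx
      have : Real.exp (-(y * b⁻¹)) * Real.exp (x * (b⁻¹ - a⁻¹)) ≤ Real.exp (-(x * a⁻¹)) := by
        rw [← Real.exp_add]
        refine Real.exp_le_exp.2 ?_
        have := mul_le_mul_of_nonneg_right hx.2 (inv_nonneg.2 hb.le)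
        linarith
      exact mul_nonneg (inv_nonneg.2 ha.le) (sub_nonneg.2 this)
  · rw [Set.Icc_eq_empty (by simpa using hy)]; simp

/-- For positive means with a given product `g ^ N`, the distribution function of the sum is
largest if all means are equal. -/
theorem expSum_Iic_le {g : ℝ} (hg : 0 < g) :
    ∀ (N : ℕ) (l : List ℝ), l.length = N → (∀ a ∈ l, 0 < a) → l.prod = g ^ N →
      ∀ y, expSum l (Set.Iic y) ≤ expSum (List.replicate N g) (Set.Iic y) := by
  intro N
  induction N with
  | zero => intro l hl _ _ y; rw [List.length_eq_zero_iff.1 hl]; simp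
  | succ N ih =>
    intro l hlen hpos hprod y
    have hgm := isProbabilityMeasure_expMeasure (inv_pos.2 hg)
    have hrep : ∀ k, IsProbabilityMeasure (expSum (List.replicate k g)) := fun k =>
      isProbabilityMeasure_expSum fun a ha => (List.eq_of_mem_replicate ha) ▸ hg
    -- Convolution with a common law preserves a pointwise order of distribution functions, so a
    -- mean equal to g can be split off and induction applies.
    have step : ∀ (l : List ℝ), l.length = N → (∀ a ∈ l, 0 < a) → l.prod = g ^ N →
        expSum (g :: l) (Set.Iic y) ≤ expSum (List.replicate (N + 1) g) (Set.Iic y) := by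
      intro l hl hp hpr
      have := isProbabilityMeasure_expSum hp
      have := hrep N
      rw [List.replicate_succ, expSum, expSum, conv_Iic, conv_Iic]
      exact lintegral_mono fun x => ih l hl hp hpr _
    by_cases hmem : g ∈ l
    · have hperm := List.perm_cons_erase hmem
      rw [expSum_perm hperm hpos]
      refine step _ (by simp [List.length_erase_of_mem hmem, hlen])
        (fun a ha => hpos a (List.mem_of_mem_erase ha)) ?_
      have := hperm.prod_eq
      rw [hprod, List.prod_cons, pow_succ'] at this
      exact (mul_left_cancel₀ hg.ne' this).symm
    -- In the remaining case no mean equals g, and since the product is a power of g, some mean lies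
    -- below g and another above.
    have hne : ∀ a ∈ l, a ≠ g := fun a ha h => hmem (h ▸ ha)
    have hne' : (Finset.univ : Finset (Fin l.length)).Nonempty :=
      Finset.univ_nonempty_iff.2 ⟨⟨0, by omega⟩⟩
    have hlt : ∃ a ∈ l, a < g := by
      by_contra! hcon
      have h1 : ∏ _i : Fin l.length, g < ∏ i : Fin l.length, l[i] :=
        Finset.prod_lt_prod_of_nonempty (fun _ _ => hg)
          (fun i _ => lt_of_le_of_ne (hcon _ (l.get_mem i)) (hne _ (l.get_mem i)).symm) hne'
      simp [Fin.prod_univ_getElem, hprod, hlen] at h1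
    have hgt : ∃ b ∈ l, g < b := by
      by_contra! hcon
      have h1 : ∏ i : Fin l.length, l[i] < ∏ _i : Fin l.length, g :=
        Finset.prod_lt_prod_of_nonempty (fun i _ => hpos _ (l.get_mem i))
          (fun i _ => lt_of_le_of_ne (hcon _ (l.get_mem i)) (hne _ (l.get_mem i))) hne'
      simp [Fin.prod_univ_getElem, hprod, hlen] at h1
    obtain ⟨a, hal, hag⟩ := hlt
    obtain ⟨b, hbl, hbg⟩ := hgt
    have ha := hpos a hal
    have hb := hpos b hbl
    have hbe : b ∈ l.erase a := (List.mem_erase_of_ne (by linarith)).2 hbl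
    set r := (l.erase a).erase b with hr
    have hperm : l.Perm (a :: b :: r) :=
      (List.perm_cons_erase hal).trans ((List.perm_cons_erase hbe).cons a)
    have hrpos : ∀ x ∈ r, 0 < x := fun x hx => hpos x (hperm.mem_iff.2 (by simp [hx]))
    have hrp := isProbabilityMeasure_expSum hrpos
    have hlen' := hperm.length_eq
    have hpr := hperm.prod_eq
    simp only [List.length_cons, List.prod_cons] at hlen' hpr
    -- The pair (a, b) is replaced by (g, ab/g): the product is kept, and the sum does not grow
    -- because (g - a)(b - g) ≥ 0. One of the means is now g.
    set c := a * b / g with hcdef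
    have hc : 0 < c := by positivity
    have hgc : g * c = a * b := by rw [hcdef]; field_simp
    have ham := isProbabilityMeasure_expMeasure (inv_pos.2 ha)
    have hbm := isProbabilityMeasure_expMeasure (inv_pos.2 hb)
    have hcm := isProbabilityMeasure_expMeasure (inv_pos.2 hc)
    have hadd : g + c ≤ a + b := by
      have : g * (g + c) ≤ g * (a + b) := by nlinarith
      exact le_of_mul_le_mul_left this hg
    calc expSum l (Set.Iic y) = expSum (a :: b :: r) (Set.Iic y) := by rw [expSum_perm hperm hpos]
      _ ≤ expSum (g :: c :: r) (Set.Iic y) := by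
        simp only [expSum]
        rw [← Measure.conv_assoc, ← Measure.conv_assoc, Measure.conv_comm _ (expSum r),
          Measure.conv_comm _ (expSum r), conv_Iic, conv_Iic]
        refine lintegral_mono fun x => ?_
        rw [expMeasure_conv_Iic ha hb, expMeasure_conv_Iic hg hc]
        split_ifs with h
        · exact ENNReal.ofReal_le_ofReal (expSumCdf_le ha hb hg hc hgc.symm hadd h)
        · exact le_rfl
      _ ≤ _ := step (c :: r) (by simp; omega)
          (by simp only [List.mem_cons, forall_eq_or_imp]; exact ⟨hc, hrpos⟩) ?_
    rw [List.prod_cons]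
    have : g * (c * r.prod) = g * g ^ N := by
      rw [← mul_assoc, hgc, mul_assoc, ← hpr, hprod, pow_succ']
    exact mul_left_cancel₀ hg.ne' this

/-- The sum of `N` independent exponential variables with the same mean is Gamma distributed. -/
theorem expSum_replicate {g : ℝ} (hg : 0 < g) {N : ℕ} (hN : 0 < N) :
    expSum (List.replicate N g) = gammaMeasure N g⁻¹ := by
  have hpos : ∀ a ∈ List.replicate N g, 0 < a := fun a ha => (List.eq_of_mem_replicate ha) ▸ hg
  have := isProbabilityMeasure_expSum hpos
  have hN' : (0 : ℝ) < N := by exact_mod_cast hN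
  have := isProbabilityMeasure_gammaMeasure hN' (inv_pos.2 hg)
  have hlt : ∀ θ, |θ| < g⁻¹ → θ < g⁻¹ := fun θ hθ => (le_abs_self θ).trans_lt hθ
  have hlt' : ∀ θ, |θ| < g⁻¹ → ∀ a ∈ List.replicate N g, θ * a < 1 := fun θ hθ a ha => by
    rw [List.eq_of_mem_replicate ha]
    simpa using (lt_div_iff₀ hg).1 ((hlt θ hθ).trans_eq (one_div g).symm)
  refine ext_of_expMoment (inv_pos.2 hg) (fun θ hθ => ?_) fun θ hθ => ?_
  · rw [expMoment_expSum hpos (hlt' θ hθ)]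
    exact ENNReal.ofReal_ne_top
  · rw [expMoment_expSum hpos (hlt' θ hθ), expMoment_gammaMeasure hN' (inv_pos.2 hg) (hlt θ hθ)]
    have : g⁻¹ - θ ≠ 0 := (sub_pos.2 (hlt θ hθ)).ne'
    have h2 : g⁻¹ / (g⁻¹ - θ) = (1 - θ * g)⁻¹ := by
      have : 1 - θ * g ≠ 0 := by
        intro h; apply this; field_simp; linarith
      field_simp
    rw [List.map_replicate, List.prod_replicate, h2, Real.rpow_natCast]

theorem integrableOn_gammaIntegrand {a : ℝ} (ha : 0 < a) :
    IntegrableOn (fun z : ℝ => z ^ (a - 1) * Real.exp (-z)) (Set.Ioi 0) := by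
  simpa [mul_comm] using Real.GammaIntegral_convergent ha

theorem gammaIntegrand_nonneg {a z : ℝ} (hz : 0 < z) : 0 ≤ z ^ (a - 1) * Real.exp (-z) := by
  positivity

theorem gammaMeasure_one_apply {a : ℝ} (ha : 0 < a) {s : Set ℝ} (hs : MeasurableSet s) :
    gammaMeasure a 1 s =
      ENNReal.ofReal ((∫ z in s ∩ Set.Ioi 0, z ^ (a - 1) * Real.exp (-z)) / Real.Gamma a) := by
  classical
  have hG := Real.Gamma_pos_of_pos ha
  rw [gammaMeasure, withDensity_apply _ hs, ← lintegral_indicator hs]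
  -- The density in `gammaPDF` also lives at 0, while the incomplete gamma integrals start after 0;
  -- the point is null.
  have key : ∀ᵐ x : ℝ, s.indicator (gammaPDF a 1) x = (s ∩ Set.Ioi 0).indicator
      (fun z => ENNReal.ofReal ((z ^ (a - 1) * Real.exp (-z)) / Real.Gamma a)) x := by
    filter_upwards [compl_mem_ae_iff.2 (measure_singleton (0 : ℝ))] with x hx
    have hx0 : x ≠ 0 := hx
    rw [Set.indicator_apply, Set.indicator_apply]
    by_cases hxs : x ∈ s
    · rcases lt_or_gt_of_ne hx0 with h | h
      · rw [if_pos hxs, if_neg (fun h' => absurd h'.2 (not_lt.2 h.le)), gammaPDF_of_neg h]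
      · rw [if_pos hxs, if_pos ⟨hxs, h⟩, gammaPDF_of_nonneg h.le]
        congr 1
        rw [Real.one_rpow, one_mul]
        ring
    · rw [if_neg hxs, if_neg (fun h' => hxs h'.1)]
  rw [lintegral_congr_ae key, lintegral_indicator (hs.inter measurableSet_Ioi), ← integral_div,
    ofReal_integral_eq_lintegral_ofReal]
  · exact ((integrableOn_gammaIntegrand ha).mono_set Set.inter_subset_right).div_const _
  · filter_upwards [ae_restrict_mem (hs.inter measurableSet_Ioi)] with x hx
    exact div_nonneg (gammaIntegrand_nonneg hx.2) hG.le

theorem gammaMeasure_one_Iic {a : ℝ} (ha : 0 < a) (y : ℝ) :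
    gammaMeasure a 1 (Set.Iic y) = ENNReal.ofReal (lowerGamma a y / Real.Gamma a) := by
  rw [gammaMeasure_one_apply ha measurableSet_Iic, Set.inter_comm, Set.Ioi_inter_Iic]
  rfl

theorem gammaMeasure_one_Ioi {a : ℝ} (ha : 0 < a) (y : ℝ) :
    gammaMeasure a 1 (Set.Ioi y) = ENNReal.ofReal (upperGamma a y / Real.Gamma a) := by
  rw [gammaMeasure_one_apply ha measurableSet_Ioi, Set.Ioi_inter_Ioi]
  rfl

/-- Comparing exponential moments replaces a change of variables in the density. -/
theorem gammaMeasure_eq_map {a r : ℝ} (ha : 0 < a) (hr : 0 < r) :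
    gammaMeasure a r = (gammaMeasure a 1).map fun x => r⁻¹ * x := by
  have := isProbabilityMeasure_gammaMeasure ha hr
  have := isProbabilityMeasure_gammaMeasure ha one_pos
  have : IsProbabilityMeasure ((gammaMeasure a 1).map fun x => r⁻¹ * x) :=
    Measure.isProbabilityMeasure_map (by fun_prop)
  have hlt : ∀ θ, |θ| < r → θ < r := fun θ hθ => (le_abs_self θ).trans_lt hθ
  refine ext_of_expMoment hr (fun θ hθ => ?_) fun θ hθ => ?_
  · rw [expMoment_gammaMeasure ha hr (hlt θ hθ)]
    exact ENNReal.ofReal_ne_top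
  · have h1 : θ * r⁻¹ < 1 := by rw [← div_eq_mul_inv, div_lt_one hr]; exact hlt θ hθ
    have h2 : expMoment ((gammaMeasure a 1).map fun x => r⁻¹ * x) θ =
        expMoment (gammaMeasure a 1) (θ * r⁻¹) := by
      unfold expMoment
      rw [lintegral_map (by fun_prop) (by fun_prop)]
      simp_rw [mul_assoc]
    rw [expMoment_gammaMeasure ha hr (hlt θ hθ), h2, expMoment_gammaMeasure ha one_pos h1]
    have h3 : r - θ ≠ 0 := (sub_pos.2 (hlt θ hθ)).ne'
    have h4 : r / (r - θ) = 1 / (1 - θ * r⁻¹) := by field_simp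
    rw [h4]

theorem gammaMeasure_Iic {a r : ℝ} (ha : 0 < a) (hr : 0 < r) (y : ℝ) :
    gammaMeasure a r (Set.Iic y) = ENNReal.ofReal (lowerGamma a (r * y) / Real.Gamma a) := by
  rw [gammaMeasure_eq_map ha hr, Measure.map_apply (by fun_prop) measurableSet_Iic,
    ← gammaMeasure_one_Iic ha]
  congr 1
  ext x
  simp [inv_mul_le_iff₀ hr]

/-! ### Exponential moments of quadratic forms of complex Gaussian vectors -/

open scoped MatrixOrder in
theorem exists_eq_conjTranspose_mul_self {ι : Type*} [Fintype ι] [DecidableEq ι]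
    {A : Matrix ι ι ℂ} (hA : A.PosDef) : ∃ S : Matrix ι ι ℂ, A = Sᴴ * S ∧ S.det ≠ 0 := by
  have hS : CFC.sqrt A * CFC.sqrt A = A := CFC.sqrt_mul_sqrt_self A hA.posSemidef.nonneg
  have hH : (CFC.sqrt A)ᴴ = CFC.sqrt A := (CFC.sqrt_nonneg A).isSelfAdjoint
  refine ⟨CFC.sqrt A, by rw [hH, hS], fun h => ?_⟩
  have := hA.det_pos
  rw [← hS, Matrix.det_mul, h, zero_mul] at this
  exact lt_irrefl _ this

/-- The density of `CN(0, 1)`. -/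
def complexGaussianDensity (z : ℂ) : ℝ := Real.pi⁻¹ * Real.exp (-‖z‖ ^ 2)

theorem complexGaussianDensity_nonneg (z : ℂ) : 0 ≤ complexGaussianDensity z := by
  unfold complexGaussianDensity; positivity

theorem measurable_complexGaussianDensity : Measurable complexGaussianDensity := by
  unfold complexGaussianDensity; fun_prop

instance (v : ℝ≥0) : IsProbabilityMeasure (complexGaussian v) :=
  Measure.isProbabilityMeasure_map (by fun_prop)

instance (p q : ℕ) : IsProbabilityMeasure (gaussianArray p q) := by
  unfold gaussianArray; infer_instance

theorem complexGaussian_one_eq_withDensity :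
    complexGaussian 1 = volume.withDensity fun z => ENNReal.ofReal (complexGaussianDensity z) := by
  have hv : (1 / 2 : ℝ≥0) ≠ 0 := by norm_num
  have hmap : (fun p : ℝ × ℝ => (p.1 : ℂ) + (p.2 : ℂ) * Complex.I) =
      Complex.measurableEquivRealProd.symm := by
    ext p; simp [Complex.measurableEquivRealProd_symm_apply, Complex.mk_eq_add_mul_I]
  unfold complexGaussian
  rw [gaussianReal_of_var_ne_zero _ hv, prod_withDensity (measurable_gaussianPDF _ _)
    (measurable_gaussianPDF _ _), hmap]
  have hvp := Complex.volume_preserving_equiv_real_prod.symm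
  ext s hs
  rw [Measure.map_apply (MeasurableEquiv.measurable _) hs, withDensity_apply _ hs,
    withDensity_apply _ (MeasurableEquiv.measurable _ hs),
    ← hvp.setLIntegral_comp_preimage hs measurable_complexGaussianDensity.ennreal_ofReal]
  refine lintegral_congr fun p => ?_
  rw [gaussianPDF, gaussianPDF, ← ENNReal.ofReal_mul (gaussianPDFReal_nonneg _ _ _)]
  congr 1
  have hn : ‖Complex.measurableEquivRealProd.symm p‖ ^ 2 = p.1 ^ 2 + p.2 ^ 2 := by
    rw [Complex.sq_norm, Complex.normSq_apply, Complex.measurableEquivRealProd_symm_apply]; ring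
  rw [complexGaussianDensity, hn, gaussianPDFReal, gaussianPDFReal]
  have h2 : (2 : ℝ) * ((1 / 2 : ℝ≥0) : ℝ) = 1 := by norm_num
  rw [mul_right_comm 2 Real.pi, h2, one_mul, div_one, div_one, sub_zero, sub_zero, neg_add,
    Real.exp_add]
  have : (√Real.pi)⁻¹ * (√Real.pi)⁻¹ = Real.pi⁻¹ := by
    rw [← mul_inv, Real.mul_self_sqrt Real.pi_pos.le]
  rw [← this]; ring

/-- The law of a vector with independent `CN(0, 1)` entries. -/
def stdGaussianVec (ι : Type*) [Fintype ι] : Measure (ι → ℂ) := Measure.pi fun _ => complexGaussian 1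

instance (ι : Type*) [Fintype ι] : IsProbabilityMeasure (stdGaussianVec ι) := by
  unfold stdGaussianVec; infer_instance

theorem integrable_complexGaussianDensity : Integrable complexGaussianDensity := by
  refine ⟨measurable_complexGaussianDensity.aestronglyMeasurable, ?_⟩
  rw [hasFiniteIntegral_iff_ofReal (by filter_upwards with x using complexGaussianDensity_nonneg x)]
  have := measure_univ (μ := complexGaussian 1)
  rw [complexGaussian_one_eq_withDensity, withDensity_apply _ MeasurableSet.univ,
    setLIntegral_univ] at this
  rw [this]; exact ENNReal.one_lt_top

theorem stdGaussianVec_eq_withDensity (ι : Type*) [Fintype ι] :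
    stdGaussianVec ι =
      volume.withDensity fun x => ENNReal.ofReal (∏ i, complexGaussianDensity (x i)) := by
  classical
  refine Measure.pi_eq fun s hs => ?_
  have hind : ∀ x : ι → ℂ, (Set.univ.pi s).indicator
      (fun x => ENNReal.ofReal (∏ i, complexGaussianDensity (x i))) x =
      ENNReal.ofReal (∏ i, (s i).indicator complexGaussianDensity (x i)) := by
    intro x
    rw [Set.indicator_apply]
    split_ifs with hx
    · congr 1
      exact Finset.prod_congr rfl fun i _ => (Set.indicator_of_mem (hx i trivial) _).symm
    · simp only [Set.mem_pi, Set.mem_univ, true_imp_iff, not_forall] at hx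
      obtain ⟨i, hi⟩ := hx
      rw [Finset.prod_eq_zero (Finset.mem_univ i) (Set.indicator_of_notMem hi _),
        ENNReal.ofReal_zero]
  have hnn : ∀ i z, 0 ≤ (s i).indicator complexGaussianDensity z := fun i z =>
    Set.indicator_nonneg (fun z _ => complexGaussianDensity_nonneg z) z
  have hint : ∀ i, Integrable ((s i).indicator complexGaussianDensity) := fun i =>
    integrable_complexGaussianDensity.indicator (hs i)
  rw [withDensity_apply _ (MeasurableSet.univ_pi hs), ← lintegral_indicator
    (MeasurableSet.univ_pi hs)]
  simp_rw [hind]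
  rw [volume_pi, ← ofReal_integral_eq_lintegral_ofReal (Integrable.fintype_prod hint)
    (by filter_upwards with x using Finset.prod_nonneg fun i _ => hnn i _), ← volume_pi,
    integral_fintype_prod_volume_eq_prod,
    ENNReal.ofReal_prod_of_nonneg fun i _ => integral_nonneg (hnn i)]
  refine Finset.prod_congr rfl fun i _ => ?_
  rw [complexGaussian_one_eq_withDensity, withDensity_apply _ (hs i), ← lintegral_indicator (hs i),
    ofReal_integral_eq_lintegral_ofReal (hint i) (by filter_upwards with x using hnn i x)]
  refine lintegral_congr fun z => ?_
  simp only [Set.indicator_apply]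
  split_ifs <;> simp

theorem prod_complexGaussianDensity {ι : Type*} [Fintype ι] (x : ι → ℂ) :
    ∏ i, complexGaussianDensity (x i) =
      Real.pi⁻¹ ^ Fintype.card ι * Real.exp (-(star x ⬝ᵥ x).re) := by
  simp only [complexGaussianDensity, Finset.prod_mul_distrib, Finset.prod_const, Finset.card_univ]
  rw [← Real.exp_sum, Finset.sum_neg_distrib]
  congr 3
  rw [dotProduct, Complex.re_sum]
  refine Finset.sum_congr rfl fun i _ => ?_
  rw [Pi.star_apply, Complex.star_def, mul_comm, Complex.mul_conj, Complex.ofReal_re, Complex.sq_norm]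

theorem det_mulVecLin_restrictScalars {ι : Type*} [Fintype ι] [DecidableEq ι] (S : Matrix ι ι ℂ) :
    LinearMap.det (S.mulVecLin.restrictScalars ℝ) = Complex.normSq S.det := by
  rw [LinearMap.det_restrictScalars, Algebra.norm_complex_apply, ← Matrix.toLin'_apply',
    LinearMap.det_toLin']

/-- Write 1 - R = SᴴS. The standard density times the exponential is the standard density at S g,
and the substitution has real Jacobian |det S|² = det(1 - R). -/
theorem lintegral_exp_quadForm_stdGaussianVec {ι : Type*} [Fintype ι] [DecidableEq ι]
    {R : Matrix ι ι ℂ} (hR : (1 - R).PosDef) :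
    ∫⁻ g, ENNReal.ofReal (Real.exp (star g ⬝ᵥ (R *ᵥ g)).re) ∂stdGaussianVec ι =
      ENNReal.ofReal (((1 - R).det.re)⁻¹) := by
  obtain ⟨S, hS, hdet⟩ := exists_eq_conjTranspose_mul_self hR
  set D : (ι → ℂ) → ℝ≥0∞ := fun x => ENNReal.ofReal (∏ i, complexGaussianDensity (x i)) with hD
  have hDm : Measurable D := (Finset.measurable_prod _ fun i _ =>
    measurable_complexGaussianDensity.comp (measurable_pi_apply i)).ennreal_ofReal
  have hD1 : ∫⁻ x, D x = 1 := by
    have := measure_univ (μ := stdGaussianVec ι)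
    rwa [stdGaussianVec_eq_withDensity, withDensity_apply _ MeasurableSet.univ,
      setLIntegral_univ] at this
  have hcont : Continuous fun g : ι → ℂ => (star g ⬝ᵥ (R *ᵥ g)).re := by fun_prop
  rw [stdGaussianVec_eq_withDensity, lintegral_withDensity_eq_lintegral_mul _ hDm
    (hcont.measurable.exp.ennreal_ofReal)]
  have key : ∀ g : ι → ℂ, (D * fun g => ENNReal.ofReal (Real.exp (star g ⬝ᵥ (R *ᵥ g)).re)) g =
      D (S *ᵥ g) := by
    intro g
    simp only [hD, Pi.mul_apply]
    rw [← ENNReal.ofReal_mul (Finset.prod_nonneg fun i _ => complexGaussianDensity_nonneg _),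
      prod_complexGaussianDensity, prod_complexGaussianDensity, mul_assoc, ← Real.exp_add]
    congr 3
    have : star (S *ᵥ g) ⬝ᵥ (S *ᵥ g) = star g ⬝ᵥ g - star g ⬝ᵥ (R *ᵥ g) := by
      rw [Matrix.star_mulVec, Matrix.dotProduct_mulVec, Matrix.vecMul_vecMul, ← hS,
        ← Matrix.dotProduct_mulVec, Matrix.sub_mulVec, Matrix.one_mulVec, dotProduct_sub]
    rw [this, Complex.sub_re]; ring
  simp_rw [key]
  have hdetR : LinearMap.det (S.mulVecLin.restrictScalars ℝ) ≠ 0 := by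
    rw [det_mulVecLin_restrictScalars]; simpa using hdet
  have hmap := Measure.map_linearMap_addHaar_eq_smul_addHaar (volume : Measure (ι → ℂ)) hdetR
  have hSm : Measurable (S.mulVecLin.restrictScalars ℝ) :=
    (by fun_prop : Continuous fun g : ι → ℂ => S *ᵥ g).measurable
  have := lintegral_map (μ := volume) hDm hSm
  rw [hmap, lintegral_smul_measure, hD1, det_mulVecLin_restrictScalars] at this
  simp only [LinearMap.coe_restrictScalars, Matrix.mulVecLin_apply] at this
  rw [← this, smul_eq_mul, mul_one, abs_of_nonneg (inv_nonneg.2 (Complex.normSq_nonneg _))]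
  rw [hS, Matrix.det_mul, Matrix.det_conjTranspose, Complex.star_def, mul_comm, Complex.mul_conj,
    Complex.ofReal_re]

/-! ### Exponential moments of quadratic forms of the received signal -/

/-- The quadratic form `re tr (Yᴴ Q Y)`. -/
def quad {n L : ℕ} (Q : Matrix (Fin n) (Fin n) ℂ) (Y : Fin n → Fin L → ℂ) : ℝ :=
  ((Matrix.of Y)ᴴ * Q * Matrix.of Y).trace.re

theorem quad_eq_sum {n L : ℕ} (Q : Matrix (Fin n) (Fin n) ℂ) (Y : Fin n → Fin L → ℂ) :
    quad Q Y = ∑ l, (star (fun i => Y i l) ⬝ᵥ (Q *ᵥ fun i => Y i l)).re := by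
  unfold quad
  rw [Matrix.trace, Complex.re_sum]
  refine Finset.sum_congr rfl fun l _ => ?_
  rw [Matrix.diag_apply, Matrix.mul_assoc, Matrix.mul_apply]
  rfl

theorem stdGaussianVec_map_curry (p q : ℕ) :
    (stdGaussianVec (Fin p × Fin q)).map (MeasurableEquiv.curry (Fin p) (Fin q) ℂ) =
      gaussianArray p q := by
  have := Measure.infinitePi_map_curry (fun (_ : Fin p) (_ : Fin q) => complexGaussian 1)
  simp only [Measure.infinitePi_eq_pi] at this
  exact this

theorem measurePreserving_gaussianArray_swap (p q : ℕ) :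
    MeasurePreserving (fun (X : Fin p → Fin q → ℂ) l i => X i l) (gaussianArray p q)
      (gaussianArray q p) := by
  refine ⟨by fun_prop, ?_⟩
  have hs := measurePreserving_arrowCongr' (fun _ : Fin p × Fin q => complexGaussian 1)
    (fun _ : Fin q × Fin p => complexGaussian 1) (Equiv.prodComm (Fin p) (Fin q))
    (MeasurableEquiv.refl ℂ) (fun _ => MeasurePreserving.id _)
  have hs' : (stdGaussianVec (Fin p × Fin q)).map
      (MeasurableEquiv.arrowCongr' (Equiv.prodComm (Fin p) (Fin q)) (MeasurableEquiv.refl ℂ)) =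
      stdGaussianVec (Fin q × Fin p) := hs.map_eq
  rw [← stdGaussianVec_map_curry, ← stdGaussianVec_map_curry, ← hs',
    Measure.map_map (by fun_prop) (by fun_prop), Measure.map_map (by fun_prop) (by fun_prop)]
  rfl

/-- The columns of the pair of fading and noise arrays are independent standard vectors. -/
theorem measurePreserving_columns (K n L : ℕ) :
    MeasurePreserving
      (fun (q : (Fin K → Fin L → ℂ) × (Fin n → Fin L → ℂ)) (l : Fin L) =>
        (Sum.elim (fun k => q.1 k l) (fun i => q.2 i l) : Fin K ⊕ Fin n → ℂ))
      ((gaussianArray K L).prod (gaussianArray n L))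
      (Measure.pi fun _ : Fin L => stdGaussianVec (Fin K ⊕ Fin n)) := by
  have h1 := (measurePreserving_gaussianArray_swap K L).prod
    (measurePreserving_gaussianArray_swap n L)
  have h2 := (measurePreserving_arrowProdEquivProdArrow (Fin K → ℂ) (Fin n → ℂ) (Fin L)
    (fun _ => stdGaussianVec (Fin K)) (fun _ => stdGaussianVec (Fin n))).symm
  have h3 := measurePreserving_pi
    (fun _ : Fin L => (stdGaussianVec (Fin K)).prod (stdGaussianVec (Fin n)))
    (fun _ : Fin L => stdGaussianVec (Fin K ⊕ Fin n))
    (fun _ => measurePreserving_sumPiEquivProdPi_symm (X := fun _ => ℂ)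
      (fun _ : Fin K ⊕ Fin n => complexGaussian 1))
  convert! (h3.comp h2).comp h1 using 1

theorem lintegral_pi_prod_same {ι E : Type*} [Fintype ι] [MeasurableSpace E] (μ : Measure E)
    [IsProbabilityMeasure μ] {f : E → ℝ≥0∞} (hf : Measurable f) :
    ∫⁻ x : ι → E, ∏ i, f (x i) ∂Measure.pi (fun _ => μ) = (∫⁻ y, f y ∂μ) ^ Fintype.card ι := by
  have hind : iIndepFun (fun i (x : ι → E) => f (x i)) (Measure.pi fun _ : ι => μ) :=
    iIndepFun_pi (X := fun _ => f) fun i => hf.aemeasurable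
  rw [lintegral_prod_eq_prod_lintegral_of_indepFun _ _ hind fun i => hf.comp (measurable_pi_apply i)]
  have : ∀ i, ∫⁻ x : ι → E, f (x i) ∂Measure.pi (fun _ => μ) = ∫⁻ y, f y ∂μ := fun i =>
    (measurePreserving_eval (fun _ : ι => μ) i).lintegral_comp hf
  simp [this]

theorem posDef_cov {n M : ℕ} (C : Fin M → Fin n → ℂ) (S : Finset (Fin M)) : (cov C S).PosDef :=
  Matrix.PosDef.one.add_posSemidef (Matrix.posSemidef_self_mul_conjTranspose _)

theorem cov_apply {n M : ℕ} (C : Fin M → Fin n → ℂ) (S : Finset (Fin M)) (i j : Fin n) :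
    cov C S i j = (1 : Matrix (Fin n) (Fin n) ℂ) i j + ∑ m ∈ S, C m i * star (C m j) := by
  rw [cov, Matrix.add_apply, Matrix.mul_apply, ← Finset.sum_coe_sort S]
  rfl

theorem exp_neg_mul_logDet {n : ℕ} (L : ℕ) {A : Matrix (Fin n) (Fin n) ℂ} (hA : 0 < A.det.re) :
    Real.exp (-(L * logDet A)) = (A.det.re)⁻¹ ^ L := by
  rw [logDet, Real.exp_neg, mul_comm, Real.exp_mul, Real.exp_log hA, Real.rpow_natCast, inv_pow]

/-- The columns of the matrix are the codewords of the active users. -/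
def activeCode {n M K : ℕ} (x : Fin M → Fin n → ℂ) (A : Finset (Fin K)) (w : Fin K → Fin M) :
    Matrix (Fin n) (Fin K) ℂ := Matrix.of fun i k => if k ∈ A then x (w k) i else 0

theorem activeCode_mul_conjTranspose {n M K : ℕ} (x : Fin M → Fin n → ℂ) {A : Finset (Fin K)}
    {w : Fin K → Fin M} (hw : Set.InjOn w A) :
    1 + activeCode x A w * (activeCode x A w)ᴴ = cov x (A.image w) := by
  ext i j
  rw [cov_apply, Matrix.add_apply, Matrix.mul_apply, Finset.sum_image hw]
  congr 1
  rw [← Finset.sum_filter_add_sum_filter_not Finset.univ (fun k => k ∈ A)]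
  rw [Finset.filter_mem_eq_inter, Finset.univ_inter, Finset.sum_congr rfl fun k hk => ?_,
    Finset.sum_eq_zero (s := Finset.univ.filter fun k => k ∉ A) fun k hk => ?_, add_zero]
  · have hk' : k ∉ A := (Finset.mem_filter.1 hk).2
    simp [activeCode, hk']
  · simp [activeCode, hk]

/-- With F = T Tᴴ, the matrix splits as (1 - TᴴF⁻¹T) + Tᴴ(F⁻¹ - Q)T. The first summand is an
orthogonal projection and the second is positive semidefinite. Sylvester's identity moves the
determinant to size n, where it equals det(F⁻¹ - Q) det F and does not vanish. -/
theorem posDef_one_sub_conj {n : ℕ} {ι : Type*} [Fintype ι] [DecidableEq ι]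
    (T : Matrix (Fin n) ι ℂ) {Q : Matrix (Fin n) (Fin n) ℂ} (hF : (T * Tᴴ).PosDef)
    (hQ : ((T * Tᴴ)⁻¹ - Q).PosDef) :
    (1 - Tᴴ * Q * T).PosDef ∧ (1 - Tᴴ * Q * T).det = (1 - Q * (T * Tᴴ)).det := by
  set F := T * Tᴴ with hFdef
  have hFu : IsUnit F.det := (Matrix.isUnit_iff_isUnit_det _).1 hF.isUnit
  have hdet : (1 - Tᴴ * Q * T).det = (1 - Q * F).det := by
    rw [Matrix.mul_assoc, Matrix.det_one_sub_mul_comm, Matrix.mul_assoc]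
  refine ⟨?_, hdet⟩
  have hFinv : (F⁻¹)ᴴ = F⁻¹ := hF.inv.isHermitian
  have hP : (1 - Tᴴ * F⁻¹ * T)ᴴ * (1 - Tᴴ * F⁻¹ * T) = 1 - Tᴴ * F⁻¹ * T := by
    have h1 : (1 - Tᴴ * F⁻¹ * T)ᴴ = 1 - Tᴴ * F⁻¹ * T := by
      rw [Matrix.conjTranspose_sub, Matrix.conjTranspose_one, Matrix.conjTranspose_mul,
        Matrix.conjTranspose_mul, Matrix.conjTranspose_conjTranspose, hFinv, Matrix.mul_assoc]
    have h2 : Tᴴ * F⁻¹ * T * (Tᴴ * F⁻¹ * T) = Tᴴ * F⁻¹ * T := by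
      calc Tᴴ * F⁻¹ * T * (Tᴴ * F⁻¹ * T) = Tᴴ * (F⁻¹ * (T * Tᴴ)) * F⁻¹ * T := by
            simp only [Matrix.mul_assoc]
        _ = _ := by rw [← hFdef, Matrix.nonsing_inv_mul _ hFu, Matrix.mul_one]
    rw [h1, Matrix.sub_mul, Matrix.mul_sub (Tᴴ * F⁻¹ * T), h2]
    simp
  have hsum : 1 - Tᴴ * Q * T = (1 - Tᴴ * F⁻¹ * T) + Tᴴ * (F⁻¹ - Q) * T := by
    rw [Matrix.mul_sub, Matrix.sub_mul]; abel
  have hpsd : (1 - Tᴴ * Q * T).PosSemidef := by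
    rw [hsum, ← hP]
    exact (Matrix.posSemidef_conjTranspose_mul_self _).add
      (hQ.posSemidef.conjTranspose_mul_mul_same T)
  refine hpsd.posDef_iff_det_ne_zero.2 ?_
  have : 1 - Q * F = (F⁻¹ - Q) * F := by rw [Matrix.sub_mul, Matrix.nonsing_inv_mul _ hFu]
  rw [hdet, this, Matrix.det_mul]
  exact mul_ne_zero hQ.det_pos.ne' hF.det_pos.ne'

theorem received_column {n L M K : ℕ} (x : Fin M → Fin n → ℂ) (A : Finset (Fin K))
    (w : Fin K → Fin M) (h : Fin K → Fin L → ℂ) (z : Fin n → Fin L → ℂ) (l : Fin L) :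
    (fun i => received x A w h z i l) =
      Matrix.fromCols (activeCode x A w) 1 *ᵥ Sum.elim (fun k => h k l) (fun i => z i l) := by
  rw [Matrix.fromCols_mulVec_sumElim, Matrix.one_mulVec]
  funext i
  simp only [received, Pi.add_apply, Matrix.mulVec, dotProduct, activeCode, Matrix.of_apply,
    ite_mul, zero_mul, Finset.sum_ite_mem, Finset.univ_inter]
  simp_rw [mul_comm]

/-- The source of all tail bounds. Each column of the received signal is T g with g standard
Gaussian, the L columns are independent, and T Tᴴ is the `cov` of the sent list because injectivity
rules out repeated codewords. -/
theorem lintegral_exp_quad_received {n L M K : ℕ} (x : Fin M → Fin n → ℂ) {A : Finset (Fin K)}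
    {w : Fin K → Fin M} (hw : Set.InjOn w A) {Q : Matrix (Fin n) (Fin n) ℂ}
    (hQ : ((cov x (A.image w))⁻¹ - Q).PosDef) :
    ∫⁻ q, ENNReal.ofReal (Real.exp (quad Q (received x A w q.1 q.2)))
        ∂((gaussianArray K L).prod (gaussianArray n L)) =
      ENNReal.ofReal (Real.exp (-(L * logDet (1 - Q * cov x (A.image w))))) := by
  set T : Matrix (Fin n) (Fin K ⊕ Fin n) ℂ := Matrix.fromCols (activeCode x A w) 1 with hT
  have hTT : T * Tᴴ = cov x (A.image w) := by
    rw [hT, Matrix.conjTranspose_fromCols_eq_fromRows_conjTranspose, Matrix.fromCols_mul_fromRows,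
      Matrix.conjTranspose_one, Matrix.mul_one, add_comm, activeCode_mul_conjTranspose x hw]
  rw [← hTT] at hQ ⊢
  obtain ⟨hpd, hdet⟩ := posDef_one_sub_conj T (hTT ▸ posDef_cov x _) hQ
  set f : (Fin K ⊕ Fin n → ℂ) → ℝ≥0∞ := fun g =>
    ENNReal.ofReal (Real.exp (star g ⬝ᵥ ((Tᴴ * Q * T) *ᵥ g)).re) with hf
  have hfm : Measurable f :=
    (by fun_prop : Continuous fun g : Fin K ⊕ Fin n → ℂ =>
      (star g ⬝ᵥ ((Tᴴ * Q * T) *ᵥ g)).re).measurable.exp.ennreal_ofReal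
  have key : ∀ q : (Fin K → Fin L → ℂ) × (Fin n → Fin L → ℂ),
      ENNReal.ofReal (Real.exp (quad Q (received x A w q.1 q.2))) =
        ∏ l, f (Sum.elim (fun k => q.1 k l) (fun i => q.2 i l)) := by
    intro q
    rw [quad_eq_sum, Real.exp_sum, ENNReal.ofReal_prod_of_nonneg fun _ _ => (Real.exp_pos _).le]
    refine Finset.prod_congr rfl fun l _ => ?_
    rw [received_column, ← hT, hf]
    simp only
    congr 3
    rw [Matrix.star_mulVec, Matrix.mulVec_mulVec, ← Matrix.dotProduct_mulVec, Matrix.mulVec_mulVec,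
      Matrix.mul_assoc]
  simp_rw [key]
  have hmp := (measurePreserving_columns K n L).lintegral_comp
    (f := fun y : Fin L → Fin K ⊕ Fin n → ℂ => ∏ l, f (y l))
    (Finset.measurable_prod _ fun l _ => hfm.comp (measurable_pi_apply l))
  have hpos : 0 < (1 - Q * (T * Tᴴ)).det.re := by
    rw [← hdet]; exact (Complex.pos_iff.1 hpd.det_pos).1
  rw [hmp, lintegral_pi_prod_same _ hfm, hf, lintegral_exp_quadForm_stdGaussianVec hpd, hdet,
    exp_neg_mul_logDet L hpos, ENNReal.ofReal_pow (inv_nonneg.2 hpos.le), Fintype.card_fin]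

/-! ### Diagonalizable matrices -/

/-- `A` is similar to the diagonal matrix with entries `d`. -/
def SimilarDiag {n : ℕ} (A : Matrix (Fin n) (Fin n) ℂ) (d : Fin n → ℝ) : Prop :=
  ∃ P : (Matrix (Fin n) (Fin n) ℂ)ˣ,
    A = P.val * Matrix.diagonal (fun i => (d i : ℂ)) * P⁻¹.val

namespace SimilarDiag

variable {n : ℕ} {A : Matrix (Fin n) (Fin n) ℂ} {d : Fin n → ℝ}

theorem one_add_smul (h : SimilarDiag A d) (a b : ℝ) :
    SimilarDiag ((a : ℂ) • (1 : Matrix (Fin n) (Fin n) ℂ) + (b : ℂ) • A) fun i => a + b * d i := by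
  obtain ⟨P, hP⟩ := h
  refine ⟨P, ?_⟩
  have hdiag : Matrix.diagonal (fun i => ((a + b * d i : ℝ) : ℂ)) =
      (a : ℂ) • (1 : Matrix (Fin n) (Fin n) ℂ) +
        (b : ℂ) • Matrix.diagonal fun i => (d i : ℂ) := by
    rw [← Matrix.diagonal_one, ← Matrix.diagonal_smul, ← Matrix.diagonal_smul,
      Matrix.diagonal_add]
    congr 1
    funext i
    simp
  rw [hdiag, Matrix.mul_add, Matrix.add_mul, Matrix.mul_smul, Matrix.mul_smul, Matrix.smul_mul,
    Matrix.smul_mul, ← hP, Matrix.mul_one, Units.mul_inv]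

theorem charpoly_eq (h : SimilarDiag A d) :
    A.charpoly = ∏ i, (Polynomial.X - Polynomial.C (d i : ℂ)) := by
  obtain ⟨P, hP⟩ := h
  rw [hP, Matrix.coe_units_inv, Matrix.charpoly_units_conj, Matrix.charpoly_diagonal]

theorem roots_charpoly (h : SimilarDiag A d) :
    A.charpoly.roots = Multiset.map (fun i => (d i : ℂ)) Finset.univ.val := by
  rw [h.charpoly_eq, Polynomial.roots_prod]
  · simp
  · simp [Finset.prod_ne_zero_iff, Polynomial.X_sub_C_ne_zero]

theorem det_eq (h : SimilarDiag A d) : A.det = ((∏ i, d i : ℝ) : ℂ) := by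
  obtain ⟨P, hP⟩ := h
  rw [hP, Matrix.det_units_conj, Matrix.det_diagonal, Complex.ofReal_prod]

theorem eigPos_iff (h : SimilarDiag A d) : EigPos A ↔ ∀ i, 0 < d i := by
  have : ∀ μ, μ ∈ spectrum ℂ A ↔ ∃ i, (d i : ℂ) = μ := by
    intro μ
    rw [Matrix.mem_spectrum_iff_isRoot_charpoly,
      ← Polynomial.mem_roots A.charpoly_monic.ne_zero, h.roots_charpoly]
    simp
  constructor
  · intro hA i
    simpa using hA _ ((this _).2 ⟨i, rfl⟩)
  · rintro hd μ hμ
    obtain ⟨i, rfl⟩ := (this μ).1 hμ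
    simpa using hd i

end SimilarDiag

theorem _root_.Matrix.IsHermitian.similarDiag {n : ℕ} {A : Matrix (Fin n) (Fin n) ℂ}
    (hA : A.IsHermitian) : SimilarDiag A hA.eigenvalues := by
  refine ⟨Unitary.toUnits hA.eigenvectorUnitary, ?_⟩
  conv_lhs => rw [hA.spectral_theorem, Unitary.conjStarAlgAut_apply]
  rfl

/-- The product of a positive definite and a Hermitian matrix is diagonalizable with real
eigenvalues, which have the signs of those of the second factor. -/
theorem similarDiag_mul {n : ℕ} {R V : Matrix (Fin n) (Fin n) ℂ} (hR : R.PosDef)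
    (hV : V.IsHermitian) : ∃ d, SimilarDiag (R * V) d ∧ (V.PosSemidef → ∀ i, 0 ≤ d i) ∧
      (V.PosDef ↔ ∀ i, 0 < d i) := by
  obtain ⟨S, hS, hdet⟩ := exists_eq_conjTranspose_mul_self hR
  have hSu : IsUnit S := (Matrix.isUnit_iff_isUnit_det _).2 (isUnit_iff_ne_zero.2 hdet)
  -- If R = SᴴS, then R V = Sᴴ (S V Sᴴ) (Sᴴ)⁻¹ is similar to a Hermitian matrix congruent to V.
  have hH : (S * V * Sᴴ).IsHermitian := by
    rw [Matrix.IsHermitian, Matrix.conjTranspose_mul, Matrix.conjTranspose_mul,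
      Matrix.conjTranspose_conjTranspose, hV.eq, Matrix.mul_assoc]
  refine ⟨hH.eigenvalues, ?_, fun h => (h.mul_mul_conjTranspose_same S).eigenvalues_nonneg, ?_⟩
  · obtain ⟨P, hP⟩ := hH.similarDiag
    have hSu' : IsUnit Sᴴ := by simpa [← Matrix.star_eq_conjTranspose] using hSu
    obtain ⟨U, hU⟩ := hSu'
    refine ⟨U * P, ?_⟩
    rw [mul_inv_rev, Units.val_mul, Units.val_mul]
    calc R * V = U.val * (S * V * Sᴴ) * U⁻¹.val := by
          rw [← hU, hS, ← hU]
          simp only [Matrix.mul_assoc, Units.mul_inv, Matrix.mul_one]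
      _ = _ := by
          rw [congrArg (fun X => U.val * X * U⁻¹.val) hP]
          simp only [Matrix.mul_assoc]
  · rw [← hH.posDef_iff_eigenvalues_pos]
    exact (Matrix.IsUnit.posDef_star_right_conjugate_iff hSu).symm

/-- G F and F G share their characteristic polynomial, so `similarDiag_mul` applies. This translates
the spectral constraints of the bounds into the positive definiteness that the moment formula
requires. -/
theorem eigPos_mul_iff {n : ℕ} {G F : Matrix (Fin n) (Fin n) ℂ} (hG : G.IsHermitian)
    (hF : F.PosDef) : EigPos (G * F) ↔ G.PosDef := by
  obtain ⟨d, hd, -, hpos⟩ := similarDiag_mul hF hG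
  rw [hpos, ← hd.eigPos_iff]
  unfold EigPos
  simp only [Matrix.mem_spectrum_iff_isRoot_charpoly, Matrix.charpoly_mul_comm G F]

theorem logDet_le_trace {n : ℕ} {H : Matrix (Fin n) (Fin n) ℂ} (hH : H.PosDef) :
    logDet H ≤ H.trace.re - n := by
  have hpos := hH.eigenvalues_pos
  rw [logDet, hH.isHermitian.similarDiag.det_eq, Complex.ofReal_re,
    Real.log_prod fun i _ => (hpos i).ne', hH.isHermitian.trace_eq_sum_eigenvalues, Complex.re_sum]
  calc ∑ i, Real.log (hH.isHermitian.eigenvalues i)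
      ≤ ∑ i, (hH.isHermitian.eigenvalues i - 1) :=
        Finset.sum_le_sum fun i _ => Real.log_le_sub_one_of_pos (hpos i)
    _ = _ := by simp

theorem isHermitian_real_smul {n : ℕ} {A : Matrix (Fin n) (Fin n) ℂ} (hA : A.IsHermitian) (a : ℝ) :
    ((a : ℂ) • A).IsHermitian := by
  rw [Matrix.IsHermitian, Matrix.conjTranspose_smul, hA.eq, Complex.star_def, Complex.conj_ofReal]

theorem inv_cov_mul_cov {n M : ℕ} (C : Fin M → Fin n → ℂ) (S : Finset (Fin M)) :
    (cov C S)⁻¹ * cov C S = 1 :=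
  Matrix.nonsing_inv_mul _ ((Matrix.isUnit_iff_isUnit_det _).1 (posDef_cov C S).isUnit)

theorem one_sub_smul_cov {n M : ℕ} (C : Fin M → Fin n → ℂ) (S : Finset (Fin M)) (ρ : ℝ) :
    1 - (ρ : ℂ) • cov C S = ((cov C S)⁻¹ - (ρ : ℂ) • 1) * cov C S := by
  rw [Matrix.sub_mul, inv_cov_mul_cov, Matrix.smul_mul, Matrix.one_mul]

/-- The eigenvalues of 1 - ρF are 1 - ρ(1 + λ), with λ running over those of F - 1. The range of ρ
in `pEst2` is thus exactly the domain of the moment formula for Q = ρ times the identity. -/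
theorem lt_inv_maxEig_iff {n M : ℕ} (hn : 1 ≤ n) (C : Fin M → Fin n → ℂ) (S : Finset (Fin M))
    {ρ : ℝ} (hρ : 0 ≤ ρ) :
    ρ < 1 / (1 + maxEig C S) ↔ ((cov C S)⁻¹ - (ρ : ℂ) • 1).PosDef := by
  have hne : Nonempty (Fin n) := ⟨⟨0, hn⟩⟩
  set hH := Matrix.isHermitian_mul_conjTranspose_self (subCode C S) with hHdef
  have hnn : ∀ i, 0 ≤ hH.eigenvalues i :=
    (Matrix.posSemidef_self_mul_conjTranspose (subCode C S)).eigenvalues_nonneg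
  have hmax : ∀ i, hH.eigenvalues i ≤ maxEig C S := fun i =>
    le_ciSup (Set.finite_range hH.eigenvalues).bddAbove i
  obtain ⟨j, hj⟩ : ∃ j, hH.eigenvalues j = maxEig C S := exists_eq_ciSup_of_finite
  have hm : 0 < 1 + maxEig C S := by linarith [hnn j, hmax j]
  have hG : ((cov C S)⁻¹ - (ρ : ℂ) • (1 : Matrix (Fin n) (Fin n) ℂ)).IsHermitian :=
    (posDef_cov C S).inv.isHermitian.sub (isHermitian_real_smul Matrix.isHermitian_one ρ)
  have hsim := hH.similarDiag.one_add_smul (1 - ρ) (-ρ)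
  have heq : ((1 - ρ : ℝ) : ℂ) • (1 : Matrix (Fin n) (Fin n) ℂ) +
      ((-ρ : ℝ) : ℂ) • (subCode C S * (subCode C S)ᴴ) = 1 - (ρ : ℂ) • cov C S := by
    rw [cov, smul_add]
    push_cast
    rw [sub_smul, one_smul, neg_smul]
    abel
  rw [heq] at hsim
  rw [← eigPos_mul_iff hG (posDef_cov C S), ← one_sub_smul_cov, hsim.eigPos_iff, lt_div_iff₀ hm]
  constructor
  · intro h i
    nlinarith [hmax i]
  · intro h
    have := h j
    rw [hj] at this
    linarith

/-! ### Laws of quadratic forms of the received signal -/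

/-- The joint law of the fading coefficients and of the noise. -/
def channelLaw (K n L : ℕ) : Measure ((Fin K → Fin L → ℂ) × (Fin n → Fin L → ℂ)) :=
  (gaussianArray K L).prod (gaussianArray n L)

instance (K n L : ℕ) : IsProbabilityMeasure (channelLaw K n L) := by
  unfold channelLaw; infer_instance

theorem continuous_quad {n L : ℕ} (Q : Matrix (Fin n) (Fin n) ℂ) :
    Continuous fun Y : Fin n → Fin L → ℂ => quad Q Y := by
  unfold quad
  have : Continuous fun Y : Fin n → Fin L → ℂ => (Matrix.of Y : Matrix (Fin n) (Fin L) ℂ) :=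
    continuous_id
  fun_prop

theorem continuous_received {n L M K : ℕ} (x : Fin M → Fin n → ℂ) (A : Finset (Fin K))
    (w : Fin K → Fin M) : Continuous fun q : (Fin K → Fin L → ℂ) × (Fin n → Fin L → ℂ) =>
      received x A w q.1 q.2 := by
  unfold received
  fun_prop

theorem quad_add {n L : ℕ} (Q Q' : Matrix (Fin n) (Fin n) ℂ) (Y : Fin n → Fin L → ℂ) :
    quad (Q + Q') Y = quad Q Y + quad Q' Y := by
  simp [quad, Matrix.mul_add, Matrix.add_mul]

theorem quad_sub {n L : ℕ} (Q Q' : Matrix (Fin n) (Fin n) ℂ) (Y : Fin n → Fin L → ℂ) :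
    quad (Q - Q') Y = quad Q Y - quad Q' Y := by
  simp [quad, Matrix.mul_sub, Matrix.sub_mul]

theorem quad_smul {n L : ℕ} (a : ℝ) (Q : Matrix (Fin n) (Fin n) ℂ) (Y : Fin n → Fin L → ℂ) :
    quad ((a : ℂ) • Q) Y = a * quad Q Y := by
  simp [quad]

theorem quad_one {n L : ℕ} (Y : Fin n → Fin L → ℂ) : quad 1 Y = ∑ i, ∑ l, ‖Y i l‖ ^ 2 := by
  rw [quad_eq_sum, Finset.sum_comm]
  refine Finset.sum_congr rfl fun l _ => ?_
  rw [Matrix.one_mulVec, dotProduct, Complex.re_sum]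
  refine Finset.sum_congr rfl fun i _ => ?_
  rw [Pi.star_apply, Complex.star_def, mul_comm, Complex.mul_conj, Complex.ofReal_re, Complex.sq_norm]

section Channel

variable {n L M K : ℕ} (x : Fin M → Fin n → ℂ) {A : Finset (Fin K)} {w : Fin K → Fin M}

/-- The Chernoff bound. -/
theorem channelLaw_nonneg_le (hw : Set.InjOn w A) {Q : Matrix (Fin n) (Fin n) ℂ}
    (hQ : ((cov x (A.image w))⁻¹ - Q).PosDef) (a : ℝ) :
    channelLaw K n L {q | 0 ≤ a + quad Q (received x A w q.1 q.2)} ≤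
      ENNReal.ofReal (Real.exp (a - L * logDet (1 - Q * cov x (A.image w)))) := by
  have hm : Measurable fun q : (Fin K → Fin L → ℂ) × (Fin n → Fin L → ℂ) =>
      quad Q (received x A w q.1 q.2) :=
    ((continuous_quad Q).comp (continuous_received x A w)).measurable
  have hmark := mul_meas_ge_le_lintegral (μ := channelLaw K n L)
    (f := fun q => ENNReal.ofReal (Real.exp (a + quad Q (received x A w q.1 q.2))))
    (by fun_prop) 1
  rw [one_mul] at hmark
  refine (measure_mono fun q hq => ?_).trans (hmark.trans_eq ?_)
  · simp only [Set.mem_ofPred_eq] at hq ⊢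
    rw [← ENNReal.ofReal_one]
    exact ENNReal.ofReal_le_ofReal (Real.one_le_exp hq)
  · simp_rw [Real.exp_add, ENNReal.ofReal_mul (Real.exp_pos _).le]
    rw [lintegral_const_mul _ (by fun_prop), channelLaw, lintegral_exp_quad_received x hw hQ,
      ← ENNReal.ofReal_mul (Real.exp_pos _).le, ← Real.exp_add, sub_eq_add_neg a]

theorem expMoment_map_quad (hw : Set.InjOn w A) (Q : Matrix (Fin n) (Fin n) ℂ) {θ : ℝ}
    (hQ : ((cov x (A.image w))⁻¹ - (θ : ℂ) • Q).PosDef) :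
    expMoment ((channelLaw K n L).map fun q => quad Q (received x A w q.1 q.2)) θ =
      ENNReal.ofReal (Real.exp (-(L * logDet (1 - (θ : ℂ) • (Q * cov x (A.image w)))))) := by
  have hm : Measurable fun q : (Fin K → Fin L → ℂ) × (Fin n → Fin L → ℂ) =>
      quad Q (received x A w q.1 q.2) :=
    ((continuous_quad Q).comp (continuous_received x A w)).measurable
  rw [← Matrix.smul_mul, ← lintegral_exp_quad_received x hw hQ, expMoment,
    lintegral_map (by fun_prop) hm]
  simp_rw [quad_smul]
  rfl

/-- Here Q F is the identity, so the moments are (1 - θ)^(-nL). -/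
theorem map_quad_inv_cov (hn : 1 ≤ n) (hL : 1 ≤ L) (hw : Set.InjOn w A) :
    (channelLaw K n L).map (fun q => quad (cov x (A.image w))⁻¹ (received x A w q.1 q.2)) =
      gammaMeasure (n * L) 1 := by
  have hm : Measurable fun q : (Fin K → Fin L → ℂ) × (Fin n → Fin L → ℂ) =>
      quad (cov x (A.image w))⁻¹ (received x A w q.1 q.2) :=
    ((continuous_quad _).comp (continuous_received x A w)).measurable
  have ha : (0 : ℝ) < n * L := by positivity
  have := isProbabilityMeasure_gammaMeasure ha one_pos
  have := Measure.isProbabilityMeasure_map (μ := channelLaw K n L) hm.aemeasurable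
  have key : ∀ θ : ℝ, |θ| < 1 → expMoment ((channelLaw K n L).map
      fun q => quad (cov x (A.image w))⁻¹ (received x A w q.1 q.2)) θ =
      expMoment (gammaMeasure (n * L) 1) θ := by
    intro θ hθ
    have hθ1 : θ < 1 := (le_abs_self θ).trans_lt hθ
    have h1 : 0 < 1 - θ := by linarith
    have hpd : ((cov x (A.image w))⁻¹ - (θ : ℂ) • (cov x (A.image w))⁻¹).PosDef := by
      have : (cov x (A.image w))⁻¹ - (θ : ℂ) • (cov x (A.image w))⁻¹ =
          ((1 - θ : ℝ) : ℂ) • (cov x (A.image w))⁻¹ := by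
        push_cast; rw [sub_smul, one_smul]
      rw [this]
      exact (posDef_cov x _).inv.smul (by exact_mod_cast h1)
    rw [expMoment_map_quad x hw _ hpd, expMoment_gammaMeasure ha one_pos hθ1, inv_cov_mul_cov]
    have hdet : (1 - (θ : ℂ) • (1 : Matrix (Fin n) (Fin n) ℂ)).det.re = (1 - θ) ^ n := by
      have : (1 - (θ : ℂ) • (1 : Matrix (Fin n) (Fin n) ℂ)) =
          ((1 - θ : ℝ) : ℂ) • (1 : Matrix (Fin n) (Fin n) ℂ) := by
        push_cast; rw [sub_smul, one_smul]
      rw [this, Matrix.det_smul, Matrix.det_one, mul_one, Fintype.card_fin, ← Complex.ofReal_pow,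
        Complex.ofReal_re]
    rw [exp_neg_mul_logDet L (by rw [hdet]; positivity), hdet]
    congr 1
    have : ((n : ℝ) * L) = ((n * L : ℕ) : ℝ) := by push_cast; rfl
    rw [this, Real.rpow_natCast, pow_mul, one_div, inv_pow, inv_pow, inv_pow]
  refine ext_of_expMoment one_pos (fun θ hθ => ?_) key
  rw [key θ hθ, expMoment_gammaMeasure ha one_pos ((le_abs_self θ).trans_lt hθ)]
  exact ENNReal.ofReal_ne_top

end Channel

/-! ### The excess quadratic form of a smaller list -/

theorem cov_sdiff_add {n M : ℕ} (C : Fin M → Fin n → ℂ) {S T : Finset (Fin M)} (h : T ⊆ S) :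
    cov C S = cov C (S \ T) + subCode C T * (subCode C T)ᴴ := by
  ext i j
  have : (subCode C T * (subCode C T)ᴴ) i j = ∑ m ∈ T, C m i * star (C m j) := by
    rw [Matrix.mul_apply, ← Finset.sum_coe_sort T]
    rfl
  rw [Matrix.add_apply, cov_apply, cov_apply, this, ← Finset.sum_sdiff h, add_assoc]

/-- The list contains every d i exactly L times, once per antenna. Products of arbitrary functions
over it cover both the moments and the product of the means. -/
theorem exists_list_prod {α : Type*} (s : Finset α) (L : ℕ) (d : α → ℝ) :
    ∃ l : List ℝ, l.length = L * s.card ∧ (∀ a ∈ l, ∃ i ∈ s, a = d i) ∧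
      ∀ f : ℝ → ℝ, (l.map f).prod = (∏ i ∈ s, f (d i)) ^ L := by
  induction L with
  | zero => exact ⟨[], by simp⟩
  | succ L ih =>
    obtain ⟨l, h1, h2, h3⟩ := ih
    refine ⟨s.toList.map d ++ l, ?_, ?_, ?_⟩
    · simp [h1]; ring
    · intro a ha
      rcases List.mem_append.1 ha with h | h
      · obtain ⟨i, hi, rfl⟩ := List.mem_map.1 h
        exact ⟨i, by simpa using hi, rfl⟩
      · exact h2 a h
    · intro f
      rw [List.map_append, List.prod_append, h3, List.map_map, pow_succ', ← Finset.prod_map_toList]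
      rfl

theorem geomEig_eq {n m : ℕ} {B : Matrix (Fin n) (Fin n) ℂ} {d : Fin n → ℝ}
    (h : SimilarDiag B d) : geomEig m B =
      if (Finset.univ.filter fun i => d i ≠ 0).card = m then
        (∏ i ∈ Finset.univ.filter (fun i => d i ≠ 0), d i) ^ (1 / (m : ℝ)) else 0 := by
  classical
  have h1 : B.charpoly.roots.filter (fun z => z ≠ 0) =
      Multiset.map (fun i => (d i : ℂ)) (Finset.univ.filter fun i => d i ≠ 0).val := by
    rw [h.roots_charpoly, Multiset.filter_map, Finset.filter_val]
    congr 1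
    refine Multiset.filter_congr fun i _ => ?_
    simp
  have h0 : geomEig m B = if Multiset.card (B.charpoly.roots.filter fun z => z ≠ 0) = m
      then (B.charpoly.roots.filter fun z => z ≠ 0).prod.re ^ (1 / (m : ℝ)) else 0 := by
    unfold geomEig
    congr!
  rw [h0, h1, Multiset.card_map, Finset.card_val]
  have h2 : (Multiset.map (fun i => (d i : ℂ)) (Finset.univ.filter fun i => d i ≠ 0).val).prod.re =
      ∏ i ∈ Finset.univ.filter (fun i => d i ≠ 0), d i := by
    have : (Multiset.map (fun i => (d i : ℂ)) (Finset.univ.filter fun i => d i ≠ 0).val).prod =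
        ((∏ i ∈ Finset.univ.filter (fun i => d i ≠ 0), d i : ℝ) : ℂ) := by
      rw [Complex.ofReal_prod]; rfl
    rw [this, Complex.ofReal_re]
  rw [h2]

/-- With F = F₁ + V one has (F₁⁻¹ - F⁻¹) F = F₁⁻¹V, so the moments are those of a sum of independent
exponentials with means the nonzero eigenvalues of F₁⁻¹V, each used L times. Their geometric mean is
g, and `expSum_Iic_le` compares the sum with a Gamma variable of shape Lm and scale g. The
hypothesis g ≠ 0 says that there are exactly m such eigenvalues. -/
theorem channelLaw_quad_sub_le {n L M K : ℕ} (x : Fin M → Fin n → ℂ) {A : Finset (Fin K)}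
    {w : Fin K → Fin M} (hL : 1 ≤ L) (hw : Set.InjOn w A) {T : Finset (Fin M)}
    (hT : T ⊆ A.image w) {m : ℕ} (hm : 1 ≤ m) {g : ℝ} (hg : g ≠ 0)
    (hgm : geomEig m ((cov x (A.image w \ T))⁻¹ * (subCode x T * (subCode x T)ᴴ)) = g) (y : ℝ) :
    0 < g ∧ channelLaw K n L {q | quad ((cov x (A.image w \ T))⁻¹ - (cov x (A.image w))⁻¹)
      (received x A w q.1 q.2) ≤ y} ≤
      ENNReal.ofReal (lowerGamma (L * m) (y / g) / Real.Gamma (L * m)) := by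
  set F := cov x (A.image w) with hF
  set F₁ := cov x (A.image w \ T) with hF₁
  set V := subCode x T * (subCode x T)ᴴ with hV
  have hadd : F = F₁ + V := cov_sdiff_add x hT
  have hFpd : F.PosDef := posDef_cov _ _
  have hF₁pd : F₁.PosDef := posDef_cov _ _
  have hVpsd : V.PosSemidef := Matrix.posSemidef_self_mul_conjTranspose _
  obtain ⟨d, hd, hd0, -⟩ := similarDiag_mul hF₁pd.inv hVpsd.isHermitian
  replace hd0 := hd0 hVpsd
  rw [geomEig_eq hd] at hgm
  set J := Finset.univ.filter (fun i => d i ≠ 0) with hJ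
  have hJcard : J.card = m := by
    by_contra h
    rw [if_neg h] at hgm
    exact hg hgm.symm
  rw [if_pos hJcard] at hgm
  have hdpos : ∀ i ∈ J, 0 < d i := fun i hi =>
    lt_of_le_of_ne (hd0 i) (Finset.mem_filter.1 hi).2.symm
  have hprod : 0 < ∏ i ∈ J, d i := Finset.prod_pos hdpos
  have hgpos : 0 < g := hgm ▸ Real.rpow_pos_of_pos hprod _
  refine ⟨hgpos, ?_⟩
  have hgpow : g ^ m = ∏ i ∈ J, d i := by
    rw [← hgm, ← Real.rpow_natCast, ← Real.rpow_mul hprod.le, one_div,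
      inv_mul_cancel₀ (by positivity), Real.rpow_one]
  obtain ⟨l, hlen, hlmem, hlprod⟩ := exists_list_prod J L d
  have hlpos : ∀ a ∈ l, 0 < a := fun a ha => by
    obtain ⟨i, hi, rfl⟩ := hlmem a ha
    exact hdpos i hi
  have hmeas : Measurable fun q : (Fin K → Fin L → ℂ) × (Fin n → Fin L → ℂ) =>
      quad (F₁⁻¹ - F⁻¹) (received x A w q.1 q.2) :=
    ((continuous_quad _).comp (continuous_received x A w)).measurable
  have := Measure.isProbabilityMeasure_map (μ := channelLaw K n L) hmeas.aemeasurable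
  have := isProbabilityMeasure_expSum hlpos
  have hexc : (F₁⁻¹ - F⁻¹) * F = F₁⁻¹ * V := by
    have h1 : F⁻¹ * F = 1 := inv_cov_mul_cov x _
    have h2 : F₁⁻¹ * F₁ = 1 := inv_cov_mul_cov x _
    rw [Matrix.sub_mul, h1, hadd, Matrix.mul_add, h2, add_sub_cancel_left]
  -- A positive strict bound on the eigenvalues: for |θ| < 1/D all the factors 1 - θ d i are
  -- positive, so the moments are finite.
  obtain ⟨D, hD1, hD⟩ : ∃ D : ℝ, 0 < D ∧ ∀ i, d i < D := by
    obtain ⟨D, hD⟩ := (Set.finite_range d).bddAbove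
    refine ⟨max D 0 + 1, by positivity, fun i => ?_⟩
    have : d i ≤ D := hD ⟨i, rfl⟩
    have := le_max_left D 0
    linarith
  have hsmall : ∀ θ : ℝ, |θ| < D⁻¹ → ∀ i, 0 < 1 - θ * d i := by
    intro θ hθ i
    have h1 : θ * d i ≤ |θ| * d i := mul_le_mul_of_nonneg_right (le_abs_self θ) (hd0 i)
    have h2 : |θ| * d i ≤ |θ| * D := mul_le_mul_of_nonneg_left (hD i).le (abs_nonneg θ)
    have h3 : |θ| * D < 1 := by simpa using (lt_div_iff₀ hD1).1 (hθ.trans_eq (one_div D).symm)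
    linarith
  have hlaw : (channelLaw K n L).map (fun q => quad (F₁⁻¹ - F⁻¹) (received x A w q.1 q.2)) =
      expSum l := by
    have hsumlt : ∀ θ : ℝ, |θ| < D⁻¹ → ∀ a ∈ l, θ * a < 1 := fun θ hθ a ha => by
      obtain ⟨i, hi, rfl⟩ := hlmem a ha
      linarith [hsmall θ hθ i]
    have key : ∀ θ : ℝ, |θ| < D⁻¹ → expMoment ((channelLaw K n L).map
        (fun q => quad (F₁⁻¹ - F⁻¹) (received x A w q.1 q.2))) θ = expMoment (expSum l) θ := by
      intro θ hθ
      have hsim := hd.one_add_smul 1 (-θ)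
      have heq : ((1 : ℝ) : ℂ) • (1 : Matrix (Fin n) (Fin n) ℂ) + ((-θ : ℝ) : ℂ) • (F₁⁻¹ * V) =
          1 - (θ : ℂ) • (F₁⁻¹ * V) := by
        push_cast
        rw [one_smul, neg_smul, sub_eq_add_neg]
      rw [heq] at hsim
      have hpos : ∀ i, 0 < 1 + -θ * d i := fun i => by linarith [hsmall θ hθ i]
      have hpd : (F⁻¹ - (θ : ℂ) • (F₁⁻¹ - F⁻¹)).PosDef := by
        have hherm : (F⁻¹ - (θ : ℂ) • (F₁⁻¹ - F⁻¹)).IsHermitian :=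
          hFpd.inv.isHermitian.sub (isHermitian_real_smul
            (hF₁pd.inv.isHermitian.sub hFpd.inv.isHermitian) θ)
        rw [← eigPos_mul_iff hherm hFpd, Matrix.sub_mul, Matrix.smul_mul, hexc,
          inv_cov_mul_cov]
        exact hsim.eigPos_iff.2 hpos
      have hdet : (1 - (θ : ℂ) • (F₁⁻¹ * V)).det.re = ∏ i, (1 + -θ * d i) := by
        rw [hsim.det_eq, Complex.ofReal_re]
      have hdetpos : 0 < ∏ i, (1 + -θ * d i) := Finset.prod_pos fun i _ => hpos i
      rw [expMoment_map_quad x hw _ hpd, ← hF, hexc, expMoment_expSum hlpos (hsumlt θ hθ),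
        exp_neg_mul_logDet L (hdet ▸ hdetpos), hdet, hlprod]
      congr 2
      -- The list carries only the nonzero eigenvalues; the zero ones contribute factors 1 to the
      -- determinant.
      rw [← Finset.prod_inv_distrib, hJ, Finset.prod_filter]
      refine Finset.prod_congr rfl fun i _ => ?_
      split_ifs with h
      · rw [neg_mul, ← sub_eq_add_neg]
      · rw [not_not.1 h]; simp
    refine ext_of_expMoment (inv_pos.2 hD1) (fun θ hθ => ?_) key
    rw [key θ hθ, expMoment_expSum hlpos (hsumlt θ hθ)]
    exact ENNReal.ofReal_ne_top
  have hle := expSum_Iic_le hgpos (L * m) l (hJcard ▸ hlen) hlpos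
    (by have := hlprod id; rw [List.map_id] at this; rw [this, mul_comm L, pow_mul, hgpow]; rfl) y
  have hset : channelLaw K n L {q | quad (F₁⁻¹ - F⁻¹) (received x A w q.1 q.2) ≤ y} =
      expSum l (Set.Iic y) := by
    rw [← hlaw, Measure.map_apply hmeas measurableSet_Iic]
    rfl
  rw [hset]
  refine hle.trans_eq ?_
  have hLm : (0 : ℝ) < L * m := by positivity
  rw [expSum_replicate hgpos (by positivity)]
  push_cast
  rw [gammaMeasure_Iic hLm (inv_pos.2 hgpos), inv_mul_eq_div]

/-! ### Measurability of functions of the codebook -/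

theorem continuous_cov {n M : ℕ} (S : Finset (Fin M)) :
    Continuous fun C : Fin M → Fin n → ℂ => cov C S := by
  refine continuous_matrix fun i j => ?_
  simp_rw [cov_apply]
  fun_prop

theorem continuous_subCode_mul {n M : ℕ} (S : Finset (Fin M)) :
    Continuous fun C : Fin M → Fin n → ℂ => subCode C S * (subCode C S)ᴴ := by
  have h := (continuous_cov (n := n) S).sub (continuous_const (y := (1 : Matrix (Fin n) (Fin n) ℂ)))
  exact h.congr fun C => by simp [cov]

theorem det_cov_re_pos {n M : ℕ} (C : Fin M → Fin n → ℂ) (S : Finset (Fin M)) :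
    0 < (cov C S).det.re := (Complex.pos_iff.1 (posDef_cov C S).det_pos).1

theorem continuous_logDet_cov {n M : ℕ} (S : Finset (Fin M)) :
    Continuous fun C : Fin M → Fin n → ℂ => logDet (cov C S) :=
  (Complex.continuous_re.comp (continuous_cov S).matrix_det).log fun C => (det_cov_re_pos C S).ne'

theorem continuous_inv_cov {n M : ℕ} (S : Finset (Fin M)) :
    Continuous fun C : Fin M → Fin n → ℂ => (cov C S)⁻¹ := by
  simp_rw [Matrix.inv_def, Ring.inverse_eq_inv']
  exact ((continuous_cov S).matrix_det.inv₀ fun C => (posDef_cov C S).det_pos.ne').smul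
    (continuous_cov S).matrix_adjugate

/-- The complement is the projection to X of a closed subset of X times the unit sphere. The sphere
is compact, so this projection is closed. -/
theorem isOpen_posDef {X : Type*} [TopologicalSpace X] {n : ℕ} {G : X → Matrix (Fin n) (Fin n) ℂ}
    (hG : Continuous G) (hH : ∀ x, (G x).IsHermitian) : IsOpen {x | (G x).PosDef} := by
  set Z : Set (X × Metric.sphere (0 : Fin n → ℂ) 1) :=
    {p | (star p.2.1 ⬝ᵥ (G p.1 *ᵥ p.2.1)).re ≤ 0} with hZ
  have hZc : IsClosed Z := by
    refine isClosed_le (Complex.continuous_re.comp ?_) continuous_const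
    exact (continuous_star.comp (continuous_subtype_val.comp continuous_snd)).dotProduct
      ((hG.comp continuous_fst).matrix_mulVec (continuous_subtype_val.comp continuous_snd))
  have himg := isClosedMap_fst_of_compactSpace Z hZc
  have : {x | (G x).PosDef} = (Prod.fst '' Z)ᶜ := by
    ext x
    simp only [Set.mem_ofPred_eq, Set.mem_compl_iff]
    constructor
    · rintro hx ⟨⟨x', v⟩, hv, rfl⟩
      have hv0 : v.1 ≠ 0 := by
        intro h
        have := v.2
        rw [h] at this
        simp at this
      exact absurd (hx.re_dotProduct_pos hv0) (not_lt.2 hv)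
    · intro hx
      refine Matrix.PosDef.of_dotProduct_mulVec_pos (hH x) fun v hv => ?_
      have hnorm : ‖v‖ ≠ 0 := norm_ne_zero_iff.2 hv
      set c : ℂ := ((‖v‖⁻¹ : ℝ) : ℂ) with hc
      have hsphere : c • v ∈ Metric.sphere (0 : Fin n → ℂ) 1 := by
        rw [mem_sphere_zero_iff_norm, norm_smul, hc, Complex.norm_real, norm_inv, norm_norm,
          inv_mul_cancel₀ hnorm]
      have hpos : 0 < (star (c • v) ⬝ᵥ (G x *ᵥ (c • v))).re := by
        by_contra hcon
        exact hx ⟨(x, ⟨c • v, hsphere⟩), not_lt.1 hcon, rfl⟩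
      have hstar : star c = c := by rw [hc, Complex.star_def, Complex.conj_ofReal]
      rw [star_smul, Matrix.mulVec_smul, smul_dotProduct, dotProduct_smul, hstar, smul_smul, hc,
        ← Complex.ofReal_mul, smul_eq_mul, Complex.re_ofReal_mul] at hpos
      have him : (star v ⬝ᵥ (G x *ᵥ v)).im = 0 := (hH x).im_star_dotProduct_mulVec_self v
      rw [Complex.pos_iff]
      exact ⟨(mul_pos_iff_of_pos_left (by positivity)).1 hpos, him.symm⟩
  rw [this]
  exact himg.isOpen_compl

/-- The infimum runs over an uncountable index set that varies with x, yet each set where it is < a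
is a union of open sets. Nonemptiness is needed because a real infimum over the empty set is 0. -/
theorem measurable_iInf_subtype {X ι : Type*} [TopologicalSpace X] [MeasurableSpace X]
    [OpensMeasurableSpace X] {p : X → ι → Prop} {f : X → ι → ℝ} (hne : ∀ x, ∃ i, p x i)
    (hf : ∀ x i, 0 ≤ f x i) (hp : ∀ i, IsOpen {x | p x i})
    (hc : ∀ i, ContinuousOn (fun x => f x i) {x | p x i}) :
    Measurable fun x => ⨅ i : {i // p x i}, f x i.1 := by
  refine measurable_of_Iio fun a => ?_
  have : (fun x => ⨅ i : {i // p x i}, f x i.1) ⁻¹' Set.Iio a =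
      ⋃ i, {x | p x i} ∩ (fun x => f x i) ⁻¹' Set.Iio a := by
    ext x
    have : Nonempty {i // p x i} := let ⟨i, hi⟩ := hne x; ⟨⟨i, hi⟩⟩
    have hb : BddBelow (Set.range fun i : {i // p x i} => f x i.1) :=
      ⟨0, by rintro _ ⟨i, rfl⟩; exact hf x i.1⟩
    simp only [Set.mem_preimage, Set.mem_Iio, Set.mem_iUnion, Set.mem_inter_iff, Set.mem_ofPred_eq]
    rw [ciInf_lt_iff hb]
    simp
  rw [this]
  exact (isOpen_iUnion fun i => (hc i).isOpen_inter_preimage (hp i) isOpen_Iio).measurableSet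

theorem posDef_one_add_smul_cov {n M : ℕ} (C : Fin M → Fin n → ℂ) (S : Finset (Fin M)) {ρ : ℝ}
    (hρ : 0 ≤ ρ) : (1 + (ρ : ℂ) • cov C S).PosDef :=
  Matrix.PosDef.one.add_posSemidef ((posDef_cov C S).posSemidef.smul (by exact_mod_cast hρ))

theorem det_re_pos {n : ℕ} {A : Matrix (Fin n) (Fin n) ℂ} (hA : A.PosDef) : 0 < A.det.re :=
  (Complex.pos_iff.1 hA.det_pos).1

theorem det_mul_re_pos {n : ℕ} {A B : Matrix (Fin n) (Fin n) ℂ} (hA : A.PosDef) (hB : B.PosDef) :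
    0 < (A * B).det.re := by
  rw [Matrix.det_mul]
  exact (Complex.pos_iff.1 (mul_pos hA.det_pos hB.det_pos)).1

theorem isOpen_posDef_inv_cov_sub {n M : ℕ} (S : Finset (Fin M)) (ρ : ℝ) :
    IsOpen {C : Fin M → Fin n → ℂ |
      ((cov C S)⁻¹ - (ρ : ℂ) • (1 : Matrix (Fin n) (Fin n) ℂ)).PosDef} :=
  isOpen_posDef ((continuous_inv_cov S).sub continuous_const) fun C =>
    (posDef_cov C S).inv.isHermitian.sub (isHermitian_real_smul Matrix.isHermitian_one ρ)

/-- The exponent matrix of the Chernoff bound for the decoder. -/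
def chernoffMatrix {n : ℕ} (F F₁ F' F'' : Matrix (Fin n) (Fin n) ℂ) (ω u r : ℝ) :
    Matrix (Fin n) (Fin n) ℂ :=
  (u : ℂ) • F''⁻¹ - (u : ℂ) • F'⁻¹ + ((r * ω : ℝ) : ℂ) • F₁⁻¹ - (r : ℂ) • F⁻¹

theorem isHermitian_inv_sub_chernoffMatrix {n : ℕ} {F F₁ F' F'' : Matrix (Fin n) (Fin n) ℂ}
    (hF : F.PosDef) (hF₁ : F₁.PosDef) (hF' : F'.PosDef) (hF'' : F''.PosDef) (ω u r : ℝ) :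
    (F⁻¹ - chernoffMatrix F F₁ F' F'' ω u r).IsHermitian := by
  have h := isHermitian_real_smul hF.inv.isHermitian
  have h₁ := isHermitian_real_smul hF₁.inv.isHermitian
  have h' := isHermitian_real_smul hF'.inv.isHermitian
  have h'' := isHermitian_real_smul hF''.inv.isHermitian
  exact hF.inv.isHermitian.sub ((((h'' u).sub (h' u)).add (h₁ (r * ω))).sub (h r))

namespace Params

variable (s : Params)

/-- Identifies `B` as 1 - Q F for the exponent matrix Q of the decoder, so that its determinant is
the one in the moment formula. -/
theorem B_eq_one_sub (C : s.Codebook) (Ka K' t t' : ℕ) (ω u r : ℝ) :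
    s.B C Ka K' t t' ω u r = 1 - chernoffMatrix (s.F C Ka) (s.F₁ C Ka K' t) (s.F' C Ka K' t t')
      (s.F'' C Ka K') ω u r * s.F C Ka := by
  have h : (s.F C Ka)⁻¹ * s.F C Ka = 1 := inv_cov_mul_cov _ _
  unfold B chernoffMatrix
  simp only [Matrix.sub_mul, Matrix.add_mul, Matrix.smul_mul, h]
  push_cast
  rw [add_smul, one_smul]
  abel

theorem B_eq_mul (C : s.Codebook) (Ka K' t t' : ℕ) (ω u r : ℝ) :
    s.B C Ka K' t t' ω u r = ((s.F C Ka)⁻¹ - chernoffMatrix (s.F C Ka) (s.F₁ C Ka K' t)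
      (s.F' C Ka K' t t') (s.F'' C Ka K') ω u r) * s.F C Ka := by
  have h : (s.F C Ka)⁻¹ * s.F C Ka = 1 := inv_cov_mul_cov _ _
  rw [B_eq_one_sub, Matrix.sub_mul, h]

theorem eigPos_B_iff (C : s.Codebook) (Ka K' t t' : ℕ) (ω u r : ℝ) :
    EigPos (s.B C Ka K' t t' ω u r) ↔ ((s.F C Ka)⁻¹ - chernoffMatrix (s.F C Ka) (s.F₁ C Ka K' t)
      (s.F' C Ka K' t t') (s.F'' C Ka K') ω u r).PosDef := by
  rw [B_eq_mul]
  exact eigPos_mul_iff (isHermitian_inv_sub_chernoffMatrix (posDef_cov _ _) (posDef_cov _ _)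
    (posDef_cov _ _) (posDef_cov _ _) ω u r) (posDef_cov _ _)

theorem isOpen_eigPos_B (Ka K' t t' : ℕ) (ω u r : ℝ) :
    IsOpen {C : s.Codebook | EigPos (s.B C Ka K' t t' ω u r)} := by
  simp_rw [eigPos_B_iff]
  refine isOpen_posDef ?_ fun C => isHermitian_inv_sub_chernoffMatrix (posDef_cov _ _)
    (posDef_cov _ _) (posDef_cov _ _) (posDef_cov _ _) ω u r
  unfold chernoffMatrix
  have h1 : Continuous fun C : s.Codebook => (s.F C Ka)⁻¹ := continuous_inv_cov _
  have h2 : Continuous fun C : s.Codebook => (s.F₁ C Ka K' t)⁻¹ := continuous_inv_cov _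
  have h3 : Continuous fun C : s.Codebook => (s.F' C Ka K' t t')⁻¹ := continuous_inv_cov _
  have h4 : Continuous fun C : s.Codebook => (s.F'' C Ka K')⁻¹ := continuous_inv_cov _
  fun_prop

theorem det_B_re_pos {C : s.Codebook} {Ka K' t t' : ℕ} {ω u r : ℝ}
    (h : EigPos (s.B C Ka K' t t' ω u r)) : 0 < (s.B C Ka K' t t' ω u r).det.re := by
  rw [B_eq_mul]
  exact det_mul_re_pos ((s.eigPos_B_iff C Ka K' t t' ω u r).1 h) (posDef_cov _ _)

theorem continuous_B (Ka K' t t' : ℕ) (ω u r : ℝ) :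
    Continuous fun C : s.Codebook => s.B C Ka K' t t' ω u r := by
  unfold B
  have h0 : Continuous fun C : s.Codebook => s.F C Ka := continuous_cov _
  have h2 : Continuous fun C : s.Codebook => (s.F₁ C Ka K' t)⁻¹ := continuous_inv_cov _
  have h3 : Continuous fun C : s.Codebook => (s.F' C Ka K' t t')⁻¹ := continuous_inv_cov _
  have h4 : Continuous fun C : s.Codebook => (s.F'' C Ka K')⁻¹ := continuous_inv_cov _
  fun_prop

theorem measurable_pEst1_integrand (Ka K' : ℕ) :
    Measurable fun C : s.Codebook => ⨅ ρ : {ρ : ℝ // 0 ≤ ρ},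
      Real.exp (ρ.1 * (s.n * s.L * (1 + ((K' : ℝ) + 1 / 2) * s.P'))
        - s.L * logDet (1 + (ρ.1 : ℂ) • cov C (msgs s.M 0 Ka))) := by
  refine measurable_iInf_subtype (p := fun _ (ρ : ℝ) => 0 ≤ ρ) (f := fun C ρ =>
      Real.exp (ρ * (s.n * s.L * (1 + ((K' : ℝ) + 1 / 2) * s.P'))
        - s.L * logDet (1 + (ρ : ℂ) • cov C (msgs s.M 0 Ka)))) (fun _ => ⟨0, le_rfl⟩)
      (fun _ _ => (Real.exp_pos _).le) (fun _ => isOpen_const) fun ρ C hρ => ?_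
  have hc : Continuous fun C : s.Codebook => logDet (1 + (ρ : ℂ) • cov C (msgs s.M 0 Ka)) := by
    have := continuous_cov (n := s.n) (msgs s.M 0 Ka)
    exact (Complex.continuous_re.comp (by fun_prop : Continuous fun C : s.Codebook =>
      (1 + (ρ : ℂ) • cov C (msgs s.M 0 Ka)).det)).log
      fun C => (det_re_pos (posDef_one_add_smul_cov C _ hρ)).ne'
  exact (continuous_const.sub (continuous_const.mul hc)).rexp.continuousWithinAt

theorem measurable_pEst2_integrand (hn : 1 ≤ s.n) (Ka K' : ℕ) :
    Measurable fun C : s.Codebook =>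
      ⨅ ρ : {ρ : ℝ // 0 ≤ ρ ∧ ρ < 1 / (1 + maxEig C (msgs s.M 0 Ka))},
      Real.exp (-ρ.1 * (s.n * s.L * (1 + ((K' : ℝ) - 1 / 2) * s.P'))
        - s.L * logDet (1 - (ρ.1 : ℂ) • cov C (msgs s.M 0 Ka))) := by
  have hp : ∀ ρ : ℝ, {C : s.Codebook | 0 ≤ ρ ∧ ρ < 1 / (1 + maxEig C (msgs s.M 0 Ka))} =
      {C | 0 ≤ ρ ∧ ((cov C (msgs s.M 0 Ka))⁻¹ - (ρ : ℂ) • 1).PosDef} := fun ρ =>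
    Set.ext fun C => and_congr_right fun h => lt_inv_maxEig_iff hn C _ h
  refine measurable_iInf_subtype
      (p := fun C ρ => 0 ≤ ρ ∧ ρ < 1 / (1 + maxEig C (msgs s.M 0 Ka))) (f := fun C ρ =>
      Real.exp (-ρ * (s.n * s.L * (1 + ((K' : ℝ) - 1 / 2) * s.P'))
        - s.L * logDet (1 - (ρ : ℂ) • cov C (msgs s.M 0 Ka)))) (fun C => ⟨0, ?_⟩)
      (fun _ _ => (Real.exp_pos _).le) (fun ρ => ?_) fun ρ => ?_
  · refine ⟨le_rfl, (lt_inv_maxEig_iff hn C _ le_rfl).2 ?_⟩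
    simpa using (posDef_cov C (msgs s.M 0 Ka)).inv
  · rw [hp, Set.ofPred_and]
    exact isOpen_const.inter (isOpen_posDef_inv_cov_sub _ ρ)
  · rw [hp]
    have hcov := continuous_cov (n := s.n) (msgs s.M 0 Ka)
    have hc : ContinuousOn (fun C : s.Codebook => logDet (1 - (ρ : ℂ) • cov C (msgs s.M 0 Ka)))
        {C | 0 ≤ ρ ∧ ((cov C (msgs s.M 0 Ka))⁻¹ - (ρ : ℂ) • 1).PosDef} := by
      refine ContinuousOn.log (Complex.continuous_re.comp (by fun_prop : Continuous
        fun C : s.Codebook => (1 - (ρ : ℂ) • cov C (msgs s.M 0 Ka)).det)).continuousOn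
        fun C hC => ?_
      rw [one_sub_smul_cov]
      exact (det_mul_re_pos hC.2 (posDef_cov _ _)).ne'
    exact (continuousOn_const.sub (continuousOn_const.mul hc)).rexp

theorem listPrior_nonneg {π : ℕ → ℝ} (hπ : ∀ k, 0 ≤ π k) (k : ℕ) : 0 ≤ s.listPrior π k :=
  div_nonneg (hπ k) (Nat.cast_nonneg _)

theorem expb_nonneg {π : ℕ → ℝ} (hπ : ∀ k, 0 ≤ π k) (Ka K' t t' : ℕ) (ω u r : ℝ) :
    0 ≤ s.expb π Ka K' t t' ω u r := by
  have := s.listPrior_nonneg hπ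
  unfold expb eb eb₁ eb' eb''
  have h := fun k a => Real.rpow_nonneg (this k) a
  exact mul_nonneg (mul_nonneg (mul_nonneg (h _ _) (h _ _)) (h _ _)) (h _ _)

/-- At u = r = 0 the matrix `B` is the identity and the Chernoff expression equals 1. Hence the
minimum in `q1` is over a nonempty set and is at most 1. -/
theorem feasible_zero (π : ℕ → ℝ) (C : s.Codebook) (Ka K' t t' : ℕ) (ω : ℝ) :
    s.Feasible π C Ka K' t t' ω 0 0 := by
  refine ⟨le_rfl, le_rfl, ?_, Or.inl rfl, Or.inl (zero_mul _)⟩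
  rw [eigPos_B_iff]
  have h : (s.F C Ka).PosDef := posDef_cov _ _
  simpa [chernoffMatrix] using h

theorem measurable_q1_integrand {π : ℕ → ℝ} (hπ : ∀ k, 0 ≤ π k) (Ka K' t t' : ℕ) (ω ν : ℝ) :
    Measurable fun C : s.Codebook =>
      ⨅ x : {x : ℝ × ℝ // s.Feasible π C Ka K' t t' ω x.1 x.2},
      Real.exp (s.L * x.1.2 * s.n * ν
        + s.L * (x.1.1 * logDet (s.F'' C Ka K') - x.1.2 * logDet (s.F C Ka)
          - x.1.1 * logDet (s.F' C Ka K' t t') + x.1.2 * ω * logDet (s.F₁ C Ka K' t)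
          - logDet (s.B C Ka K' t t' ω x.1.1 x.1.2)))
        * s.expb π Ka K' t t' ω x.1.1 x.1.2 := by
  refine measurable_iInf_subtype
    (p := fun (C : s.Codebook) (x : ℝ × ℝ) => s.Feasible π C Ka K' t t' ω x.1 x.2)
    (f := fun C x => Real.exp (s.L * x.2 * s.n * ν
        + s.L * (x.1 * logDet (s.F'' C Ka K') - x.2 * logDet (s.F C Ka)
          - x.1 * logDet (s.F' C Ka K' t t') + x.2 * ω * logDet (s.F₁ C Ka K' t)
          - logDet (s.B C Ka K' t t' ω x.1 x.2)))
        * s.expb π Ka K' t t' ω x.1 x.2)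
    (fun C => ⟨(0, 0), s.feasible_zero π C Ka K' t t' ω⟩)
    (fun _ _ => mul_nonneg (Real.exp_pos _).le (s.expb_nonneg hπ ..)) (fun x => ?_) fun x => ?_
  · unfold Feasible
    have := s.isOpen_eigPos_B Ka K' t t' ω x.1 x.2
    exact isOpen_const.inter (isOpen_const.inter (this.inter (isOpen_const.inter isOpen_const)))
  · have hB : ContinuousOn (fun C : s.Codebook => logDet (s.B C Ka K' t t' ω x.1 x.2))
        {C | s.Feasible π C Ka K' t t' ω x.1 x.2} :=
      ContinuousOn.log (Complex.continuous_re.comp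
        (s.continuous_B Ka K' t t' ω x.1 x.2).matrix_det).continuousOn
        fun C hC => (s.det_B_re_pos hC.2.2.1).ne'
    have h0 : Continuous fun C : s.Codebook => logDet (s.F C Ka) := continuous_logDet_cov _
    have h1 : Continuous fun C : s.Codebook => logDet (s.F₁ C Ka K' t) := continuous_logDet_cov _
    have h2 : Continuous fun C : s.Codebook => logDet (s.F' C Ka K' t t') :=
      continuous_logDet_cov _
    have h3 : Continuous fun C : s.Codebook => logDet (s.F'' C Ka K') := continuous_logDet_cov _
    exact ((continuousOn_const.add (continuousOn_const.mul (ContinuousOn.sub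
      (by fun_prop : Continuous _).continuousOn hB))).rexp).mul continuousOn_const

end Params

/-! ### Measurability of the incomplete gamma terms -/

theorem continuous_charpoly_coeff {n : ℕ} (k : ℕ) :
    Continuous fun A : Matrix (Fin n) (Fin n) ℂ => A.charpoly.coeff k := by
  have : ∀ A : Matrix (Fin n) (Fin n) ℂ, A.charpoly.coeff k =
      MvPolynomial.eval (fun p : Fin n × Fin n => A p.1 p.2)
        ((Matrix.charpoly.univ ℂ (Fin n)).coeff k) := fun A =>
    (Matrix.charpoly.univ_coeff_eval₂Hom (Fin n) (RingHom.id ℂ)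
      (fun p : Fin n × Fin n => A p.1 p.2) k).symm
  simp_rw [this]
  exact (MvPolynomial.continuous_eval _).comp
    (continuous_pi fun p => continuous_id.matrix_elem p.1 p.2)

/-- The multiset of roots is not visibly measurable in the matrix, but the coefficients of the
characteristic polynomial are continuous. Exactly m eigenvalues are nonzero if and only if the
lowest nonvanishing coefficient sits in degree n - m, and it is then (-1)^m times their product. -/
theorem geomEig_eq_coeff {n m : ℕ} (hmn : m ≤ n) {B : Matrix (Fin n) (Fin n) ℂ} {d : Fin n → ℝ}
    (h : SimilarDiag B d) : geomEig m B =
      if (∀ k < n - m, B.charpoly.coeff k = 0) ∧ B.charpoly.coeff (n - m) ≠ 0 then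
        ((-1) ^ m * B.charpoly.coeff (n - m)).re ^ (1 / (m : ℝ)) else 0 := by
  classical
  rw [geomEig_eq h]
  set J := Finset.univ.filter (fun i => d i ≠ 0) with hJ
  set q : Polynomial ℂ := ∏ i ∈ J, (Polynomial.X - Polynomial.C (d i : ℂ)) with hq
  have hJn : J.card ≤ n := (Finset.card_le_univ J).trans_eq (Fintype.card_fin n)
  have hp : B.charpoly = Polynomial.X ^ (n - J.card) * q := by
    rw [h.charpoly_eq, ← Finset.prod_filter_mul_prod_filter_not Finset.univ (fun i => d i ≠ 0),
      ← hJ, ← hq, mul_comm]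
    congr 1
    rw [Finset.prod_congr rfl (g := fun _ => Polynomial.X), Finset.prod_const]
    · congr 1
      have := Finset.card_filter_add_card_filter_not (s := Finset.univ) (fun i : Fin n => d i ≠ 0)
      rw [Finset.card_univ, Fintype.card_fin] at this
      rw [← hJ] at this
      omega
    · intro i hi
      rw [not_not.1 (Finset.mem_filter.1 hi).2]
      simp
  have hq0 : q.coeff 0 = (-1) ^ J.card * ((∏ i ∈ J, d i : ℝ) : ℂ) := by
    rw [Polynomial.coeff_zero_eq_eval_zero, hq, Polynomial.eval_prod, Complex.ofReal_prod,
      ← Finset.prod_const, ← Finset.prod_mul_distrib]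
    simp
  have hq0' : q.coeff 0 ≠ 0 := by
    rw [hq0]
    refine mul_ne_zero (pow_ne_zero _ (by norm_num)) (Complex.ofReal_ne_zero.2 ?_)
    exact Finset.prod_ne_zero_iff.2 fun i hi => (Finset.mem_filter.1 hi).2
  have hcoeff : ∀ k, B.charpoly.coeff k = if n - J.card ≤ k then q.coeff (k - (n - J.card)) else 0 :=
    fun k => by rw [hp, Polynomial.coeff_X_pow_mul']
  have hiff : J.card = m ↔
      (∀ k < n - m, B.charpoly.coeff k = 0) ∧ B.charpoly.coeff (n - m) ≠ 0 := by
    constructor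
    · rintro rfl
      refine ⟨fun k hk => by rw [hcoeff, if_neg (by omega)], ?_⟩
      rw [hcoeff, if_pos le_rfl, Nat.sub_self]
      exact hq0'
    · rintro ⟨h1, h2⟩
      rcases lt_trichotomy (n - J.card) (n - m) with hlt | heq | hgt
      · have := h1 _ hlt
        rw [hcoeff, if_pos le_rfl, Nat.sub_self] at this
        exact absurd this hq0'
      · omega
      · rw [hcoeff, if_neg (by omega)] at h2
        exact absurd rfl h2
  by_cases hJm : J.card = m
  · rw [if_pos hJm, if_pos (hiff.1 hJm), hcoeff, if_pos (by omega), hJm, Nat.sub_self, hq0, hJm,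
      ← mul_assoc, ← mul_pow, neg_one_mul, neg_neg, one_pow, one_mul, Complex.ofReal_re]
  · rw [if_neg hJm, if_neg (fun hc => hJm (hiff.2 hc))]

theorem measurable_geomEig {X : Type*} [TopologicalSpace X] [MeasurableSpace X]
    [OpensMeasurableSpace X] {n m : ℕ} (hmn : m ≤ n) {B : X → Matrix (Fin n) (Fin n) ℂ}
    (hB : Continuous B) (hd : ∀ x, ∃ d, SimilarDiag (B x) d) :
    Measurable fun x => geomEig m (B x) := by
  have hc : ∀ k, Measurable fun x => (B x).charpoly.coeff k := fun k =>
    ((continuous_charpoly_coeff k).comp hB).measurable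
  have : ∀ x, geomEig m (B x) =
      if (∀ k < n - m, (B x).charpoly.coeff k = 0) ∧ (B x).charpoly.coeff (n - m) ≠ 0 then
        ((-1) ^ m * (B x).charpoly.coeff (n - m)).re ^ (1 / (m : ℝ)) else 0 := fun x =>
    let ⟨_, h⟩ := hd x
    geomEig_eq_coeff hmn h
  simp_rw [this]
  refine Measurable.ite ?_ ?_ measurable_const
  · refine MeasurableSet.inter ?_ ?_
    · change MeasurableSet {x | ∀ k < n - m, (B x).charpoly.coeff k = 0}
      simp only [Set.ofPred_forall]
      exact MeasurableSet.iInter fun k => MeasurableSet.iInter fun _ =>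
        hc k (measurableSet_singleton 0)
    · exact (hc (n - m) (measurableSet_singleton 0)).compl
  · exact (Complex.measurable_re.comp ((hc _).const_mul _)).pow_const _

theorem lowerGamma_div_eq {a : ℝ} (ha : 0 < a) (y : ℝ) :
    lowerGamma a y / Real.Gamma a = (gammaMeasure a 1 (Set.Iic y)).toReal := by
  rw [gammaMeasure_one_Iic ha, ENNReal.toReal_ofReal]
  refine div_nonneg (setIntegral_nonneg measurableSet_Ioc fun z hz => ?_)
    (Real.Gamma_pos_of_pos ha).le
  exact gammaIntegrand_nonneg hz.1

theorem upperGamma_div_eq {a : ℝ} (ha : 0 < a) (y : ℝ) :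
    upperGamma a y / Real.Gamma a = (gammaMeasure a 1 (Set.Ioi y)).toReal := by
  rw [gammaMeasure_one_Ioi ha, ENNReal.toReal_ofReal]
  refine div_nonneg (setIntegral_nonneg measurableSet_Ioi fun z hz => ?_)
    (Real.Gamma_pos_of_pos ha).le
  exact gammaIntegrand_nonneg ((le_max_right y 0).trans_lt hz)

theorem lowerGamma_div_mem {a : ℝ} (ha : 0 < a) (y : ℝ) :
    0 ≤ lowerGamma a y / Real.Gamma a ∧ lowerGamma a y / Real.Gamma a ≤ 1 := by
  have := isProbabilityMeasure_gammaMeasure ha one_pos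
  rw [lowerGamma_div_eq ha]
  exact ⟨ENNReal.toReal_nonneg, measureReal_le_one⟩

theorem upperGamma_div_mem {a : ℝ} (ha : 0 < a) (y : ℝ) :
    0 ≤ upperGamma a y / Real.Gamma a ∧ upperGamma a y / Real.Gamma a ≤ 1 := by
  have := isProbabilityMeasure_gammaMeasure ha one_pos
  rw [upperGamma_div_eq ha]
  exact ⟨ENNReal.toReal_nonneg, measureReal_le_one⟩

theorem measurable_lowerGamma_div {a : ℝ} (ha : 0 < a) :
    Measurable fun y => lowerGamma a y / Real.Gamma a := by
  have := isProbabilityMeasure_gammaMeasure ha one_pos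
  simp_rw [lowerGamma_div_eq ha]
  exact (show Monotone fun y => gammaMeasure a 1 (Set.Iic y) from fun y y' h =>
    measure_mono (Set.Iic_subset_Iic.2 h)).measurable.ennreal_toReal

theorem measurable_upperGamma_div {a : ℝ} (ha : 0 < a) :
    Measurable fun y => upperGamma a y / Real.Gamma a := by
  have := isProbabilityMeasure_gammaMeasure ha one_pos
  simp_rw [upperGamma_div_eq ha]
  exact (show Antitone fun y => gammaMeasure a 1 (Set.Ioi y) from fun y y' h =>
    measure_mono (Set.Ioi_subset_Ioi h)).measurable.ennreal_toReal

theorem lowerGammaRatio_mem {a : ℝ} (ha : 0 < a) (x y : ℝ) :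
    0 ≤ lowerGammaRatio a x y ∧ lowerGammaRatio a x y ≤ 1 := by
  unfold lowerGammaRatio
  split_ifs
  · simp
  · simp
  · exact lowerGamma_div_mem ha _

theorem measurable_lowerGammaRatio {X : Type*} [MeasurableSpace X] {a : ℝ} (ha : 0 < a)
    {f g : X → ℝ} (hf : Measurable f) (hg : Measurable g) :
    Measurable fun x => lowerGammaRatio a (f x) (g x) := by
  unfold lowerGammaRatio
  refine Measurable.ite (hg (measurableSet_singleton 0)) ?_
    ((measurable_lowerGamma_div ha).comp (hf.div hg))
  exact Measurable.ite (measurableSet_lt measurable_const hf) measurable_const measurable_const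

namespace Params

variable (s : Params)

/-- The integrand of the second term of `q₂`. -/
def q2Integrand (π : ℕ → ℝ) (Ka K' t : ℕ) (ω ν δ : ℝ) (C : s.Codebook) : ℝ :=
  if 0 < ω ∧ s.eb₁ π Ka K' t = 0 then 0 else
    lowerGammaRatio (s.L * s.m Ka K' t)
      (s.n * s.L * (1 + δ) * (1 - ω)
        - ω * (s.L * logDet (s.F₁ C Ka K' t) - Real.log (s.eb₁ π Ka K' t))
        + s.L * logDet (s.F C Ka) - Real.log (s.eb π Ka) - s.n * s.L * ν)
      (ω * geomEig (s.m Ka K' t) ((s.F₁ C Ka K' t)⁻¹ *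
        (subCode C (s.W₁ Ka K' t) * (subCode C (s.W₁ Ka K' t))ᴴ)))

theorem exists_similarDiag_inv_cov_mul {n M : ℕ} (C : Fin M → Fin n → ℂ) (S T : Finset (Fin M)) :
    ∃ d, SimilarDiag ((cov C S)⁻¹ * (subCode C T * (subCode C T)ᴴ)) d :=
  let ⟨d, hd, _⟩ := similarDiag_mul (posDef_cov C S).inv
    (Matrix.isHermitian_mul_conjTranspose_self (subCode C T))
  ⟨d, hd⟩

theorem L_mul_m_pos (hn : 1 ≤ s.n) (hL : 1 ≤ s.L) {Ka K' t : ℕ} (h : 0 < t + s.missed Ka K') :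
    (0 : ℝ) < s.L * s.m Ka K' t := by
  have : 0 < s.m Ka K' t := lt_min hn h
  positivity

theorem measurable_q2Integrand (hn : 1 ≤ s.n) (hL : 1 ≤ s.L) (π : ℕ → ℝ) {Ka K' t : ℕ}
    (h : 0 < t + s.missed Ka K') (ω ν δ : ℝ) :
    Measurable (s.q2Integrand π Ka K' t ω ν δ) := by
  unfold q2Integrand
  split_ifs
  · exact measurable_const
  have h0 : Measurable fun C : s.Codebook => logDet (s.F C Ka) :=
    (continuous_logDet_cov _).measurable
  have h1 : Measurable fun C : s.Codebook => logDet (s.F₁ C Ka K' t) :=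
    (continuous_logDet_cov _).measurable
  have hB : Continuous fun C : s.Codebook => (s.F₁ C Ka K' t)⁻¹ *
      (subCode C (s.W₁ Ka K' t) * (subCode C (s.W₁ Ka K' t))ᴴ) := by
    have h1 : Continuous fun C : s.Codebook => (s.F₁ C Ka K' t)⁻¹ := continuous_inv_cov _
    have h2 := continuous_subCode_mul (n := s.n) (s.W₁ Ka K' t)
    exact h1.matrix_mul h2
  refine measurable_lowerGammaRatio (s.L_mul_m_pos hn hL h) (by fun_prop)
    ((measurable_geomEig (min_le_left _ _) hB fun C => ?_).const_mul ω)
  exact exists_similarDiag_inv_cov_mul C _ _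

theorem q2Integrand_mem (hn : 1 ≤ s.n) (hL : 1 ≤ s.L) (π : ℕ → ℝ) {Ka K' t : ℕ}
    (h : 0 < t + s.missed Ka K') (ω ν δ : ℝ) (C : s.Codebook) :
    0 ≤ s.q2Integrand π Ka K' t ω ν δ C ∧ s.q2Integrand π Ka K' t ω ν δ C ≤ 1 := by
  unfold q2Integrand
  split_ifs
  · simp
  · exact lowerGammaRatio_mem (s.L_mul_m_pos hn hL h) _ _

end Params

/-! ### The codebook law -/

theorem continuous_energy {n : ℕ} : Continuous (energy : (Fin n → ℂ) → ℝ) := by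
  unfold energy; fun_prop

instance (n : ℕ) (P' : ℝ) (e : Ensemble) : IsProbabilityMeasure (codewordLaw n P' e) := by
  cases e with
  | gaussian => unfold codewordLaw; infer_instance
  | spherical =>
    -- The norm on `Fin n → ℂ` is the supremum norm, so the Euclidean unit ball is enclosed between
    -- two balls of that norm to see that its volume is neither 0 nor infinite. With radius 1/(n+1)
    -- the squared entries sum to at most n/(n+1).
    have hsub : Metric.ball (0 : Fin n → ℂ) (1 / (n + 1)) ⊆ {x | energy x ≤ 1} := by
      intro x hx
      rw [mem_ball_zero_iff] at hx
      have h1 : ∀ i, ‖x i‖ ^ 2 ≤ 1 / (n + 1) := by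
        intro i
        have h2 : ‖x i‖ ≤ 1 / (n + 1) := (norm_le_pi_norm x i).trans hx.le
        have h3 : (1 : ℝ) / (n + 1) ≤ 1 := by
          rw [div_le_one (by positivity)]; linarith [(Nat.cast_nonneg n : (0 : ℝ) ≤ n)]
        nlinarith [norm_nonneg (x i)]
      calc energy x ≤ ∑ _i : Fin n, (1 : ℝ) / (n + 1) := Finset.sum_le_sum fun i _ => h1 i
        _ ≤ 1 := by
          simp only [Finset.sum_const, Finset.card_univ, Fintype.card_fin, nsmul_eq_mul]
          rw [mul_one_div, div_le_one (by positivity)]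
          linarith
    have hsup : {x : Fin n → ℂ | energy x ≤ 1} ⊆ Metric.closedBall 0 1 := by
      intro x hx
      rw [mem_closedBall_zero_iff, pi_norm_le_iff_of_nonneg zero_le_one]
      intro i
      have h1 : ‖x i‖ ^ 2 ≤ energy x :=
        Finset.single_le_sum (f := fun i => ‖x i‖ ^ 2) (fun i _ => by positivity)
          (Finset.mem_univ i)
      have h2 : ‖x i‖ ^ 2 ≤ 1 := h1.trans hx
      nlinarith [norm_nonneg (x i)]
    have hne : volume {x : Fin n → ℂ | energy x ≤ 1} ≠ 0 :=
      ((Metric.measure_ball_pos volume _ (by positivity)).trans_le (measure_mono hsub)).ne'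
    have hfin : volume {x : Fin n → ℂ | energy x ≤ 1} ≠ ∞ :=
      ((measure_mono hsup).trans_lt measure_closedBall_lt_top).ne
    have := cond_isProbabilityMeasure_of_finite hne hfin
    unfold codewordLaw
    refine Measure.isProbabilityMeasure_map (Measurable.aemeasurable ?_)
    have := (continuous_energy (n := n)).measurable
    fun_prop

instance (s : Params) : IsProbabilityMeasure s.codebookLaw := by
  unfold Params.codebookLaw; infer_instance

/-- The codebook law is invariant under reindexing of the messages. -/
theorem measurePreserving_reindex (s : Params) (σ : Equiv.Perm (Fin s.M)) :
    MeasurePreserving (fun (C : s.Codebook) i => C (σ i)) s.codebookLaw s.codebookLaw := by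
  have := measurePreserving_arrowCongr' (fun _ : Fin s.M => codewordLaw s.n s.P' s.ens)
    (fun _ : Fin s.M => codewordLaw s.n s.P' s.ens) σ.symm (MeasurableEquiv.refl _)
    (fun _ => MeasurePreserving.id _)
  exact this

theorem subCode_reindex {n M : ℕ} (C : Fin M → Fin n → ℂ) (σ : Equiv.Perm (Fin M))
    (S : Finset (Fin M)) : subCode (fun i => C (σ i)) S * (subCode (fun i => C (σ i)) S)ᴴ =
      subCode C (S.map σ.toEmbedding) * (subCode C (S.map σ.toEmbedding))ᴴ := by
  have h : ∀ (D : Fin M → Fin n → ℂ) (T : Finset (Fin M)) (i j : Fin n),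
      (subCode D T * (subCode D T)ᴴ) i j = ∑ m ∈ T, D m i * star (D m j) := by
    intro D T i j
    rw [Matrix.mul_apply, ← Finset.sum_coe_sort T]
    rfl
  ext i j
  rw [h, h, Finset.sum_map]
  rfl

theorem cov_reindex {n M : ℕ} (C : Fin M → Fin n → ℂ) (σ : Equiv.Perm (Fin M))
    (S : Finset (Fin M)) : cov (fun i => C (σ i)) S = cov C (S.map σ.toEmbedding) := by
  rw [cov, subCode_reindex]; rfl

/-! ### Reindexing of the messages -/

theorem mem_msgs {M a b : ℕ} {i : Fin M} : i ∈ msgs M a b ↔ a ≤ i.val ∧ i.val < b := by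
  simp [msgs]

theorem card_msgs_zero {M b : ℕ} (h : b ≤ M) : (msgs M 0 b).card = b := by
  have : msgs M 0 b = Finset.univ.filter fun i : Fin M => i.val < b := by simp [msgs]
  rw [this, Fin.card_filter_val_lt, min_eq_right h]

theorem eq_msgs_of_isLowerSet {M : ℕ} {S : Finset (Fin M)} (h : ∀ i j, i ≤ j → j ∈ S → i ∈ S) :
    S = msgs M 0 S.card := by
  have hc : S.card ≤ M := (Finset.card_le_univ S).trans_eq (Fintype.card_fin M)
  refine Finset.eq_of_subset_of_card_le (fun j hj => ?_) (card_msgs_zero hc).le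
  have hsub : Finset.Iic j ⊆ S := fun i hi => h i j (Finset.mem_Iic.1 hi) hj
  have := Finset.card_le_card hsub
  rw [Fin.card_Iic] at this
  exact mem_msgs.2 ⟨Nat.zero_le _, by omega⟩

/-- A permutation that sorts f turns the sublevel sets of f into initial segments. -/
theorem map_msgs_of_monotone {M : ℕ} {f : Fin M → ℕ} {σ : Equiv.Perm (Fin M)}
    (hσ : Monotone (f ∘ σ)) {S : Finset (Fin M)} {k : ℕ} (hS : ∀ i, i ∈ S ↔ f i ≤ k) :
    (msgs M 0 S.card).map σ.toEmbedding = S := by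
  have h1 : S.map σ.symm.toEmbedding = msgs M 0 S.card := by
    have := eq_msgs_of_isLowerSet (S := S.map σ.symm.toEmbedding) fun i j hij hj => by
      rw [Finset.mem_map_equiv, Equiv.symm_symm] at hj ⊢
      rw [hS] at hj ⊢
      exact (hσ hij).trans hj
    rwa [Finset.card_map] at this
  rw [← h1, Finset.map_map]
  ext i
  simp

/-- The messages are labelled 0 to 5 by the innermost set containing them and sorted by label, so
that every set becomes an interval of indices. Any error pattern thereby takes the canonical
position used in `F`, `F₁`, `F'` and `F''`. -/
theorem exists_reindex {M : ℕ} {T₁₁ T₁ W T₂₁ T₂ : Finset (Fin M)} (h1 : T₁₁ ⊆ T₁) (h2 : T₁ ⊆ W)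
    (h3 : T₂₁ ⊆ T₂) (h4 : Disjoint W T₂) : ∃ σ : Equiv.Perm (Fin M),
      (msgs M 0 T₁₁.card).map σ.toEmbedding = T₁₁ ∧ (msgs M 0 T₁.card).map σ.toEmbedding = T₁ ∧
      (msgs M 0 W.card).map σ.toEmbedding = W ∧
      (msgs M W.card (W.card + T₂₁.card)).map σ.toEmbedding = T₂₁ ∧
      (msgs M W.card (W.card + T₂.card)).map σ.toEmbedding = T₂ := by
  set f : Fin M → ℕ := fun i => if i ∈ T₁₁ then 0 else if i ∈ T₁ then 1 else if i ∈ W then 2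
    else if i ∈ T₂₁ then 3 else if i ∈ T₂ then 4 else 5 with hf
  have hσ := Tuple.monotone_sort f
  have hW := map_msgs_of_monotone hσ (S := W) (k := 2) fun i => by
    have a := @h1 i; have b := @h2 i
    simp only [hf]
    grind
  have hdiff : ∀ {T : Finset (Fin M)} {k : ℕ}, Disjoint W T → (∀ i, i ∈ W ∪ T ↔ f i ≤ k) →
      (msgs M W.card (W.card + T.card)).map (Tuple.sort f).toEmbedding = T := by
    intro T k hd hk
    have h := map_msgs_of_monotone hσ hk
    rw [Finset.card_union_of_disjoint hd] at h
    have hm : msgs M W.card (W.card + T.card) =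
        msgs M 0 (W.card + T.card) \ msgs M 0 W.card := by
      ext i; simp only [mem_msgs, Finset.mem_sdiff]; omega
    rw [hm, Finset.map_sdiff, h, hW, Finset.union_sdiff_cancel_left hd]
  refine ⟨Tuple.sort f, map_msgs_of_monotone hσ (k := 0) fun i => ?_,
    map_msgs_of_monotone hσ (k := 1) fun i => ?_, hW,
    hdiff (k := 3) (Finset.disjoint_of_subset_right h3 h4) fun i => ?_, hdiff (k := 4) h4 fun i => ?_⟩
  all_goals
    have a := @h1 i
    have b := @h2 i
    have c := @h3 i
    simp only [hf, Finset.mem_union]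
    grind

/-! ### Events for a given codebook -/

theorem rpow_eq_exp_log_mul {x y : ℝ} (hx : 0 ≤ x) (h : y = 0 ∨ x ≠ 0) :
    x ^ y = Real.exp (Real.log x * y) := by
  rcases h with rfl | h
  · simp
  · exact Real.rpow_def_of_pos (lt_of_le_of_ne hx h.symm) y

namespace Params

variable (s : Params)

/-- The part of the metric that does not depend on the prior. -/
def rawMetric (C : s.Codebook) (Y : Fin s.n → Fin s.L → ℂ) (S : Finset (Fin s.M)) : ℝ :=
  s.L * logDet (cov C S) + quad (cov C S)⁻¹ Y

theorem listPrior_eq_zero_iff {π : ℕ → ℝ} {k : ℕ} (hk : k ≤ s.M) :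
    s.listPrior π k = 0 ↔ π k = 0 := by
  have : (s.M.choose k : ℝ) ≠ 0 := by exact_mod_cast (Nat.choose_pos hk).ne'
  simp [listPrior, this]

theorem card_le_M (S : Finset (Fin s.M)) : S.card ≤ s.M :=
  (Finset.card_le_univ S).trans_eq (Fintype.card_fin _)

theorem mapMetric_eq_top {π : ℕ → ℝ} (C : s.Codebook) (Y : Fin s.n → Fin s.L → ℂ)
    {S : Finset (Fin s.M)} (h : s.listPrior π S.card = 0) : s.mapMetric π C Y S = ⊤ := by
  rw [mapMetric, if_pos ((s.listPrior_eq_zero_iff (s.card_le_M S)).1 h), EReal.coe_add_top]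

theorem mapMetric_eq_coe {π : ℕ → ℝ} (C : s.Codebook) (Y : Fin s.n → Fin s.L → ℂ)
    {S : Finset (Fin s.M)} (h : s.listPrior π S.card ≠ 0) :
    s.mapMetric π C Y S =
      ((s.rawMetric C Y S - Real.log (s.listPrior π S.card) : ℝ) : EReal) := by
  have h1 : π S.card ≠ 0 := fun h0 => h ((s.listPrior_eq_zero_iff (s.card_le_M S)).2 h0)
  have h2 : (s.M.choose S.card : ℝ) ≠ 0 := by
    exact_mod_cast (Nat.choose_pos (s.card_le_M S)).ne'
  rw [mapMetric, if_neg h1, ← EReal.coe_add, listPrior, Real.log_div h1 h2]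
  congr 1
  simp only [rawMetric, quad]
  ring

/-- The event that the metric of the list `W` is at most a combination of the metric of `W \ T` and
of a threshold. -/
def Good (π : ℕ → ℝ) (ω ν : ℝ) (C : s.Codebook) (Y : Fin s.n → Fin s.L → ℂ)
    (W T : Finset (Fin s.M)) : Prop :=
  -- Here the metric of `W \ T` is +∞ with a positive weight, so the comparison holds trivially. It
  -- must be listed separately, since `Real.log 0` is 0.
  (0 < ω ∧ s.listPrior π (W.card - T.card) = 0) ∨
    s.rawMetric C Y W - Real.log (s.listPrior π W.card) ≤
      ω * (s.rawMetric C Y (W \ T) - Real.log (s.listPrior π (W.card - T.card))) + s.n * s.L * ν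

/-- The event behind the Chernoff bound, for given lists. -/
theorem nonneg_of_good {π : ℕ → ℝ} {ω ν u r : ℝ} (hu : 0 ≤ u)
    (hr : 0 ≤ r) {C : s.Codebook} {Y : Fin s.n → Fin s.L → ℂ} {W T S' S'' : Finset (Fin s.M)}
    (hgood : s.Good π ω ν C Y W T)
    (hle : s.mapMetric π C Y S' ≤ s.mapMetric π C Y S'')
    (hu' : u = 0 ∨ s.listPrior π S''.card ≠ 0)
    (hr' : r * ω = 0 ∨ s.listPrior π (W.card - T.card) ≠ 0) :
    (u = 0 ∨ s.listPrior π S'.card ≠ 0) ∧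
    0 ≤ (r * s.n * s.L * ν + u * (s.L * logDet (cov C S'') - Real.log (s.listPrior π S''.card))
        - u * (s.L * logDet (cov C S') - Real.log (s.listPrior π S'.card))
        + r * ω * (s.L * logDet (cov C (W \ T)) - Real.log (s.listPrior π (W.card - T.card)))
        - r * (s.L * logDet (cov C W) - Real.log (s.listPrior π W.card)))
      + quad (chernoffMatrix (cov C W) (cov C (W \ T)) (cov C S') (cov C S'') ω u r) Y := by
  -- The claim is u times the preference for S' over S'' plus r times the inequality in `Good`. If u
  -- is nonzero, S'' has a finite metric, and then so has the preferred S'.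
  have h1 : (u = 0 ∨ s.listPrior π S'.card ≠ 0) ∧
      0 ≤ u * ((s.rawMetric C Y S'' - Real.log (s.listPrior π S''.card)) -
        (s.rawMetric C Y S' - Real.log (s.listPrior π S'.card))) := by
    rcases hu' with rfl | h
    · simp
    · rw [s.mapMetric_eq_coe C Y h] at hle
      have h' : s.listPrior π S'.card ≠ 0 := by
        intro h0
        rw [s.mapMetric_eq_top C Y h0] at hle
        exact EReal.coe_ne_top _ (top_le_iff.1 hle)
      rw [s.mapMetric_eq_coe C Y h', EReal.coe_le_coe_iff] at hle
      exact ⟨Or.inr h', mul_nonneg hu (sub_nonneg.2 hle)⟩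
  have h2 : 0 ≤ r * (ω * (s.rawMetric C Y (W \ T) -
      Real.log (s.listPrior π (W.card - T.card))) + s.n * s.L * ν -
      (s.rawMetric C Y W - Real.log (s.listPrior π W.card))) := by
    rcases hr.eq_or_lt with rfl | hrpos
    · simp
    · rcases hgood with ⟨hω', h0⟩ | h
      · rcases hr' with h | h
        · exact absurd h (mul_pos hrpos hω').ne'
        · exact absurd h0 h
      · exact mul_nonneg hr (sub_nonneg.2 h)
  refine ⟨h1.1, ?_⟩
  unfold chernoffMatrix
  rw [quad_sub, quad_add, quad_sub, quad_smul, quad_smul, quad_smul, quad_smul]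
  have := h1.2
  unfold rawMetric at this h2
  linarith

theorem quad_nonneg {n L : ℕ} {Q : Matrix (Fin n) (Fin n) ℂ} (hQ : Q.PosSemidef)
    (Y : Fin n → Fin L → ℂ) : 0 ≤ quad Q Y := by
  rw [quad_eq_sum]
  exact Finset.sum_nonneg fun l _ => hQ.re_dotProduct_nonneg _

/-- Inversion reverses the order: with F = F₁ + V the difference is F⁻¹(V + V F₁⁻¹ V)F⁻¹. This
handles the degenerate case of `q2`, where the geometric mean of the eigenvalues or ω vanishes. -/
theorem posSemidef_inv_cov_sub {n M : ℕ} (C : Fin M → Fin n → ℂ) {S T : Finset (Fin M)}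
    (h : T ⊆ S) : ((cov C (S \ T))⁻¹ - (cov C S)⁻¹).PosSemidef := by
  set F := cov C S with hF
  set F₁ := cov C (S \ T) with hF₁
  set V := subCode C T * (subCode C T)ᴴ with hV
  have hadd : F = F₁ + V := cov_sdiff_add C h
  have hVpsd : V.PosSemidef := Matrix.posSemidef_self_mul_conjTranspose _
  have hFpd : F.PosDef := posDef_cov _ _
  have hF₁pd : F₁.PosDef := posDef_cov _ _
  have hFH : (F⁻¹)ᴴ = F⁻¹ := hFpd.inv.isHermitian
  have hFF : F⁻¹ * F = 1 := inv_cov_mul_cov _ _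
  have hFF' : F * F⁻¹ = 1 :=
    Matrix.mul_nonsing_inv _ ((Matrix.isUnit_iff_isUnit_det _).1 hFpd.isUnit)
  have hF₁F₁ : F₁⁻¹ * F₁ = 1 := inv_cov_mul_cov _ _
  have hF₁F₁' : F₁ * F₁⁻¹ = 1 :=
    Matrix.mul_nonsing_inv _ ((Matrix.isUnit_iff_isUnit_det _).1 hF₁pd.isUnit)
  have hmid : F * F₁⁻¹ * F - F = V + V * F₁⁻¹ * V := by
    rw [hadd]
    simp only [Matrix.add_mul, Matrix.mul_add, hF₁F₁', Matrix.mul_assoc, hF₁F₁, Matrix.mul_one,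
      Matrix.one_mul]
    abel
  have heq : F₁⁻¹ - F⁻¹ = F⁻¹ * (V + V * F₁⁻¹ * V) * F⁻¹ᴴ := by
    rw [← hmid, hFH, Matrix.mul_sub, Matrix.sub_mul, hFF, Matrix.one_mul]
    calc F₁⁻¹ - F⁻¹ = (F⁻¹ * F) * F₁⁻¹ * (F * F⁻¹) - F⁻¹ := by rw [hFF, hFF']; simp
      _ = _ := by simp only [Matrix.mul_assoc]
  rw [heq]
  refine (hVpsd.add ?_).mul_mul_conjTranspose_same _
  have := hF₁pd.inv.posSemidef.mul_mul_conjTranspose_same V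
  rwa [hVpsd.isHermitian.eq] at this

end Params

/-! ### Probabilities over the codebook and the channel -/

theorem continuous_received_joint {n L M K : ℕ} (A : Finset (Fin K)) (w : Fin K → Fin M) :
    Continuous fun p : (Fin M → Fin n → ℂ) × ((Fin K → Fin L → ℂ) × (Fin n → Fin L → ℂ)) =>
      received p.1 A w p.2.1 p.2.2 := by
  unfold received
  fun_prop

theorem ENNReal_le_ofReal_iInf {ι : Type*} [Nonempty ι] {a : ℝ≥0∞} (ha : a ≠ ∞) {f : ι → ℝ}
    (hf : ∀ i, 0 ≤ f i) (h : ∀ i, a ≤ ENNReal.ofReal (f i)) : a ≤ ENNReal.ofReal (⨅ i, f i) := by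
  refine (ENNReal.le_ofReal_iff_toReal_le ha (Real.iInf_nonneg hf)).2 (le_ciInf fun i => ?_)
  exact (ENNReal.le_ofReal_iff_toReal_le ha (hf i)).1 (h i)

namespace Params

variable (s : Params)

/-- The joint law of the codebook, the fading coefficients and the noise. -/
def fullLaw : Measure (s.Codebook × ((Fin s.K → Fin s.L → ℂ) × (Fin s.n → Fin s.L → ℂ))) :=
  s.codebookLaw.prod (channelLaw s.K s.n s.L)

instance : IsProbabilityMeasure s.fullLaw := by unfold fullLaw; infer_instance

theorem continuous_rawMetric (S : Finset (Fin s.M)) :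
    Continuous fun p : s.Codebook × (Fin s.n → Fin s.L → ℂ) => s.rawMetric p.1 p.2 S := by
  have h1 : Continuous fun p : s.Codebook × (Fin s.n → Fin s.L → ℂ) => logDet (cov p.1 S) :=
    (continuous_logDet_cov S).comp continuous_fst
  have h2 : Continuous fun p : s.Codebook × (Fin s.n → Fin s.L → ℂ) => (cov p.1 S)⁻¹ :=
    (continuous_inv_cov S).comp continuous_fst
  have h3 : Continuous fun p : s.Codebook × (Fin s.n → Fin s.L → ℂ) =>
      (Matrix.of p.2 : Matrix (Fin s.n) (Fin s.L) ℂ) := continuous_snd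
  unfold rawMetric quad
  fun_prop

theorem measurable_mapMetric (π : ℕ → ℝ) (S : Finset (Fin s.M)) :
    Measurable fun p : s.Codebook × (Fin s.n → Fin s.L → ℂ) => s.mapMetric π p.1 p.2 S := by
  by_cases h : s.listPrior π S.card = 0
  · simp_rw [s.mapMetric_eq_top _ _ h]
    exact measurable_const
  · simp_rw [s.mapMetric_eq_coe _ _ h]
    have := (s.continuous_rawMetric S).measurable
    exact measurable_coe_real_ereal.comp (this.sub_const _)

theorem measurableSet_good (π : ℕ → ℝ) (ω ν : ℝ) (W T : Finset (Fin s.M)) :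
    MeasurableSet {p : s.Codebook × (Fin s.n → Fin s.L → ℂ) | s.Good π ω ν p.1 p.2 W T} := by
  have h1 := (s.continuous_rawMetric W).measurable
  have h2 := (s.continuous_rawMetric (W \ T)).measurable
  exact (MeasurableSet.const _).union
    (measurableSet_le (h1.sub_const _) (((h2.sub_const _).const_mul ω).add_const _))

/-- Fubini with the codebook held fixed: the channel bound may be optimized separately for each
codebook, which puts the minima of the bounds inside the expectations. Invariance of the codebook
law then absorbs the permutation. -/
theorem fullLaw_le {E : Set (s.Codebook × ((Fin s.K → Fin s.L → ℂ) × (Fin s.n → Fin s.L → ℂ)))}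
    (hE : MeasurableSet E) {f : s.Codebook → ℝ} (hf : Measurable f) (hf0 : ∀ C, 0 ≤ f C)
    (hf1 : ∀ C, f C ≤ 1) (σ : Equiv.Perm (Fin s.M))
    (h : ∀ C, channelLaw s.K s.n s.L (Prod.mk C ⁻¹' E) ≤ ENNReal.ofReal (f fun i => C (σ i))) :
    s.fullLaw E ≤ ENNReal.ofReal (∫ C, f C ∂s.codebookLaw) := by
  have hint : Integrable f s.codebookLaw :=
    Integrable.of_bound hf.aestronglyMeasurable 1 (by
      filter_upwards with C
      rw [Real.norm_of_nonneg (hf0 C)]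
      exact hf1 C)
  rw [fullLaw, Measure.prod_apply hE, ofReal_integral_eq_lintegral_ofReal hint
    (by filter_upwards with C using hf0 C),
    ← (measurePreserving_reindex s σ).lintegral_comp hf.ennreal_ofReal]
  exact lintegral_mono h

/-- The integrand of `q₁`. -/
def q1Integrand (π : ℕ → ℝ) (Ka K' t t' : ℕ) (ω ν : ℝ) (C : s.Codebook) : ℝ :=
  ⨅ x : {x : ℝ × ℝ // s.Feasible π C Ka K' t t' ω x.1 x.2},
    Real.exp (s.L * x.1.2 * s.n * ν
      + s.L * (x.1.1 * logDet (s.F'' C Ka K') - x.1.2 * logDet (s.F C Ka)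
        - x.1.1 * logDet (s.F' C Ka K' t t') + x.1.2 * ω * logDet (s.F₁ C Ka K' t)
        - logDet (s.B C Ka K' t t' ω x.1.1 x.1.2)))
      * s.expb π Ka K' t t' ω x.1.1 x.1.2

theorem q1Integrand_nonneg {π : ℕ → ℝ} (hπ : ∀ k, 0 ≤ π k) (Ka K' t t' : ℕ) (ω ν : ℝ)
    (C : s.Codebook) : 0 ≤ s.q1Integrand π Ka K' t t' ω ν C :=
  Real.iInf_nonneg fun _ => mul_nonneg (Real.exp_pos _).le (s.expb_nonneg hπ ..)

theorem q1Integrand_le_one {π : ℕ → ℝ} (hπ : ∀ k, 0 ≤ π k) (Ka K' t t' : ℕ) (ω ν : ℝ)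
    (C : s.Codebook) : s.q1Integrand π Ka K' t t' ω ν C ≤ 1 := by
  refine (ciInf_le ⟨0, ?_⟩ ⟨(0, 0), s.feasible_zero π C Ka K' t t' ω⟩).trans_eq ?_
  · rintro _ ⟨x, rfl⟩
    exact mul_nonneg (Real.exp_pos _).le (s.expb_nonneg hπ ..)
  · simp [B, expb, logDet]

variable {A : Finset (Fin s.K)} {w : Fin s.K → Fin s.M}

/-- The probability that the metric prefers the list `(W \ T₁) ∪ T₂` to all other lists. -/
theorem fullLaw_prefer_le {π : ℕ → ℝ} (hπ : ∀ k, 0 ≤ π k) (hw : Set.InjOn w A)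
    {Ka K' t t' : ℕ} (hWK : (A.image w).card = Ka) (hlh : s.lo K' ≤ s.hi K')
    (hb : s.listPrior π Ka ≠ 0) {T₁ T₂ : Finset (Fin s.M)} (hT₁ : T₁ ⊆ A.image w)
    (hT₁c : T₁.card = t + s.missed Ka K') (hT₂ : Disjoint (A.image w) T₂)
    (hT₂c : T₂.card = t' + s.extra Ka K') (ω ν : ℝ) :
    s.fullLaw {p | (∀ S : Finset (Fin s.M), S.card ∈ Finset.Icc (s.lo K') (s.hi K') →
        s.mapMetric π p.1 (received p.1 A w p.2.1 p.2.2) ((A.image w \ T₁) ∪ T₂) ≤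
          s.mapMetric π p.1 (received p.1 A w p.2.1 p.2.2) S) ∧
        s.Good π ω ν p.1 (received p.1 A w p.2.1 p.2.2) (A.image w) T₁} ≤
      ENNReal.ofReal (∫ C, s.q1Integrand π Ka K' t t' ω ν C ∂s.codebookLaw) := by
  set W := A.image w with hW
  -- The list `W` itself may have an inadmissible size. Dropping `missed` of its messages, or adding
  -- `extra` others, brings it to the nearest admissible size; taking them inside T₁ and T₂ gives
  -- the reference list S''.
  obtain ⟨T₁₁, hT₁₁, hT₁₁c⟩ := Finset.exists_subset_card_eq
    (show s.missed Ka K' ≤ T₁.card by omega)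
  obtain ⟨T₂₁, hT₂₁, hT₂₁c⟩ := Finset.exists_subset_card_eq
    (show s.extra Ka K' ≤ T₂.card by omega)
  obtain ⟨σ, e11, e1, e, e21, e2⟩ := exists_reindex hT₁₁ hT₁ hT₂₁ hT₂
  set S' := (W \ T₁) ∪ T₂ with hS'
  set S'' := (W \ T₁₁) ∪ T₂₁ with hS''
  have hT₁W := Finset.card_le_card hT₁
  have cS₁ : (W \ T₁).card = Ka - (t + s.missed Ka K') := by
    rw [Finset.card_sdiff_of_subset hT₁, hWK, hT₁c]
  have cS' : S'.card = s.listSize Ka K' t t' := by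
    rw [hS', Finset.card_union_of_disjoint (Finset.disjoint_of_subset_left Finset.sdiff_subset hT₂),
      cS₁, hT₂c, listSize]
    omega
  have cS'' : S''.card = Ka - s.missed Ka K' + s.extra Ka K' := by
    rw [hS'', Finset.card_union_of_disjoint (Finset.disjoint_of_subset_left Finset.sdiff_subset
      (Finset.disjoint_of_subset_right hT₂₁ hT₂)),
      Finset.card_sdiff_of_subset (hT₁₁.trans hT₁), hWK, hT₁₁c, hT₂₁c]
  have hS''mem : S''.card ∈ Finset.Icc (s.lo K') (s.hi K') := by
    rw [cS'', Finset.mem_Icc, missed, extra]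
    omega
  have hYm : Measurable fun p : s.Codebook × ((Fin s.K → Fin s.L → ℂ) × (Fin s.n → Fin s.L → ℂ)) =>
      (p.1, received p.1 A w p.2.1 p.2.2) :=
    measurable_fst.prodMk (continuous_received_joint A w).measurable
  set E : Set (s.Codebook × ((Fin s.K → Fin s.L → ℂ) × (Fin s.n → Fin s.L → ℂ))) :=
    {p | s.mapMetric π p.1 (received p.1 A w p.2.1 p.2.2) S' ≤
      s.mapMetric π p.1 (received p.1 A w p.2.1 p.2.2) S'' ∧
      s.Good π ω ν p.1 (received p.1 A w p.2.1 p.2.2) W T₁} with hE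
  have hEm : MeasurableSet E :=
    (measurableSet_le ((s.measurable_mapMetric π S').comp hYm)
      ((s.measurable_mapMetric π S'').comp hYm)).inter (hYm (s.measurableSet_good π ω ν W T₁))
  -- Of all the comparisons won by S', only the one with S'' is kept.
  refine (measure_mono fun p hp => ⟨hp.1 S'' hS''mem, hp.2⟩ : _ ≤ s.fullLaw E).trans
    (s.fullLaw_le hEm (s.measurable_q1_integrand hπ Ka K' t t' ω ν)
      (s.q1Integrand_nonneg hπ Ka K' t t' ω ν) (s.q1Integrand_le_one hπ Ka K' t t' ω ν) σ
      fun C => ?_)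
  set C' : s.Codebook := fun i => C (σ i) with hC'
  have mW : (s.W Ka).map σ.toEmbedding = W := by rw [← hWK]; exact e
  have mW₁ : (s.W₁ Ka K' t).map σ.toEmbedding = T₁ := by
    rw [Params.W₁, add_comm, ← hT₁c]; exact e1
  have mW₁₁ : (s.W₁₁ Ka K').map σ.toEmbedding = T₁₁ := by
    rw [Params.W₁₁, ← hT₁₁c]; exact e11
  have mW₂ : (s.W₂ Ka K' t').map σ.toEmbedding = T₂ := by
    rw [Params.W₂, add_assoc, add_comm (s.extra _ _), ← hT₂c, ← hWK]; exact e2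
  have mW₂₁ : (s.W₂₁ Ka K').map σ.toEmbedding = T₂₁ := by
    rw [Params.W₂₁, ← hT₂₁c, ← hWK]; exact e21
  have hF : s.F C' Ka = cov C W := by rw [F, cov_reindex, mW]
  have hF₁ : s.F₁ C' Ka K' t = cov C (W \ T₁) := by
    rw [F₁, cov_reindex, Finset.map_sdiff, mW, mW₁]
  have hF' : s.F' C' Ka K' t t' = cov C S' := by
    rw [Params.F', cov_reindex, Finset.map_union, Finset.map_sdiff, mW, mW₁, mW₂]
  have hF'' : s.F'' C' Ka K' = cov C S'' := by
    rw [Params.F'', cov_reindex, Finset.map_union, Finset.map_sdiff, mW, mW₁₁, mW₂₁]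
  have hne : Nonempty {x : ℝ × ℝ // s.Feasible π C' Ka K' t t' ω x.1 x.2} :=
    ⟨⟨(0, 0), s.feasible_zero π C' Ka K' t t' ω⟩⟩
  refine ENNReal_le_ofReal_iInf (measure_ne_top _ _)
    (fun _ => mul_nonneg (Real.exp_pos _).le (s.expb_nonneg hπ ..)) ?_
  rintro ⟨⟨u, r⟩, hu, hr, hB, hu', hr'⟩
  simp only at hu hr hB hu' hr' ⊢
  have hsub : Prod.mk C ⁻¹' E ⊆ {q | (u = 0 ∨ s.listPrior π S'.card ≠ 0) ∧
      0 ≤ (r * s.n * s.L * ν + u * (s.L * logDet (cov C S'') - Real.log (s.listPrior π S''.card))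
        - u * (s.L * logDet (cov C S') - Real.log (s.listPrior π S'.card))
        + r * ω * (s.L * logDet (cov C (W \ T₁)) - Real.log (s.listPrior π (W.card - T₁.card)))
        - r * (s.L * logDet (cov C W) - Real.log (s.listPrior π W.card)))
      + quad (chernoffMatrix (cov C W) (cov C (W \ T₁)) (cov C S') (cov C S'') ω u r)
        (received C A w q.1 q.2)} := fun q hq =>
    s.nonneg_of_good hu hr hq.2 hq.1 (by rwa [cS'']) (by rwa [hWK, hT₁c])
  -- If u ≠ 0 and S' has prior zero, its metric is +∞ and cannot beat the finite metric of S'', so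
  -- the event is empty. Otherwise every base with a nonzero exponent in `expb` is positive, and the
  -- powers become exponentials.
  by_cases hp' : u = 0 ∨ s.listPrior π S'.card ≠ 0
  swap
  · refine (measure_mono fun q hq => ?_).trans_eq (measure_empty (μ := channelLaw s.K s.n s.L))
      |>.trans zero_le
    exact absurd (hsub hq).1 hp'
  refine (measure_mono fun q hq => (hsub hq).2).trans ((channelLaw_nonneg_le C hw ?_ _).trans_eq ?_)
  · have := (s.eigPos_B_iff C' Ka K' t t' ω u r).1 hB
    rwa [hF, hF₁, hF', hF''] at this
  · have hBeq := s.B_eq_one_sub C' Ka K' t t' ω u r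
    rw [hF, hF₁, hF', hF''] at hBeq
    rw [← hW, ← hBeq, hF, hF₁, hF', hF'']
    have hneg : ∀ {y : ℝ}, y = 0 → -y = 0 := fun h => by rw [h, neg_zero]
    have hexpb : s.expb π Ka K' t t' ω u r = Real.exp (-u * Real.log (s.listPrior π S''.card)
        + r * Real.log (s.listPrior π W.card) + u * Real.log (s.listPrior π S'.card)
        - r * ω * Real.log (s.listPrior π (W.card - T₁.card))) := by
      rw [expb, eb, eb₁, eb', eb'', rpow_eq_exp_log_mul (s.listPrior_nonneg hπ _) (hu'.imp_left hneg),
        rpow_eq_exp_log_mul (s.listPrior_nonneg hπ _) (Or.inr hb),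
        rpow_eq_exp_log_mul (s.listPrior_nonneg hπ _) (hp'.imp_right (by rw [cS']; exact id)),
        rpow_eq_exp_log_mul (s.listPrior_nonneg hπ _) (hr'.imp_left hneg),
        ← Real.exp_add, ← Real.exp_add, ← Real.exp_add, cS', cS'', hWK, hT₁c]
      congr 1
      ring
    rw [hexpb, ← Real.exp_add]
    congr 2
    ring

end Params

/-! ### Failure of the threshold event -/

namespace Params

variable (s : Params) {A : Finset (Fin s.K)} {w : Fin s.K → Fin s.M}

theorem measurable_codebook_received :
    Measurable fun p : s.Codebook × ((Fin s.K → Fin s.L → ℂ) × (Fin s.n → Fin s.L → ℂ)) =>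
      (p.1, received p.1 A w p.2.1 p.2.2) :=
  measurable_fst.prodMk (continuous_received_joint A w).measurable

theorem channelLaw_quad_gt (hn : 1 ≤ s.n) (hL : 1 ≤ s.L) (hw : Set.InjOn w A) (C : s.Codebook)
    (y : ℝ) : channelLaw s.K s.n s.L
      {q | y < quad (cov C (A.image w))⁻¹ (received C A w q.1 q.2)} =
        ENNReal.ofReal (upperGamma (s.n * s.L) y / Real.Gamma (s.n * s.L)) := by
  have ha : (0 : ℝ) < s.n * s.L := by positivity
  have hm : Measurable fun q : (Fin s.K → Fin s.L → ℂ) × (Fin s.n → Fin s.L → ℂ) =>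
      quad (cov C (A.image w))⁻¹ (received C A w q.1 q.2) :=
    ((continuous_quad _).comp (continuous_received C A w)).measurable
  rw [← gammaMeasure_one_Ioi ha, ← map_quad_inv_cov C hn hL hw, Measure.map_apply hm measurableSet_Ioi]
  rfl

theorem measurable_quad_inv_cov : Measurable fun p : s.Codebook ×
    ((Fin s.K → Fin s.L → ℂ) × (Fin s.n → Fin s.L → ℂ)) =>
      quad (cov p.1 (A.image w))⁻¹ (received p.1 A w p.2.1 p.2.2) := by
  have h : Continuous fun p : s.Codebook × (Fin s.n → Fin s.L → ℂ) =>
      quad (cov p.1 (A.image w))⁻¹ p.2 := by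
    have h2 : Continuous fun p : s.Codebook × (Fin s.n → Fin s.L → ℂ) => (cov p.1 (A.image w))⁻¹ :=
      (continuous_inv_cov _).comp continuous_fst
    have h3 : Continuous fun p : s.Codebook × (Fin s.n → Fin s.L → ℂ) =>
        (Matrix.of p.2 : Matrix (Fin s.n) (Fin s.L) ℂ) := continuous_snd
    unfold quad
    fun_prop
  have := h.measurable.comp (s.measurable_codebook_received (A := A) (w := w))
  exact this

/-- The probability of a bad threshold event, when some message is missed. -/
theorem fullLaw_not_good_le (hn : 1 ≤ s.n) (hL : 1 ≤ s.L) (π : ℕ → ℝ) (hw : Set.InjOn w A)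
    {Ka K' t : ℕ} (hWK : (A.image w).card = Ka) {T₁ : Finset (Fin s.M)} (hT₁ : T₁ ⊆ A.image w)
    (hT₁c : T₁.card = t + s.missed Ka K') (hpos : 0 < t + s.missed Ka K') {ω : ℝ} (hω0 : 0 ≤ ω)
    (hω1 : ω ≤ 1) (ν : ℝ) (δ : ℝ) :
    s.fullLaw {p | ¬ s.Good π ω ν p.1 (received p.1 A w p.2.1 p.2.2) (A.image w) T₁} ≤
      ENNReal.ofReal (upperGamma (s.n * s.L) (s.n * s.L * (1 + δ)) / Real.Gamma (s.n * s.L)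
        + ∫ C, s.q2Integrand π Ka K' t ω ν δ C ∂s.codebookLaw) := by
  have ha : (0 : ℝ) < s.n * s.L := by positivity
  set W := A.image w with hW
  obtain ⟨σ, -, e1, e, -, -⟩ := exists_reindex (Finset.empty_subset T₁) hT₁
    (Finset.empty_subset ∅) (Finset.disjoint_empty_right W)
  set G : Set (s.Codebook × ((Fin s.K → Fin s.L → ℂ) × (Fin s.n → Fin s.L → ℂ))) :=
    {p | ¬ s.Good π ω ν p.1 (received p.1 A w p.2.1 p.2.2) W T₁} with hG
  have hGm : MeasurableSet G := s.measurable_codebook_received (s.measurableSet_good π ω ν W T₁).compl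
  set X : Set (s.Codebook × ((Fin s.K → Fin s.L → ℂ) × (Fin s.n → Fin s.L → ℂ))) :=
    {p | s.n * s.L * (1 + δ) < quad (cov p.1 W)⁻¹ (received p.1 A w p.2.1 p.2.2)} with hX
  have hXm : MeasurableSet X := measurableSet_lt measurable_const s.measurable_quad_inv_cov
  have hu := upperGamma_div_mem ha (s.n * s.L * (1 + δ))
  have hq := s.q2Integrand_mem hn hL π hpos ω ν δ
  rw [ENNReal.ofReal_add hu.1 (integral_nonneg fun C => (hq C).1)]
  -- Split according to whether the Gamma variable tr(YᴴF⁻¹Y) exceeds nL(1 + δ).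
  refine (measure_mono (fun p hp => ?_ : G ⊆ X ∪ (G ∩ Xᶜ))).trans
    ((measure_union_le _ _).trans (add_le_add ?_ ?_))
  · by_cases h : p ∈ X
    · exact Or.inl h
    · exact Or.inr ⟨hp, h⟩
  · refine (s.fullLaw_le hXm (f := fun _ => upperGamma (s.n * s.L) (s.n * s.L * (1 + δ)) /
      Real.Gamma (s.n * s.L)) measurable_const (fun _ => hu.1) (fun _ => hu.2) (Equiv.refl _)
      fun C => (s.channelLaw_quad_gt hn hL hw C _).le).trans_eq ?_
    simp
  refine s.fullLaw_le (hGm.inter hXm.compl) (s.measurable_q2Integrand hn hL π hpos ω ν δ)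
    (fun C => (hq C).1) (fun C => (hq C).2) σ fun C => ?_
  set C' : s.Codebook := fun i => C (σ i) with hC'
  have mW : (s.W Ka).map σ.toEmbedding = W := by rw [← hWK]; exact e
  have mW₁ : (s.W₁ Ka K' t).map σ.toEmbedding = T₁ := by
    rw [Params.W₁, add_comm, ← hT₁c]; exact e1
  have hF : s.F C' Ka = cov C W := by rw [F, cov_reindex, mW]
  have hF₁ : s.F₁ C' Ka K' t = cov C (W \ T₁) := by
    rw [F₁, cov_reindex, Finset.map_sdiff, mW, mW₁]
  have hV : subCode C' (s.W₁ Ka K' t) * (subCode C' (s.W₁ Ka K' t))ᴴ =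
      subCode C T₁ * (subCode C T₁)ᴴ := by rw [subCode_reindex, mW₁]
  have hm : 1 ≤ s.m Ka K' t := lt_min hn hpos
  rw [q2Integrand, hF, hF₁, hV]
  set N := s.n * s.L * (1 + δ) * (1 - ω)
    - ω * (s.L * logDet (cov C (W \ T₁)) - Real.log (s.eb₁ π Ka K' t))
    + s.L * logDet (cov C W) - Real.log (s.eb π Ka) - s.n * s.L * ν with hN
  set g := geomEig (s.m Ka K' t) ((cov C (W \ T₁))⁻¹ * (subCode C T₁ * (subCode C T₁)ᴴ)) with hg
  -- In the failed inequality the form of F₁⁻¹ is written as that of F⁻¹ plus the excess. The form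
  -- of F⁻¹ then has the nonnegative coefficient 1 - ω and is replaced by its bound nL(1 + δ).
  have hsub : Prod.mk C ⁻¹' (G ∩ Xᶜ) ⊆ {q | ¬ (0 < ω ∧ s.eb₁ π Ka K' t = 0) ∧
      ω * quad ((cov C (W \ T₁))⁻¹ - (cov C W)⁻¹) (received C A w q.1 q.2) < N} := by
    rintro q ⟨h1, h2⟩
    have h2 : quad (cov C W)⁻¹ (received C A w q.1 q.2) ≤ s.n * s.L * (1 + δ) := not_lt.1 h2
    have h1 : ¬ s.Good π ω ν C (received C A w q.1 q.2) W T₁ := h1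
    rw [Good, not_or, hWK, hT₁c, not_le] at h1
    refine ⟨h1.1, ?_⟩
    have h3 := h1.2
    have h4 := mul_le_mul_of_nonneg_left h2 (sub_nonneg.2 hω1)
    rw [quad_sub, hN, eb₁, eb]
    simp only [rawMetric] at h3
    nlinarith
  by_cases h0 : 0 < ω ∧ s.eb₁ π Ka K' t = 0
  · exact (measure_mono (t := ∅) fun q hq => (hsub hq).1 h0).trans (by simp)
  rw [if_neg h0, lowerGammaRatio]
  -- No rescaling is possible when ω g = 0, but the excess form is nonnegative, so the event still
  -- forces N > 0. This matches the convention in `lowerGammaRatio`.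
  by_cases hωg : ω * g = 0
  · rw [if_pos hωg]
    split_ifs with hNpos
    · rw [ENNReal.ofReal_one]; exact prob_le_one
    · exact (measure_mono (t := ∅) fun q hq => hNpos ((mul_nonneg hω0 (quad_nonneg
        (posSemidef_inv_cov_sub C hT₁) _)).trans_lt (hsub hq).2)).trans (by simp)
  · rw [if_neg hωg]
    have hωpos : 0 < ω := hω0.lt_of_ne' (left_ne_zero_of_mul hωg)
    have := (channelLaw_quad_sub_le C hL hw hT₁ hm (right_ne_zero_of_mul hωg) hg.symm (N / ω)).2
    rw [div_div] at this
    refine (measure_mono fun q hq => ?_).trans this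
    exact (le_div_iff₀' hωpos).2 (hsub hq).2.le

theorem q20_nonneg (hn : 1 ≤ s.n) (hL : 1 ≤ s.L) (π : ℕ → ℝ) (Ka : ℕ) (ω ν : ℝ) :
    0 ≤ s.q20 π Ka ω ν := by
  have ha : (0 : ℝ) < s.n * s.L := by positivity
  unfold q20
  split_ifs
  · exact le_rfl
  · exact integral_nonneg fun C => (upperGamma_div_mem ha _).1

/-- The probability of a bad threshold event, when no message is missed. -/
theorem fullLaw_not_good_empty_le (hn : 1 ≤ s.n) (hL : 1 ≤ s.L) (π : ℕ → ℝ) (hw : Set.InjOn w A)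
    {Ka : ℕ} (hWK : (A.image w).card = Ka) {ω : ℝ} (hω1 : ω ≤ 1) {ν : ℝ} (hν : 0 ≤ ν) :
    s.fullLaw {p | ¬ s.Good π ω ν p.1 (received p.1 A w p.2.1 p.2.2) (A.image w) ∅} ≤
      ENNReal.ofReal (s.q20 π Ka ω ν) := by
  have ha : (0 : ℝ) < s.n * s.L := by positivity
  set W := A.image w with hW
  obtain ⟨σ, -, -, e, -, -⟩ := exists_reindex (Finset.empty_subset ∅) (Finset.empty_subset W)
    (Finset.empty_subset ∅) (Finset.disjoint_empty_right W)
  set G : Set (s.Codebook × ((Fin s.K → Fin s.L → ℂ) × (Fin s.n → Fin s.L → ℂ))) :=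
    {p | ¬ s.Good π ω ν p.1 (received p.1 A w p.2.1 p.2.2) W ∅} with hG
  have hGm : MeasurableSet G := s.measurable_codebook_received (s.measurableSet_good π ω ν W ∅).compl
  -- With nothing missed, both metrics in `Good` are the same, and failure means that (1 - ω) times
  -- this metric exceeds nLν. At ω = 1 this contradicts ν ≥ 0.
  have key : ∀ C q, (C, q) ∈ G → s.n * s.L * ν <
      (1 - ω) * (s.L * logDet (cov C W) - Real.log (s.eb π Ka) +
        quad (cov C W)⁻¹ (received C A w q.1 q.2)) := by
    intro C q h
    have h : ¬ s.Good π ω ν C (received C A w q.1 q.2) W ∅ := h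
    rw [Good, not_or, not_le, Finset.sdiff_empty, Finset.card_empty, Nat.sub_zero, hWK] at h
    have := h.2
    simp only [rawMetric] at this
    rw [eb]
    linarith
  unfold q20
  split_ifs with h1
  · refine (measure_mono (t := ∅) fun p hp => ?_).trans (by simp)
    have := key p.1 p.2 hp
    rw [h1, sub_self, zero_mul] at this
    exact absurd this (not_lt.2 (by positivity))
  have hω : 0 < 1 - ω := sub_pos.2 (hω1.lt_of_ne h1)
  have hF : Measurable fun C : s.Codebook => logDet (s.F C Ka) :=
    (continuous_logDet_cov _).measurable
  refine s.fullLaw_le hGm ((measurable_upperGamma_div ha).comp (by fun_prop))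
    (fun C => (upperGamma_div_mem ha _).1) (fun C => (upperGamma_div_mem ha _).2) σ fun C => ?_
  have mW : (s.W Ka).map σ.toEmbedding = W := by rw [← hWK]; exact e
  have hF : s.F (fun i => C (σ i)) Ka = cov C W := by rw [F, cov_reindex, mW]
  rw [hF, ← s.channelLaw_quad_gt hn hL hw C]
  refine measure_mono fun q hq => ?_
  have := (div_lt_iff₀' hω).2 (key C q hq)
  simp only [Set.mem_ofPred_eq]
  linarith

end Params

/-! ### Union bound over error patterns -/

namespace Params

variable (s : Params) {A : Finset (Fin s.K)} {w : Fin s.K → Fin s.M}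

/-- The list `D` is optimal for the metric among the lists that are admissible for the estimate
`K'`. -/
def IsOptimal (π : ℕ → ℝ) (K' : ℕ) (C : s.Codebook) (Y : Fin s.n → Fin s.L → ℂ)
    (D : Finset (Fin s.M)) : Prop :=
  D.card ∈ Finset.Icc (s.lo K') (s.hi K') ∧
    ∀ S : Finset (Fin s.M), S.card ∈ Finset.Icc (s.lo K') (s.hi K') →
      s.mapMetric π C Y D ≤ s.mapMetric π C Y S

theorem q1_nonneg {π : ℕ → ℝ} (hπ : ∀ k, 0 ≤ π k) (Ka K' t t' : ℕ) (ω ν : ℝ) :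
    0 ≤ s.q1 π Ka K' t t' ω ν :=
  mul_nonneg (by positivity) (integral_nonneg fun C => s.q1Integrand_nonneg hπ Ka K' t t' ω ν C)

theorem q2_inner_nonneg (hn : 1 ≤ s.n) (hL : 1 ≤ s.L) (π : ℕ → ℝ) {Ka K' t : ℕ}
    (h : 0 < t + s.missed Ka K') (ω ν δ : ℝ) :
    0 ≤ upperGamma (s.n * s.L) (s.n * s.L * (1 + δ)) / Real.Gamma (s.n * s.L)
      + ∫ C, s.q2Integrand π Ka K' t ω ν δ C ∂s.codebookLaw := by
  have ha : (0 : ℝ) < s.n * s.L := by positivity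
  exact add_nonneg (upperGamma_div_mem ha _).1
    (integral_nonneg fun C => (s.q2Integrand_mem hn hL π h ω ν δ C).1)

theorem q2_nonneg (hn : 1 ≤ s.n) (hL : 1 ≤ s.L) (π : ℕ → ℝ) {Ka K' t : ℕ}
    (h : 0 < t + s.missed Ka K') (ω ν : ℝ) : 0 ≤ s.q2 π Ka K' t ω ν :=
  mul_nonneg (Nat.cast_nonneg _) (Real.iInf_nonneg fun δ => s.q2_inner_nonneg hn hL π h ω ν δ)

theorem pErr_inner_nonneg (hn : 1 ≤ s.n) (hL : 1 ≤ s.L) {π : ℕ → ℝ} (hπ : ∀ k, 0 ≤ π k)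
    (Ka K' t t' : ℕ) (ω ν : ℝ) : 0 ≤ s.q1 π Ka K' t t' ω ν
      + if 0 < t + s.missed Ka K' then s.q2 π Ka K' t ω ν else s.q20 π Ka ω ν := by
  refine add_nonneg (s.q1_nonneg hπ ..) ?_
  split_ifs with h
  · exact s.q2_nonneg hn hL π h ω ν
  · exact s.q20_nonneg hn hL π Ka ω ν

theorem pErr_nonneg (hn : 1 ≤ s.n) (hL : 1 ≤ s.L) {π : ℕ → ℝ} (hπ : ∀ k, 0 ≤ π k)
    (Ka K' t t' : ℕ) : 0 ≤ s.pErr π Ka K' t t' :=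
  Real.iInf_nonneg fun _ => s.pErr_inner_nonneg hn hL hπ ..

/-- The probability that some optimal list has the given numbers of missed and of extra messages. -/
theorem fullLaw_err_le (hn : 1 ≤ s.n) (hL : 1 ≤ s.L) {π : ℕ → ℝ} (hπ : ∀ k, 0 ≤ π k)
    (hw : Set.InjOn w A) {Ka : ℕ} (K' t t' : ℕ) (hWK : (A.image w).card = Ka)
    (hlh : s.lo K' ≤ s.hi K') (hb : s.listPrior π Ka ≠ 0) :
    s.fullLaw {p | ∃ D, s.IsOptimal π K' p.1 (received p.1 A w p.2.1 p.2.2) D ∧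
        (A.image w \ D).card = t + s.missed Ka K' ∧ (D \ A.image w).card = t' + s.extra Ka K'} ≤
      ENNReal.ofReal (s.pErr π Ka K' t t') := by
  have hne : Nonempty {x : ℝ × ℝ // 0 ≤ x.1 ∧ x.1 ≤ 1 ∧ 0 ≤ x.2} := ⟨⟨(0, 0), by simp⟩⟩
  refine ENNReal_le_ofReal_iInf (measure_ne_top _ _)
    (fun _ => s.pErr_inner_nonneg hn hL hπ ..) ?_
  rintro ⟨⟨ω, ν⟩, hω0, hω1, hν⟩
  simp only at hω0 hω1 hν ⊢
  set W := A.image w with hW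
  -- A list D is recovered from T₁ = W \ D and T₂ = D \ W, so the union runs over subsets of W and
  -- of its complement with the prescribed sizes.
  set P₁ := W.powersetCard (t + s.missed Ka K') with hP₁
  set P₂ := Wᶜ.powersetCard (t' + s.extra Ka K') with hP₂
  have c₁ : P₁.card = Ka.choose (t + s.missed Ka K') := by rw [hP₁, Finset.card_powersetCard, hWK]
  have c₂ : P₂.card = (s.M - Ka).choose (t' + s.extra Ka K') := by
    rw [hP₂, Finset.card_powersetCard, Finset.card_compl, hWK, Fintype.card_fin]
  set E₁ : Finset (Fin s.M) → Finset (Fin s.M) →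
      Set (s.Codebook × ((Fin s.K → Fin s.L → ℂ) × (Fin s.n → Fin s.L → ℂ))) := fun T₁ T₂ =>
    {p | (∀ S : Finset (Fin s.M), S.card ∈ Finset.Icc (s.lo K') (s.hi K') →
        s.mapMetric π p.1 (received p.1 A w p.2.1 p.2.2) ((W \ T₁) ∪ T₂) ≤
          s.mapMetric π p.1 (received p.1 A w p.2.1 p.2.2) S) ∧
        s.Good π ω ν p.1 (received p.1 A w p.2.1 p.2.2) W T₁} with hE₁
  -- The threshold event depends on T₁ alone. Its failure is therefore counted once per T₁, and `q2`
  -- carries only one binomial coefficient.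
  set E₂ : Finset (Fin s.M) →
      Set (s.Codebook × ((Fin s.K → Fin s.L → ℂ) × (Fin s.n → Fin s.L → ℂ))) := fun T₁ =>
    {p | ¬ s.Good π ω ν p.1 (received p.1 A w p.2.1 p.2.2) W T₁} with hE₂
  have hsub : {p : s.Codebook × ((Fin s.K → Fin s.L → ℂ) × (Fin s.n → Fin s.L → ℂ)) |
      ∃ D, s.IsOptimal π K' p.1 (received p.1 A w p.2.1 p.2.2) D ∧
        (W \ D).card = t + s.missed Ka K' ∧ (D \ W).card = t' + s.extra Ka K'} ⊆
      (⋃ T₁ ∈ P₁, ⋃ T₂ ∈ P₂, E₁ T₁ T₂) ∪ ⋃ T₁ ∈ P₁, E₂ T₁ := by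
    rintro p ⟨D, hD, h1, h2⟩
    have m1 : W \ D ∈ P₁ := Finset.mem_powersetCard.2 ⟨Finset.sdiff_subset, h1⟩
    have m2 : D \ W ∈ P₂ := Finset.mem_powersetCard.2
      ⟨fun i hi => Finset.mem_compl.2 (Finset.mem_sdiff.1 hi).2, h2⟩
    by_cases hg : s.Good π ω ν p.1 (received p.1 A w p.2.1 p.2.2) W (W \ D)
    · refine Or.inl (Set.mem_biUnion m1 (Set.mem_biUnion m2 ⟨?_, hg⟩))
      have : W \ (W \ D) ∪ D \ W = D := by
        ext i; simp only [Finset.mem_union, Finset.mem_sdiff]; tauto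
      rw [this]
      exact hD.2
    · exact Or.inr (Set.mem_biUnion m1 hg)
  have hP₁mem : ∀ T₁ ∈ P₁, T₁ ⊆ W ∧ T₁.card = t + s.missed Ka K' := fun T₁ h =>
    Finset.mem_powersetCard.1 h
  have b1 : s.fullLaw (⋃ T₁ ∈ P₁, ⋃ T₂ ∈ P₂, E₁ T₁ T₂) ≤
      ENNReal.ofReal (s.q1 π Ka K' t t' ω ν) := by
    calc s.fullLaw (⋃ T₁ ∈ P₁, ⋃ T₂ ∈ P₂, E₁ T₁ T₂)
        ≤ ∑ T₁ ∈ P₁, ∑ T₂ ∈ P₂, s.fullLaw (E₁ T₁ T₂) :=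
          (measure_biUnion_finset_le _ _).trans
            (Finset.sum_le_sum fun T₁ _ => measure_biUnion_finset_le _ _)
      _ ≤ ∑ T₁ ∈ P₁, ∑ T₂ ∈ P₂,
          ENNReal.ofReal (∫ C, s.q1Integrand π Ka K' t t' ω ν C ∂s.codebookLaw) := by
        refine Finset.sum_le_sum fun T₁ h₁ => Finset.sum_le_sum fun T₂ h₂ => ?_
        have h₂ := Finset.mem_powersetCard.1 h₂
        exact s.fullLaw_prefer_le hπ hw hWK hlh hb (hP₁mem T₁ h₁).1 (hP₁mem T₁ h₁).2
          (Finset.disjoint_left.2 fun i hi hi' => Finset.mem_compl.1 (h₂.1 hi') hi) h₂.2 ω ν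
      _ = _ := by
        rw [Finset.sum_const, Finset.sum_const, c₁, c₂, nsmul_eq_mul, nsmul_eq_mul, q1,
          mul_assoc, ENNReal.ofReal_mul (Nat.cast_nonneg _),
          ENNReal.ofReal_mul (Nat.cast_nonneg _), ENNReal.ofReal_natCast, ENNReal.ofReal_natCast]
        rfl
  have b2 : s.fullLaw (⋃ T₁ ∈ P₁, E₂ T₁) ≤ ENNReal.ofReal
      (if 0 < t + s.missed Ka K' then s.q2 π Ka K' t ω ν else s.q20 π Ka ω ν) := by
    refine (measure_biUnion_finset_le _ _).trans ?_
    split_ifs with hpos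
    · have hb : ∀ T₁ ∈ P₁, s.fullLaw (E₂ T₁) ≤ ENNReal.ofReal (⨅ δ : {δ : ℝ // 0 ≤ δ},
          (upperGamma (s.n * s.L) (s.n * s.L * (1 + δ.1)) / Real.Gamma (s.n * s.L)
            + ∫ C, s.q2Integrand π Ka K' t ω ν δ.1 C ∂s.codebookLaw)) := by
        intro T₁ h₁
        have : Nonempty {δ : ℝ // 0 ≤ δ} := ⟨⟨0, le_rfl⟩⟩
        exact ENNReal_le_ofReal_iInf (measure_ne_top _ _)
          (fun δ => s.q2_inner_nonneg hn hL π hpos ω ν δ) fun δ =>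
          s.fullLaw_not_good_le hn hL π hw hWK (hP₁mem T₁ h₁).1 (hP₁mem T₁ h₁).2 hpos hω0 hω1 ν δ
      refine (Finset.sum_le_sum hb).trans_eq ?_
      rw [Finset.sum_const, c₁, nsmul_eq_mul, q2, ENNReal.ofReal_mul (Nat.cast_nonneg _),
        ENNReal.ofReal_natCast]
      rfl
    · have h0 : t + s.missed Ka K' = 0 := by omega
      rw [hP₁, h0, Finset.powersetCard_zero, Finset.sum_singleton]
      exact s.fullLaw_not_good_empty_le hn hL π hw hWK hω1 hν
  rw [ENNReal.ofReal_add (s.q1_nonneg hπ ..) ?_]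
  · exact (measure_mono hsub).trans ((measure_union_le _ _).trans (add_le_add b1 b2))
  · split_ifs with h
    · exact s.q2_nonneg hn hL π h ω ν
    · exact s.q20_nonneg hn hL π Ka ω ν

end Params

/-! ### The energy detector -/

theorem logDet_le_trace_of_similarDiag {n : ℕ} {H : Matrix (Fin n) (Fin n) ℂ} {d : Fin n → ℝ}
    (h : SimilarDiag H d) (hd : ∀ i, 0 < d i) : logDet H ≤ H.trace.re - n := by
  have htr : H.trace = ((∑ i, d i : ℝ) : ℂ) := by
    obtain ⟨P, hP⟩ := h
    rw [hP, Matrix.trace_units_conj, Matrix.trace_diagonal, Complex.ofReal_sum]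
  rw [logDet, h.det_eq, htr, Complex.ofReal_re, Complex.ofReal_re,
    Real.log_prod fun i _ => (hd i).ne']
  calc ∑ i, Real.log (d i) ≤ ∑ i, (d i - 1) :=
        Finset.sum_le_sum fun i _ => Real.log_le_sub_one_of_pos (hd i)
    _ = _ := by simp

theorem trace_cov {n M : ℕ} (C : Fin M → Fin n → ℂ) (S : Finset (Fin M)) :
    (cov C S).trace.re = n + ∑ m ∈ S, energy (C m) := by
  have : (cov C S).trace = n + ∑ i, ∑ m ∈ S, C m i * star (C m i) := by
    rw [cov, Matrix.trace_add, Matrix.trace_one, Fintype.card_fin, Matrix.trace]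
    congr 1
    refine Finset.sum_congr rfl fun i _ => ?_
    rw [Matrix.diag_apply, Matrix.mul_apply, ← Finset.sum_coe_sort S]
    rfl
  rw [this, Complex.add_re, Complex.natCast_re, Finset.sum_comm, Complex.re_sum]
  congr 1
  refine Finset.sum_congr rfl fun m _ => ?_
  rw [energy, Complex.re_sum]
  refine Finset.sum_congr rfl fun i _ => ?_
  rw [Complex.star_def, Complex.mul_conj, Complex.ofReal_re, Complex.sq_norm]

theorem complexGaussian_zero : complexGaussian 0 = Measure.dirac 0 := by
  have hm : Measurable fun p : ℝ × ℝ => (p.1 : ℂ) + (p.2 : ℂ) * Complex.I := by fun_prop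
  rw [complexGaussian, zero_div, gaussianReal_zero_var, Measure.dirac_prod_dirac,
    Measure.map_dirac' hm]
  simp

theorem energy_real_smul {n : ℕ} (a : ℝ) (x : Fin n → ℂ) :
    energy (fun i => (a : ℂ) * x i) = a ^ 2 * energy x := by
  simp only [energy, norm_mul, Complex.norm_real, mul_pow, Finset.mul_sum, Real.norm_eq_abs, sq_abs]

theorem energy_nonneg {n : ℕ} (x : Fin n → ℂ) : 0 ≤ energy x :=
  Finset.sum_nonneg fun i _ => by positivity

theorem eq_zero_of_energy {n : ℕ} {x : Fin n → ℂ} (h : energy x = 0) : x = 0 := by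
  funext i
  have := (Finset.sum_eq_zero_iff_of_nonneg fun i _ => by positivity).1 h i (Finset.mem_univ i)
  simpa using this

theorem ae_energy_codewordLaw {n : ℕ} (hn : 1 ≤ n) {P' : ℝ} (hP' : 0 ≤ P') {e : Ensemble}
    (h : e = .spherical ∨ P' = 0) : ∀ᵐ x ∂codewordLaw n P' e, energy x = n * P' := by
  have hmeas : MeasurableSet {x : Fin n → ℂ | energy x = n * P'} :=
    (isClosed_eq continuous_energy continuous_const).measurableSet
  cases e with
  | gaussian =>
    have h : P' = 0 := h.resolve_left (by simp)
    rw [codewordLaw, h, Real.toNNReal_zero, complexGaussian_zero]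
    have : ∀ i, ∀ᵐ x : Fin n → ℂ ∂Measure.pi fun _ => Measure.dirac (0 : ℂ), x i = 0 := fun i =>
      (measurePreserving_eval (fun _ : Fin n => Measure.dirac (0 : ℂ)) i).quasiMeasurePreserving.ae
        (p := fun z => z = 0) (by rw [ae_dirac_eq]; rfl)
    filter_upwards [ae_all_iff.2 this] with x hx
    simp [energy, hx]
  | spherical =>
    have hm : Measurable fun (x : Fin n → ℂ) i =>
        ((Real.sqrt (n * P') / Real.sqrt (energy x) : ℝ) : ℂ) * x i := by
      have := (continuous_energy (n := n)).measurable
      fun_prop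
    rw [codewordLaw, ae_map_iff hm.aemeasurable hmeas]
    have hne : Nonempty (Fin n) := ⟨⟨0, hn⟩⟩
    have h0 : ∀ᵐ x : Fin n → ℂ, x ≠ 0 := by
      rw [ae_iff]
      simp
    filter_upwards [ProbabilityTheory.cond_absolutelyContinuous h0] with x hx
    have hpos : 0 < energy x := (energy_nonneg x).lt_of_ne' fun h => hx (eq_zero_of_energy h)
    rw [energy_real_smul, div_pow, Real.sq_sqrt (by positivity), Real.sq_sqrt hpos.le,
      div_mul_cancel₀ _ hpos.ne']

namespace Params

variable (s : Params) {A : Finset (Fin s.K)} {w : Fin s.K → Fin s.M}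

theorem ae_energy (hn : 1 ≤ s.n) (hP' : 0 ≤ s.P') (h : s.ens = .spherical ∨ s.P' = 0) :
    ∀ᵐ C ∂s.codebookLaw, ∀ m, energy (C m) = s.n * s.P' := by
  refine ae_all_iff.2 fun m => ?_
  exact (measurePreserving_eval (fun _ : Fin s.M => codewordLaw s.n s.P' s.ens)
    m).quasiMeasurePreserving.ae (ae_energy_codewordLaw hn hP' h)

/-- The integrand of `pEst1`. -/
def est1Integrand (Ka K' : ℕ) (C : s.Codebook) : ℝ :=
  ⨅ ρ : {ρ : ℝ // 0 ≤ ρ},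
    Real.exp (ρ.1 * (s.n * s.L * (1 + ((K' : ℝ) + 1 / 2) * s.P'))
      - s.L * logDet (1 + (ρ.1 : ℂ) • cov C (msgs s.M 0 Ka)))

/-- The integrand of `pEst2`. -/
def est2Integrand (Ka K' : ℕ) (C : s.Codebook) : ℝ :=
  ⨅ ρ : {ρ : ℝ // 0 ≤ ρ ∧ ρ < 1 / (1 + maxEig C (msgs s.M 0 Ka))},
    Real.exp (-ρ.1 * (s.n * s.L * (1 + ((K' : ℝ) - 1 / 2) * s.P'))
      - s.L * logDet (1 - (ρ.1 : ℂ) • cov C (msgs s.M 0 Ka)))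

theorem est1Integrand_mem (Ka K' : ℕ) (C : s.Codebook) :
    0 ≤ s.est1Integrand Ka K' C ∧ s.est1Integrand Ka K' C ≤ 1 := by
  refine ⟨Real.iInf_nonneg fun _ => (Real.exp_pos _).le,
    (ciInf_le ⟨0, ?_⟩ ⟨0, le_rfl⟩).trans_eq ?_⟩
  · rintro _ ⟨x, rfl⟩
    exact (Real.exp_pos _).le
  · simp [logDet]

theorem zero_lt_inv_maxEig (hn : 1 ≤ s.n) (C : s.Codebook) (S : Finset (Fin s.M)) :
    0 < 1 / (1 + maxEig C S) :=
  (lt_inv_maxEig_iff hn C S le_rfl).2 (by simpa using (posDef_cov C S).inv)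

theorem est2Integrand_mem (hn : 1 ≤ s.n) (Ka K' : ℕ) (C : s.Codebook) :
    0 ≤ s.est2Integrand Ka K' C ∧ s.est2Integrand Ka K' C ≤ 1 := by
  refine ⟨Real.iInf_nonneg fun _ => (Real.exp_pos _).le,
    (ciInf_le ⟨0, ?_⟩ ⟨0, le_rfl, s.zero_lt_inv_maxEig hn C _⟩).trans_eq ?_⟩
  · rintro _ ⟨x, rfl⟩
    exact (Real.exp_pos _).le
  · simp [logDet]

theorem one_le_integral_codebookLaw {f : s.Codebook → ℝ} (hf : Measurable f)
    (hf1 : ∀ C, 0 ≤ f C ∧ f C ≤ 1) (h : ∀ᵐ C ∂s.codebookLaw, 1 ≤ f C) :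
    1 ≤ ∫ C, f C ∂s.codebookLaw := by
  have hint : Integrable f s.codebookLaw :=
    Integrable.of_bound hf.aestronglyMeasurable 1 (by
      filter_upwards with C
      rw [Real.norm_of_nonneg (hf1 C).1]
      exact (hf1 C).2)
  calc (1 : ℝ) = ∫ _, 1 ∂s.codebookLaw := by simp
    _ ≤ _ := integral_mono_ae (integrable_const _) hint h

theorem trace_cov_msgs {Ka : ℕ} (hKa : Ka ≤ s.M) {C : s.Codebook}
    (hC : ∀ m, energy (C m) = s.n * s.P') :
    (cov C (msgs s.M 0 Ka)).trace.re = s.n * (1 + Ka * s.P') := by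
  rw [trace_cov, Finset.sum_congr rfl fun m _ => hC m, Finset.sum_const, card_msgs_zero hKa,
    nsmul_eq_mul]
  ring

/-- With constant codeword energy, log det(1 + ρF) ≤ ρ tr F = ρ n(1 + Ka P'), so no exponent is
negative and the bound is trivial. This is why spherical codewords need no exception at K' = Ku,
where K' + 1 is not a candidate; it also covers P' = 0, where all candidates tie. -/
theorem one_le_pEst1 (hn : 1 ≤ s.n) (hP' : 0 ≤ s.P') (h : s.ens = .spherical ∨ s.P' = 0)
    {Ka K' : ℕ} (hKa : Ka ≤ s.M) (hle : Ka * s.P' ≤ K' * s.P') : 1 ≤ s.pEst1 Ka K' := by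
  refine s.one_le_integral_codebookLaw (s.measurable_pEst1_integrand Ka K')
    (s.est1Integrand_mem Ka K') ?_
  filter_upwards [s.ae_energy hn hP' h] with C hC
  have : Nonempty {ρ : ℝ // 0 ≤ ρ} := ⟨⟨0, le_rfl⟩⟩
  refine le_ciInf fun ⟨ρ, hρ⟩ => Real.one_le_exp ?_
  have h1 := logDet_le_trace (posDef_one_add_smul_cov C (msgs s.M 0 Ka) hρ)
  rw [Matrix.trace_add, Matrix.trace_one, Fintype.card_fin, Matrix.trace_smul, Complex.add_re,
    Complex.natCast_re, smul_eq_mul, Complex.re_ofReal_mul, s.trace_cov_msgs hKa hC] at h1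
  have h2 : logDet (1 + (ρ : ℂ) • cov C (msgs s.M 0 Ka)) ≤
      ρ * (s.n * (1 + ((K' : ℝ) + 1 / 2) * s.P')) := by
    refine h1.trans ?_
    have : ρ * (s.n * (1 + Ka * s.P')) ≤ ρ * (s.n * (1 + ((K' : ℝ) + 1 / 2) * s.P')) := by
      refine mul_le_mul_of_nonneg_left (mul_le_mul_of_nonneg_left ?_ (Nat.cast_nonneg _)) hρ
      linarith
    linarith
  have := mul_le_mul_of_nonneg_left h2 (Nat.cast_nonneg s.L : (0 : ℝ) ≤ s.L)
  simp only
  linarith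

/-- The mirror image for K' = Kl, using log det(1 - ρF) ≤ -ρ tr F. -/
theorem one_le_pEst2 (hn : 1 ≤ s.n) (hP' : 0 ≤ s.P') (h : s.ens = .spherical ∨ s.P' = 0)
    {Ka K' : ℕ} (hKa : Ka ≤ s.M) (hle : K' * s.P' ≤ Ka * s.P') : 1 ≤ s.pEst2 Ka K' := by
  refine s.one_le_integral_codebookLaw (s.measurable_pEst2_integrand hn Ka K')
    (s.est2Integrand_mem hn Ka K') ?_
  filter_upwards [s.ae_energy hn hP' h] with C hC
  have : Nonempty {ρ : ℝ // 0 ≤ ρ ∧ ρ < 1 / (1 + maxEig C (msgs s.M 0 Ka))} :=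
    ⟨⟨0, le_rfl, s.zero_lt_inv_maxEig hn C _⟩⟩
  refine le_ciInf fun ⟨ρ, hρ, hρ'⟩ => Real.one_le_exp ?_
  have hpd := (lt_inv_maxEig_iff hn C _ hρ).1 hρ'
  obtain ⟨d, hd, -, hpos⟩ := similarDiag_mul hpd (posDef_cov C (msgs s.M 0 Ka)).isHermitian
  rw [← one_sub_smul_cov] at hd
  have h1 := logDet_le_trace_of_similarDiag hd (hpos.1 (posDef_cov _ _))
  rw [Matrix.trace_sub, Matrix.trace_one, Fintype.card_fin, Matrix.trace_smul, Complex.sub_re,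
    Complex.natCast_re, smul_eq_mul, Complex.re_ofReal_mul, s.trace_cov_msgs hKa hC] at h1
  have h2 : logDet (1 - (ρ : ℂ) • cov C (msgs s.M 0 Ka)) ≤
      -(ρ * (s.n * (1 + ((K' : ℝ) - 1 / 2) * s.P'))) := by
    refine h1.trans ?_
    have : ρ * (s.n * (1 + ((K' : ℝ) - 1 / 2) * s.P')) ≤ ρ * (s.n * (1 + Ka * s.P')) := by
      refine mul_le_mul_of_nonneg_left (mul_le_mul_of_nonneg_left ?_ (Nat.cast_nonneg _)) hρ
      linarith
    linarith
  have := mul_le_mul_of_nonneg_left h2 (Nat.cast_nonneg s.L : (0 : ℝ) ≤ s.L)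
  simp only
  linarith

/-- `K'` is a possible output of the energy detector. -/
def IsEstimate (Y : Fin s.n → Fin s.L → ℂ) (K' : ℕ) : Prop :=
  ∀ k ∈ Finset.Icc s.Kl s.Ku, s.energyMetric Y K' ≤ s.energyMetric Y k

/-- Chernoff bound with Q = -ρ times the identity; every ρ ≥ 0 is allowed since F⁻¹ + ρ stays
positive definite. -/
theorem fullLaw_quad_one_le (hw : Set.InjOn w A) {Ka : ℕ} (hWK : (A.image w).card = Ka) (K' : ℕ) :
    s.fullLaw {p | quad 1 (received p.1 A w p.2.1 p.2.2) ≤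
        s.n * s.L * (1 + ((K' : ℝ) + 1 / 2) * s.P')} ≤ ENNReal.ofReal (s.pEst1 Ka K') := by
  obtain ⟨σ, -, -, e, -, -⟩ := exists_reindex (Finset.empty_subset ∅)
    (Finset.empty_subset (A.image w)) (Finset.empty_subset ∅) (Finset.disjoint_empty_right _)
  have hm : Measurable fun p : s.Codebook × ((Fin s.K → Fin s.L → ℂ) × (Fin s.n → Fin s.L → ℂ)) =>
      quad 1 (received p.1 A w p.2.1 p.2.2) :=
    ((continuous_quad 1).comp (continuous_received_joint A w)).measurable
  refine s.fullLaw_le (measurableSet_le hm measurable_const) (s.measurable_pEst1_integrand Ka K')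
    (fun C => (s.est1Integrand_mem Ka K' C).1) (fun C => (s.est1Integrand_mem Ka K' C).2) σ
    fun C => ?_
  have : Nonempty {ρ : ℝ // 0 ≤ ρ} := ⟨⟨0, le_rfl⟩⟩
  refine ENNReal_le_ofReal_iInf (measure_ne_top _ _) (fun _ => (Real.exp_pos _).le) ?_
  rintro ⟨ρ, hρ⟩
  have hF : cov (fun i => C (σ i)) (msgs s.M 0 Ka) = cov C (A.image w) := by
    rw [cov_reindex, ← hWK, e]
  have hneg : ((-ρ : ℝ) : ℂ) • (1 : Matrix (Fin s.n) (Fin s.n) ℂ) = -((ρ : ℂ) • 1) := by simp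
  have hpd : ((cov C (A.image w))⁻¹ - ((-ρ : ℝ) : ℂ) • 1).PosDef := by
    rw [hneg, sub_neg_eq_add]
    exact (posDef_cov _ _).inv.add_posSemidef
      (Matrix.PosSemidef.one.smul (by exact_mod_cast hρ))
  refine (measure_mono fun q hq => ?_).trans ((channelLaw_nonneg_le C hw hpd
    (ρ * (s.n * s.L * (1 + ((K' : ℝ) + 1 / 2) * s.P')))).trans_eq ?_)
  · have hq : quad 1 (received C A w q.1 q.2) ≤ s.n * s.L * (1 + ((K' : ℝ) + 1 / 2) * s.P') := hq
    have := mul_le_mul_of_nonneg_left hq hρ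
    rw [Set.mem_ofPred_eq, quad_smul]
    linarith
  · rw [hF, hneg, neg_mul, sub_neg_eq_add, Matrix.smul_mul, Matrix.one_mul]

theorem fullLaw_le_quad_one (hn : 1 ≤ s.n) (hw : Set.InjOn w A) {Ka : ℕ}
    (hWK : (A.image w).card = Ka) (K' : ℕ) :
    s.fullLaw {p | s.n * s.L * (1 + ((K' : ℝ) - 1 / 2) * s.P') ≤
        quad 1 (received p.1 A w p.2.1 p.2.2)} ≤ ENNReal.ofReal (s.pEst2 Ka K') := by
  obtain ⟨σ, -, -, e, -, -⟩ := exists_reindex (Finset.empty_subset ∅)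
    (Finset.empty_subset (A.image w)) (Finset.empty_subset ∅) (Finset.disjoint_empty_right _)
  have hm : Measurable fun p : s.Codebook × ((Fin s.K → Fin s.L → ℂ) × (Fin s.n → Fin s.L → ℂ)) =>
      quad 1 (received p.1 A w p.2.1 p.2.2) :=
    ((continuous_quad 1).comp (continuous_received_joint A w)).measurable
  refine s.fullLaw_le (measurableSet_le measurable_const hm)
    (s.measurable_pEst2_integrand hn Ka K') (fun C => (s.est2Integrand_mem hn Ka K' C).1)
    (fun C => (s.est2Integrand_mem hn Ka K' C).2) σ fun C => ?_
  set C' : s.Codebook := fun i => C (σ i) with hC'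
  have : Nonempty {ρ : ℝ // 0 ≤ ρ ∧ ρ < 1 / (1 + maxEig C' (msgs s.M 0 Ka))} :=
    ⟨⟨0, le_rfl, s.zero_lt_inv_maxEig hn C' _⟩⟩
  refine ENNReal_le_ofReal_iInf (measure_ne_top _ _) (fun _ => (Real.exp_pos _).le) ?_
  rintro ⟨ρ, hρ, hρ'⟩
  have hF : cov C' (msgs s.M 0 Ka) = cov C (A.image w) := by
    rw [cov_reindex, ← hWK, e]
  have hpd : ((cov C (A.image w))⁻¹ - (ρ : ℂ) • 1).PosDef := by
    rw [← hF]
    exact (lt_inv_maxEig_iff hn C' _ hρ).1 hρ'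
  refine (measure_mono fun q hq => ?_).trans ((channelLaw_nonneg_le C hw hpd
    (-ρ * (s.n * s.L * (1 + ((K' : ℝ) - 1 / 2) * s.P')))).trans_eq ?_)
  · have hq : s.n * s.L * (1 + ((K' : ℝ) - 1 / 2) * s.P') ≤ quad 1 (received C A w q.1 q.2) := hq
    have := mul_le_mul_of_nonneg_left hq hρ
    rw [Set.mem_ofPred_eq, quad_smul]
    linarith
  · rw [hF, Matrix.smul_mul, Matrix.one_mul]

/-- If K' is at least as close as K' + 1, the normalized energy is at most the midpoint of the two
predicted energies, which are distinct because P' > 0. -/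
theorem quad_one_le_of_isEstimate (hn : 1 ≤ s.n) (hL : 1 ≤ s.L) (hP' : 0 < s.P')
    {Y : Fin s.n → Fin s.L → ℂ} {K' : ℕ} (h : s.IsEstimate Y K')
    (hK' : K' + 1 ∈ Finset.Icc s.Kl s.Ku) :
    quad 1 Y ≤ s.n * s.L * (1 + ((K' : ℝ) + 1 / 2) * s.P') := by
  have ha : (0 : ℝ) < s.n * s.L := by positivity
  have h := h _ hK'
  rw [energyMetric, energyMetric, ← quad_one, ← sq_le_sq] at h
  push_cast at h
  have : (1 / (s.n * s.L : ℝ)) * quad 1 Y ≤ 1 + ((K' : ℝ) + 1 / 2) * s.P' := by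
    by_contra! hc
    nlinarith
  rwa [one_div, inv_mul_le_iff₀ ha] at this

theorem le_quad_one_of_isEstimate (hn : 1 ≤ s.n) (hL : 1 ≤ s.L) (hP' : 0 < s.P')
    {Y : Fin s.n → Fin s.L → ℂ} {k : ℕ} (h : s.IsEstimate Y (k + 1))
    (hk : k ∈ Finset.Icc s.Kl s.Ku) :
    s.n * s.L * (1 + (((k + 1 : ℕ) : ℝ) - 1 / 2) * s.P') ≤ quad 1 Y := by
  have ha : (0 : ℝ) < s.n * s.L := by positivity
  have h := h _ hk
  rw [energyMetric, energyMetric, ← quad_one, ← sq_le_sq] at h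
  push_cast at h ⊢
  have : 1 + ((k : ℝ) + 1 - 1 / 2) * s.P' ≤ (1 / (s.n * s.L : ℝ)) * quad 1 Y := by
    by_contra! hc
    nlinarith
  rwa [one_div_mul_eq_div, le_div_iff₀' ha] at this

/-- The probability of a given output of the energy detector. -/
theorem fullLaw_isEstimate_le (hn : 1 ≤ s.n) (hL : 1 ≤ s.L) (hP' : 0 ≤ s.P')
    (hw : Set.InjOn w A) {Ka K' : ℕ} (hWK : (A.image w).card = Ka)
    (hKa : Ka ∈ Finset.Icc s.Kl s.Ku) (hK' : K' ∈ Finset.Icc s.Kl s.Ku) :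
    s.fullLaw {p | s.IsEstimate (received p.1 A w p.2.1 p.2.2) K'} ≤
      ENNReal.ofReal (s.pEst Ka K') := by
  rw [Finset.mem_Icc] at hKa hK'
  have hM : Ka ≤ s.M := hWK ▸ s.card_le_M _
  set E := {p : s.Codebook × ((Fin s.K → Fin s.L → ℂ) × (Fin s.n → Fin s.L → ℂ)) |
    s.IsEstimate (received p.1 A w p.2.1 p.2.2) K'} with hE
  have one : ∀ {x : ℝ}, 1 ≤ x → s.fullLaw E ≤ ENNReal.ofReal x := fun hx =>
    prob_le_one.trans (ENNReal.one_le_ofReal.2 hx)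
  -- Three cases: P' = 0 and the endpoint K' = Ku for spherical codewords, where the bound is at
  -- least 1; otherwise K' + 1 is a candidate and the comparison with it applies.
  have h1 : s.ens = .spherical ∨ K' ≠ s.Ku → s.fullLaw E ≤ ENNReal.ofReal (s.pEst1 Ka K') := by
    intro h
    rcases hP'.eq_or_lt with h0 | hpos
    · exact one (s.one_le_pEst1 hn hP' (Or.inr h0.symm) hM (by simp [← h0]))
    by_cases hK : K' = s.Ku
    · refine one (s.one_le_pEst1 hn hP' (Or.inl (h.resolve_right (by simpa using hK))) hM ?_)
      have : (Ka : ℝ) ≤ K' := by exact_mod_cast hK ▸ hKa.2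
      gcongr
    · refine (measure_mono fun p hp => ?_).trans (s.fullLaw_quad_one_le hw hWK K')
      exact s.quad_one_le_of_isEstimate hn hL hpos hp (Finset.mem_Icc.2 (by omega))
  have h2 : s.ens = .spherical ∨ K' ≠ s.Kl → s.fullLaw E ≤ ENNReal.ofReal (s.pEst2 Ka K') := by
    intro h
    rcases hP'.eq_or_lt with h0 | hpos
    · exact one (s.one_le_pEst2 hn hP' (Or.inr h0.symm) hM (by simp [← h0]))
    by_cases hK : K' = s.Kl
    · refine one (s.one_le_pEst2 hn hP' (Or.inl (h.resolve_right (by simpa using hK))) hM ?_)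
      have : (K' : ℝ) ≤ Ka := by exact_mod_cast hK ▸ hKa.1
      gcongr
    · refine (measure_mono fun p hp => ?_).trans (s.fullLaw_le_quad_one hn hw hWK K')
      obtain ⟨k, rfl⟩ : ∃ k, K' = k + 1 := ⟨K' - 1, by omega⟩
      exact s.le_quad_one_of_isEstimate hn hL hpos hp (Finset.mem_Icc.2 (by omega))
  unfold pEst
  cases hens : s.ens with
  | spherical =>
    simp only
    rw [ENNReal.ofReal_min]
    exact le_min (h1 (Or.inl hens)) (h2 (Or.inl hens))
  | gaussian =>
    simp only
    rw [ENNReal.ofReal_min]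
    refine le_min ?_ ?_
    · split_ifs with h
      · exact one le_rfl
      · exact h1 (Or.inr h)
    · split_ifs with h
      · exact one le_rfl
      · exact h2 (Or.inr h)

theorem pEst_nonneg (Ka K' : ℕ) : 0 ≤ s.pEst Ka K' := by
  have h1 : 0 ≤ s.pEst1 Ka K' :=
    integral_nonneg fun C => Real.iInf_nonneg fun _ => (Real.exp_pos _).le
  have h2 : 0 ≤ s.pEst2 Ka K' :=
    integral_nonneg fun C => Real.iInf_nonneg fun _ => (Real.exp_pos _).le
  unfold pEst
  cases s.ens with
  | spherical => exact le_min h1 h2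
  | gaussian =>
    refine le_min ?_ ?_ <;> split_ifs <;> first | exact zero_le_one | assumption

end Params

/-! ### Power violations -/

/-- The moment formula with R = θ times the identity gives (1 - θ)^(-n). -/
theorem map_energy_stdGaussianVec {n : ℕ} (hn : 1 ≤ n) :
    (stdGaussianVec (Fin n)).map energy = gammaMeasure n 1 := by
  have hm : Measurable (energy : (Fin n → ℂ) → ℝ) := continuous_energy.measurable
  have ha : (0 : ℝ) < n := by positivity
  have := isProbabilityMeasure_gammaMeasure ha one_pos
  have : IsProbabilityMeasure (stdGaussianVec (Fin n)) := by unfold stdGaussianVec; infer_instance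
  have := Measure.isProbabilityMeasure_map (μ := stdGaussianVec (Fin n)) hm.aemeasurable
  have key : ∀ θ : ℝ, |θ| < 1 → expMoment ((stdGaussianVec (Fin n)).map energy) θ =
      expMoment (gammaMeasure n 1) θ := by
    intro θ hθ
    have hθ1 : θ < 1 := (le_abs_self θ).trans_lt hθ
    have h1 : 0 < 1 - θ := by linarith
    have heq : (1 - (θ : ℂ) • (1 : Matrix (Fin n) (Fin n) ℂ)) =
        ((1 - θ : ℝ) : ℂ) • (1 : Matrix (Fin n) (Fin n) ℂ) := by
      push_cast; rw [sub_smul, one_smul]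
    have hpd : (1 - (θ : ℂ) • (1 : Matrix (Fin n) (Fin n) ℂ)).PosDef := by
      rw [heq]
      exact Matrix.PosDef.one.smul (by exact_mod_cast h1)
    have hquad : ∀ g : Fin n → ℂ,
        (star g ⬝ᵥ (((θ : ℂ) • (1 : Matrix (Fin n) (Fin n) ℂ)) *ᵥ g)).re = θ * energy g := by
      intro g
      rw [Matrix.smul_mulVec, Matrix.one_mulVec, dotProduct_smul, smul_eq_mul,
        Complex.re_ofReal_mul, energy, dotProduct, Complex.re_sum]
      congr 1
      refine Finset.sum_congr rfl fun i _ => ?_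
      rw [Pi.star_apply, Complex.star_def, mul_comm, Complex.mul_conj, Complex.ofReal_re,
        Complex.sq_norm]
    have h := lintegral_exp_quadForm_stdGaussianVec hpd
    simp_rw [hquad] at h
    rw [expMoment, lintegral_map (by fun_prop) hm, h, heq, Matrix.det_smul, Matrix.det_one,
      mul_one, Fintype.card_fin, ← Complex.ofReal_pow, Complex.ofReal_re,
      expMoment_gammaMeasure ha one_pos hθ1, Real.rpow_natCast, one_div, inv_pow]
  refine ext_of_expMoment one_pos (fun θ hθ => ?_) key
  rw [key θ hθ, expMoment_gammaMeasure ha one_pos ((le_abs_self θ).trans_lt hθ)]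
  exact ENNReal.ofReal_ne_top

theorem complexGaussian_eq_map (a : ℝ) :
    complexGaussian (a ^ 2).toNNReal = (complexGaussian 1).map fun z => (a : ℂ) * z := by
  have hv : (a ^ 2).toNNReal / 2 = NNReal.mk (a ^ 2) (sq_nonneg a) * (1 / 2) := by
    ext
    simp [Real.toNNReal_of_nonneg (sq_nonneg a), div_eq_mul_inv]
  have hg : gaussianReal 0 ((a ^ 2).toNNReal / 2) =
      (gaussianReal 0 (1 / 2)).map fun x => a * x := by
    rw [gaussianReal_map_const_mul, mul_zero, hv]
  have hm : Measurable fun p : ℝ × ℝ => (p.1 : ℂ) + (p.2 : ℂ) * Complex.I := by fun_prop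
  rw [complexGaussian, hg, Measure.map_prod_map _ _ (by fun_prop) (by fun_prop),
    Measure.map_map hm (by fun_prop), complexGaussian, Measure.map_map (by fun_prop) hm]
  congr 1
  funext p
  simp only [Function.comp, Prod.map]
  push_cast
  ring

theorem codewordLaw_gaussian_eq_map (n : ℕ) {P' : ℝ} (hP' : 0 ≤ P') :
    codewordLaw n P' .gaussian =
      (stdGaussianVec (Fin n)).map fun x i => ((Real.sqrt P' : ℝ) : ℂ) * x i := by
  have h := complexGaussian_eq_map (Real.sqrt P')
  rw [Real.sq_sqrt hP'] at h
  have : IsProbabilityMeasure ((complexGaussian 1).map fun z => ((Real.sqrt P' : ℝ) : ℂ) * z) :=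
    Measure.isProbabilityMeasure_map (by fun_prop)
  rw [codewordLaw, h, stdGaussianVec, Measure.pi_map_pi fun _ => by fun_prop]

namespace Params

variable (s : Params)

/-- The probability that a codeword violates the power constraint, for Gaussian codewords. -/
def powerTail : ℝ :=
  match s.ens with
  | .gaussian => if s.P' = 0 then 0 else upperGamma s.n (s.n * s.P / s.P') / Real.Gamma s.n
  | .spherical => 0

theorem p0Ka_eq (Ka : ℕ) : s.p0Ka Ka = Ka * s.powerTail := by
  unfold p0Ka powerTail
  cases s.ens with
  | gaussian =>
    simp only
    split_ifs
    · rw [mul_zero]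
    · rw [mul_div_assoc]
  | spherical => simp

theorem powerTail_nonneg (hn : 1 ≤ s.n) : 0 ≤ s.powerTail := by
  have ha : (0 : ℝ) < s.n := by positivity
  unfold powerTail
  cases s.ens with
  | gaussian =>
    simp only
    split_ifs
    · exact le_rfl
    · exact (upperGamma_div_mem ha _).1
  | spherical => exact le_rfl

theorem codewordLaw_power_le (hn : 1 ≤ s.n) (hP'0 : 0 ≤ s.P') (hP' : s.P' ≤ s.P) :
    codewordLaw s.n s.P' s.ens {x | s.n * s.P < energy x} ≤ ENNReal.ofReal s.powerTail := by
  have ha : (0 : ℝ) < s.n := by positivity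
  have hzero : s.ens = .spherical ∨ s.P' = 0 →
      codewordLaw s.n s.P' s.ens {x | s.n * s.P < energy x} = 0 := by
    intro h
    refine measure_mono_null (fun x hx => ?_) (ae_energy_codewordLaw hn hP'0 h)
    intro he
    have hx : s.n * s.P < energy x := hx
    have := mul_le_mul_of_nonneg_left hP' ha.le
    have he : energy x = s.n * s.P' := he
    linarith
  by_cases h : s.ens = .spherical ∨ s.P' = 0
  · rw [hzero h]; exact zero_le
  · rw [not_or] at h
    have hens : s.ens = .gaussian := by
      cases hs : s.ens with
      | gaussian => rfl
      | spherical => exact absurd hs h.1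
    have hpos : 0 < s.P' := hP'0.lt_of_ne' h.2
    have hE : MeasurableSet {x : Fin s.n → ℂ | s.n * s.P < energy x} :=
      measurableSet_lt measurable_const continuous_energy.measurable
    rw [powerTail, hens]
    simp only
    rw [if_neg h.2, codewordLaw_gaussian_eq_map s.n hP'0, Measure.map_apply (by fun_prop) hE,
      ← gammaMeasure_one_Ioi ha, ← map_energy_stdGaussianVec hn,
      Measure.map_apply continuous_energy.measurable measurableSet_Ioi]
    refine measure_mono fun x hx => ?_
    have hx : s.n * s.P < energy (fun i => ((Real.sqrt s.P' : ℝ) : ℂ) * x i) := hx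
    rw [energy_real_smul, Real.sq_sqrt hP'0] at hx
    exact (div_lt_iff₀' hpos).2 hx

/-- The probability that one of the codewords of `W` violates the power constraint. -/
theorem fullLaw_power_le (hn : 1 ≤ s.n) (hP'0 : 0 ≤ s.P') (hP' : s.P' ≤ s.P)
    (W : Finset (Fin s.M)) :
    s.fullLaw {p | ∃ m ∈ W, s.n * s.P < energy (p.1 m)} ≤ ENNReal.ofReal (s.p0Ka W.card) := by
  have hE : MeasurableSet {x : Fin s.n → ℂ | s.n * s.P < energy x} :=
    measurableSet_lt measurable_const continuous_energy.measurable
  have hsub : {p : s.Codebook × ((Fin s.K → Fin s.L → ℂ) × (Fin s.n → Fin s.L → ℂ)) |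
      ∃ m ∈ W, s.n * s.P < energy (p.1 m)} =
      ⋃ m ∈ W, (fun p => p.1 m) ⁻¹' {x | s.n * s.P < energy x} := by
    ext p; simp
  rw [hsub, p0Ka_eq, ENNReal.ofReal_mul (Nat.cast_nonneg _), ENNReal.ofReal_natCast]
  refine (measure_biUnion_finset_le _ _).trans ((Finset.sum_le_card_nsmul _ _ _
    fun m _ => ?_).trans_eq (nsmul_eq_mul _ _))
  have h1 : MeasurePreserving (fun p : s.Codebook × ((Fin s.K → Fin s.L → ℂ) ×
      (Fin s.n → Fin s.L → ℂ)) => p.1 m) s.fullLaw (codewordLaw s.n s.P' s.ens) :=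
    (measurePreserving_eval (fun _ : Fin s.M => codewordLaw s.n s.P' s.ens) m).comp
      measurePreserving_fst
  rw [h1.measure_preimage hE.nullMeasurableSet]
  exact s.codewordLaw_power_le hn hP'0 hP'

end Params

/-! ### Collisions of messages -/

/-- Overwriting coordinate i of w by an arbitrary message is injective on the pairs with w i = w j,
since the lost value can be read off at j. Two given messages thus collide with probability at most
1/M. -/
theorem card_eq_mul_le {K M : ℕ} {i j : Fin K} (hij : i ≠ j) :
    (Finset.univ.filter fun w : Fin K → Fin M => w i = w j).card * M ≤ M ^ K := by
  classical
  have h : ((Finset.univ.filter fun w : Fin K → Fin M => w i = w j) ×ˢ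
      (Finset.univ : Finset (Fin M))).card ≤ (Finset.univ : Finset (Fin K → Fin M)).card := by
    refine Finset.card_le_card_of_injOn (fun p => Function.update p.1 i p.2)
      (fun _ _ => Finset.mem_coe.2 (Finset.mem_univ _)) ?_
    rintro ⟨w, a⟩ hw ⟨w', a'⟩ hw' h
    simp only [Finset.coe_product, Set.mem_prod, Finset.mem_coe, Finset.mem_filter,
      Finset.mem_univ, true_and, and_true] at hw hw'
    have hk : ∀ k, k ≠ i → w k = w' k := fun k hk => by
      have := congrFun h k
      simpa [hk] using this
    have ha : a = a' := by simpa using congrFun h i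
    refine Prod.ext (funext fun k => ?_) ha
    by_cases hki : k = i
    · rw [hki]
      change w i = w' i
      rw [hw, hw', hk j hij.symm]
    · exact hk k hki
  simpa [Finset.card_product] using h

-- A union bound over the pairs of active users.
open Classical in
theorem card_not_injOn_le {K M : ℕ} (A : Finset (Fin K)) :
    (Finset.univ.filter fun w : Fin K → Fin M => ¬ Set.InjOn w A).card * M ≤
      A.card.choose 2 * M ^ K := by
  have hsub : (Finset.univ.filter fun w : Fin K → Fin M => ¬ Set.InjOn w A) ⊆
      (A.powersetCard 2).biUnion fun p =>
        Finset.univ.filter fun w : Fin K → Fin M => ∃ i ∈ p, ∃ j ∈ p, i ≠ j ∧ w i = w j := by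
    intro w hw
    simp only [Finset.mem_filter, Finset.mem_univ, true_and, Set.InjOn, not_forall] at hw
    obtain ⟨i, hi, j, hj, hwij, hij⟩ := hw
    simp only [Finset.mem_biUnion, Finset.mem_powersetCard, Finset.mem_filter, Finset.mem_univ,
      true_and]
    refine ⟨{i, j}, ⟨?_, Finset.card_pair hij⟩, i, by simp, j, by simp, hij, hwij⟩
    intro k hk
    rcases Finset.mem_insert.1 hk with rfl | hk
    · exact hi
    · exact Finset.mem_singleton.1 hk ▸ hj
  calc _ ≤ ((A.powersetCard 2).biUnion fun p =>
        Finset.univ.filter fun w : Fin K → Fin M =>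
          ∃ i ∈ p, ∃ j ∈ p, i ≠ j ∧ w i = w j).card * M :=
        Nat.mul_le_mul_right _ (Finset.card_le_card hsub)
    _ ≤ (∑ p ∈ A.powersetCard 2, (Finset.univ.filter fun w : Fin K → Fin M =>
          ∃ i ∈ p, ∃ j ∈ p, i ≠ j ∧ w i = w j).card) * M :=
        Nat.mul_le_mul_right _ Finset.card_biUnion_le
    _ ≤ ∑ p ∈ A.powersetCard 2, M ^ K := by
        rw [Finset.sum_mul]
        refine Finset.sum_le_sum fun p hp => ?_
        obtain ⟨i, j, hij, rfl⟩ := Finset.card_eq_two.1 (Finset.mem_powersetCard.1 hp).2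
        refine le_trans (Nat.mul_le_mul_right _ (Finset.card_le_card fun w hw => ?_))
          (card_eq_mul_le (M := M) hij)
        simp only [Finset.mem_filter, Finset.mem_univ, true_and, Finset.mem_insert,
          Finset.mem_singleton] at hw ⊢
        obtain ⟨a, rfl | rfl, b, rfl | rfl, hne, h⟩ := hw
        · exact absurd rfl hne
        · exact h
        · exact h.symm
        · exact absurd rfl hne
    _ = _ := by rw [Finset.sum_const, Finset.card_powersetCard, smul_eq_mul]

/-! ### The two-stage code -/

namespace Params

variable (s : Params)

theorem continuous_energyMetric (k : ℕ) :
    Continuous fun Y : Fin s.n → Fin s.L → ℂ => s.energyMetric Y k := by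
  unfold energyMetric
  fun_prop

/-- `D` is a possible output of the two-stage decoder. -/
def IsOutput (π : ℕ → ℝ) (C : s.Codebook) (Y : Fin s.n → Fin s.L → ℂ) (D : Finset (Fin s.M)) :
    Prop :=
  ∃ K' ∈ Finset.Icc s.Kl s.Ku, s.IsEstimate Y K' ∧ s.IsOptimal π K' C Y D

theorem measurableSet_isOutput (π : ℕ → ℝ) (D : Finset (Fin s.M)) :
    MeasurableSet {p : s.Codebook × (Fin s.n → Fin s.L → ℂ) | s.IsOutput π p.1 p.2 D} := by
  have he : ∀ k, Measurable fun p : s.Codebook × (Fin s.n → Fin s.L → ℂ) =>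
      s.energyMetric p.2 k := fun k => ((s.continuous_energyMetric k).comp continuous_snd).measurable
  have hm := s.measurable_mapMetric π
  have h1 : ∀ K', MeasurableSet {p : s.Codebook × (Fin s.n → Fin s.L → ℂ) |
      s.IsEstimate p.2 K'} := fun K' => by
    unfold IsEstimate
    simp only [Set.ofPred_forall]
    exact MeasurableSet.iInter fun k => MeasurableSet.iInter fun _ =>
      measurableSet_le (he K') (he k)
  have h2 : ∀ K', MeasurableSet {p : s.Codebook × (Fin s.n → Fin s.L → ℂ) |
      s.IsOptimal π K' p.1 p.2 D} := fun K' => by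
    unfold IsOptimal
    simp only [Set.ofPred_and, Set.ofPred_forall]
    refine (MeasurableSet.const _).inter ?_
    exact MeasurableSet.iInter fun S => MeasurableSet.iInter fun _ => measurableSet_le (hm D) (hm S)
  have : {p : s.Codebook × (Fin s.n → Fin s.L → ℂ) | s.IsOutput π p.1 p.2 D} =
      ⋃ K' ∈ Finset.Icc s.Kl s.Ku, {p | s.IsEstimate p.2 K'} ∩ {p | s.IsOptimal π K' p.1 p.2 D} := by
    ext p
    simp only [Set.mem_iUnion, Set.mem_inter_iff, Set.mem_ofPred_eq, IsOutput, exists_prop]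
  rw [this]
  exact Finset.measurableSet_biUnion _ fun K' _ => (h1 K').inter (h2 K')

theorem lo_le_hi (hlu : s.Kl ≤ s.Ku) {K' : ℕ} (hK' : K' ∈ Finset.Icc s.Kl s.Ku) :
    s.lo K' ≤ s.hi K' := by
  rw [Finset.mem_Icc] at hK'
  unfold lo hi
  omega

theorem exists_isOutput (hlu : s.Kl ≤ s.Ku) (huM : s.Ku ≤ s.M) (π : ℕ → ℝ) (C : s.Codebook)
    (Y : Fin s.n → Fin s.L → ℂ) : ∃ D, s.IsOutput π C Y D := by
  obtain ⟨K', hK', hmin⟩ := Finset.exists_min_image (Finset.Icc s.Kl s.Ku) (s.energyMetric Y)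
    ⟨s.Kl, Finset.mem_Icc.2 ⟨le_rfl, hlu⟩⟩
  have hlh := s.lo_le_hi hlu hK'
  have hne : (Finset.univ.filter fun S : Finset (Fin s.M) =>
      S.card ∈ Finset.Icc (s.lo K') (s.hi K')).Nonempty := by
    obtain ⟨S, -, hS⟩ := Finset.exists_subset_card_eq (s := (Finset.univ : Finset (Fin s.M)))
      (n := s.hi K') (by
        rw [Finset.card_univ, Fintype.card_fin]
        exact (min_le_left _ _).trans huM)
    exact ⟨S, by simp [hS, hlh]⟩
  obtain ⟨D, hD, hDmin⟩ := Finset.exists_min_image _ (s.mapMetric π C Y) hne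
  refine ⟨D, K', hK', hmin, (Finset.mem_filter.1 hD).2, fun S hS => hDmin S ?_⟩
  exact Finset.mem_filter.2 ⟨Finset.mem_univ _, hS⟩

open Classical in
/-- The set of the possible outputs of the decoder. -/
def outputs (π : ℕ → ℝ) (C : s.Codebook) (Y : Fin s.n → Fin s.L → ℂ) :
    Finset (Finset (Fin s.M)) :=
  Finset.univ.filter fun D => s.IsOutput π C Y D

/-- The decoder of the two-stage scheme. -/
def decode (π : ℕ → ℝ) (C : s.Codebook) (Y : Fin s.n → Fin s.L → ℂ) : Finset (Fin s.M) :=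
  Classical.epsilon fun D => D ∈ s.outputs π C Y

open Classical in
theorem isOutput_decode (hlu : s.Kl ≤ s.Ku) (huM : s.Ku ≤ s.M) (π : ℕ → ℝ) (C : s.Codebook)
    (Y : Fin s.n → Fin s.L → ℂ) : s.IsOutput π C Y (s.decode π C Y) := by
  obtain ⟨D, hD⟩ := s.exists_isOutput hlu huM π C Y
  have : s.decode π C Y ∈ s.outputs π C Y :=
    Classical.epsilon_spec (p := fun D => D ∈ s.outputs π C Y)
      ⟨D, Finset.mem_filter.2 ⟨Finset.mem_univ _, hD⟩⟩
  exact (Finset.mem_filter.1 this).2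

/-- Ties are broken by a choice that depends on codebook and signal only through the finite set
`outputs`. That set has finitely many values, each attained on a measurable set. -/
theorem measurableSet_decode (π : ℕ → ℝ) (S : Finset (Fin s.M)) :
    MeasurableSet {p : s.Codebook × (Fin s.n → Fin s.L → ℂ) | s.decode π p.1 p.2 = S} := by
  have h1 : ∀ o : Finset (Finset (Fin s.M)),
      MeasurableSet {p : s.Codebook × (Fin s.n → Fin s.L → ℂ) | s.outputs π p.1 p.2 = o} := by
    intro o
    have : {p : s.Codebook × (Fin s.n → Fin s.L → ℂ) | s.outputs π p.1 p.2 = o} =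
        ⋂ D, {p | s.IsOutput π p.1 p.2 D ↔ D ∈ o} := by
      ext p
      simp [outputs, Finset.ext_iff]
    rw [this]
    refine MeasurableSet.iInter fun D => ?_
    by_cases hD : D ∈ o
    · simpa only [hD, iff_true] using s.measurableSet_isOutput π D
    · simpa only [hD, iff_false, Set.compl_ofPred] using (s.measurableSet_isOutput π D).compl
  have : {p : s.Codebook × (Fin s.n → Fin s.L → ℂ) | s.decode π p.1 p.2 = S} =
      ⋃ o ∈ {o : Finset (Finset (Fin s.M)) | (Classical.epsilon fun D => D ∈ o) = S},
        {p | s.outputs π p.1 p.2 = o} := by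
    ext p
    simp [decode]
  rw [this]
  exact MeasurableSet.biUnion (Set.to_countable _) fun o _ => h1 o

/-- The encoder of the two-stage scheme. -/
def encode (C : s.Codebook) : s.Codebook :=
  fun m => if energy (C m) ≤ s.n * s.P then C m else 0

theorem measurable_encode : Measurable s.encode := by
  refine measurable_pi_lambda _ fun m => ?_
  have hm : Measurable fun C : s.Codebook => C m := measurable_pi_apply m
  exact Measurable.ite (measurableSet_le (continuous_energy.measurable.comp hm) measurable_const)
    hm measurable_const

theorem energy_encode_le (hP : 0 ≤ s.P) (C : s.Codebook) (m : Fin s.M) :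
    energy (s.encode C m) ≤ s.n * s.P := by
  unfold encode
  split_ifs with h
  · exact h
  · have : energy (0 : Fin s.n → ℂ) = 0 := by simp [energy]
    rw [this]
    positivity

/-- The two-stage code. -/
def twoStageCode (π : ℕ → ℝ) (hP : 0 ≤ s.P) (hlu : s.Kl ≤ s.Ku) (huK : s.Ku ≤ s.K)
    (huM : s.Ku ≤ s.M) : Code s.n s.L s.M s.K s.P where
  𝒰 := s.Codebook
  law := s.codebookLaw
  enc := s.encode
  enc_measurable := s.measurable_encode
  power := s.energy_encode_le hP
  dec := s.decode π
  dec_measurable := s.measurableSet_decode π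
  dec_card C Y := by
    obtain ⟨K', -, -, h, -⟩ := s.isOutput_decode hlu huM π C Y
    exact ((Finset.mem_Icc.1 h).2.trans (min_le_left _ _)).trans huK

theorem isTwoStage_twoStageCode (π : ℕ → ℝ) (hP : 0 ≤ s.P) (hlu : s.Kl ≤ s.Ku)
    (huK : s.Ku ≤ s.K) (huM : s.Ku ≤ s.M) :
    s.IsTwoStage π (s.twoStageCode π hP hlu huK huM) :=
  ⟨id, measurable_id, Measure.map_id, fun _ _ => rfl, fun C Y =>
    s.isOutput_decode hlu huM π C Y⟩

end Params

/-! ### Averaging -/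

/-- Neither the events nor f need be measurable: the events are replaced by measurable hulls of the
same measure, and a nonnegative f needs only an integrable majorant. -/
theorem integral_le_of_forall {X ι : Type*} [MeasurableSpace X] {μ : Measure X}
    [IsProbabilityMeasure μ] {f : X → ℝ} (hf : ∀ x, 0 ≤ f x) {E₀ : Set X} {p₀ : ℝ} (hp₀ : 0 ≤ p₀)
    (h₀ : μ E₀ ≤ ENNReal.ofReal p₀) {I : Finset ι} {c p : ι → ℝ} (hc : ∀ i ∈ I, 0 ≤ c i)
    (hp : ∀ i ∈ I, 0 ≤ p i) {E : ι → Set X} (hE : ∀ i ∈ I, μ (E i) ≤ ENNReal.ofReal (p i))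
    (h : ∀ x, (x ∈ E₀ ∧ f x ≤ 1) ∨ f x = 0 ∨ ∃ i ∈ I, x ∈ E i ∧ f x ≤ c i) :
    ∫ x, f x ∂μ ≤ p₀ + ∑ i ∈ I, c i * p i := by
  set F : ι → Set X := fun i => toMeasurable μ (E i) with hF
  have hFm : ∀ i, MeasurableSet (F i) := fun i => measurableSet_toMeasurable _ _
  have hint : ∀ (S : Set X), MeasurableSet S → Integrable (S.indicator fun _ => (1 : ℝ)) μ :=
    fun S hS => (integrable_const 1).indicator hS
  have hint' : Integrable (fun x => ∑ i ∈ I, c i * (F i).indicator (fun _ => (1 : ℝ)) x) μ :=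
    integrable_finsetSum _ fun i _ => (hint _ (hFm i)).const_mul _
  have hnn : ∀ (S : Set X) x, 0 ≤ S.indicator (fun _ => (1 : ℝ)) x := fun S x =>
    Set.indicator_nonneg (fun _ _ => zero_le_one) x
  have hval : ∀ (S : Set X) (a : ℝ), 0 ≤ a → μ S ≤ ENNReal.ofReal a →
      ∫ x, (toMeasurable μ S).indicator (fun _ => (1 : ℝ)) x ∂μ ≤ a := by
    intro S a ha hS
    rw [integral_indicator_const _ (measurableSet_toMeasurable _ _), smul_eq_mul, mul_one,
      measureReal_def, measure_toMeasurable]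
    exact ENNReal.toReal_le_of_le_ofReal ha hS
  calc ∫ x, f x ∂μ ≤ ∫ x, ((toMeasurable μ E₀).indicator (fun _ => (1 : ℝ)) x
        + ∑ i ∈ I, c i * (F i).indicator (fun _ => (1 : ℝ)) x) ∂μ := by
        refine integral_mono_of_nonneg (by filter_upwards with x using hf x)
          ((hint _ (measurableSet_toMeasurable _ _)).add hint') ?_
        filter_upwards with x
        have hsum : 0 ≤ ∑ i ∈ I, c i * (F i).indicator (fun _ => (1 : ℝ)) x :=
          Finset.sum_nonneg fun i hi => mul_nonneg (hc i hi) (hnn _ _)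
        rcases h x with ⟨hx, h1⟩ | h0 | ⟨i, hi, hx, h1⟩
        · rw [Set.indicator_of_mem (subset_toMeasurable μ E₀ hx)]
          linarith
        · rw [h0]
          exact add_nonneg (hnn _ _) hsum
        · have := Finset.single_le_sum (f := fun i => c i * (F i).indicator (fun _ => (1 : ℝ)) x)
            (fun i hi => mul_nonneg (hc i hi) (hnn _ _)) hi
          simp only [Set.indicator_of_mem (subset_toMeasurable μ (E i) hx), mul_one, hF] at this
          have := hnn (toMeasurable μ E₀) x
          linarith
    _ = ∫ x, (toMeasurable μ E₀).indicator (fun _ => (1 : ℝ)) x ∂μ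
        + ∑ i ∈ I, c i * ∫ x, (F i).indicator (fun _ => (1 : ℝ)) x ∂μ := by
        rw [integral_add (hint _ (measurableSet_toMeasurable _ _)) hint',
          integral_finsetSum _ fun i _ => (hint _ (hFm i)).const_mul _]
        simp_rw [integral_const_mul]
    _ ≤ _ := add_le_add (hval _ _ hp₀ h₀) (Finset.sum_le_sum fun i hi =>
        mul_le_mul_of_nonneg_left (hval _ _ (hp i hi) (hE i hi)) (hc i hi))

theorem numActive_nonneg {K : ℕ} (Q : PMF (Finset (Fin K))) (k : ℕ) : 0 ≤ numActive Q k :=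
  Finset.sum_nonneg fun A _ => by split_ifs <;> simp

theorem numActive_card_ne_zero {K : ℕ} {Q : PMF (Finset (Fin K))} {A : Finset (Fin K)}
    (h : Q A ≠ 0) : numActive Q A.card ≠ 0 := by
  have h1 : 0 < (Q A).toReal := ENNReal.toReal_pos h (Q.apply_ne_top A)
  have h2 := Finset.single_le_sum
    (f := fun B : Finset (Fin K) => if B.card = A.card then (Q B).toReal else 0)
    (fun B _ => by split_ifs <;> simp) (Finset.mem_univ A)
  simp only [if_true] at h2
  exact (h1.trans_le h2).ne'

theorem sum_mul_card {K : ℕ} (Q : PMF (Finset (Fin K))) (G : ℕ → ℝ) :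
    ∑ A, (Q A).toReal * G A.card = ∑ k ∈ Finset.Icc 0 K, numActive Q k * G k := by
  simp_rw [numActive, Finset.sum_mul]
  rw [Finset.sum_comm]
  refine Finset.sum_congr rfl fun A _ => ?_
  have hA : A.card ∈ Finset.Icc 0 K :=
    Finset.mem_Icc.2 ⟨Nat.zero_le _, (Finset.card_le_univ A).trans_eq (Fintype.card_fin K)⟩
  simp_rw [ite_mul, zero_mul]
  rw [Finset.sum_ite_eq, if_pos hA]

namespace Params

variable (s : Params)

theorem p0Ka_nonneg (hn : 1 ≤ s.n) (Ka : ℕ) : 0 ≤ s.p0Ka Ka := by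
  rw [p0Ka_eq]
  exact mul_nonneg (Nat.cast_nonneg _) (s.powerTail_nonneg hn)

theorem received_encode {C : s.Codebook} {A : Finset (Fin s.K)} {w : Fin s.K → Fin s.M}
    (h : ¬ ∃ m ∈ A.image w, s.n * s.P < energy (C m)) (f : Fin s.K → Fin s.L → ℂ)
    (z : Fin s.n → Fin s.L → ℂ) : received (s.encode C) A w f z = received C A w f z := by
  push Not at h
  funext i l
  unfold received
  congr 1
  refine Finset.sum_congr rfl fun k hk => ?_
  rw [encode, if_pos (h _ (Finset.mem_image_of_mem w hk))]

variable {Q : PMF (Finset (Fin s.K))} {φ : Finset (Fin s.K) → (Fin s.K → Fin s.M) →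
  Finset (Fin s.M) → ℝ} {β : ℕ → ℝ}

/-- Averaging over the active users and the messages. -/
theorem expect_le (hn : 1 ≤ s.n) (hM : 1 ≤ s.M) (hlu : s.Kl ≤ s.Ku) (huK : s.Ku ≤ s.K)
    (hP : 0 ≤ s.P) (huM : s.Ku ≤ s.M) (hφ : ∀ A w D, 0 ≤ φ A w D ∧ φ A w D ≤ 1)
    (hβ : ∀ k, 0 ≤ β k)
    (h : ∀ A w, Q A ≠ 0 → A.card ∈ Finset.Icc s.Kl s.Ku → Set.InjOn w A →
      ∫ q, φ A w (s.decode (numActive Q) q.1 (received (s.encode q.1) A w q.2.1 q.2.2)) ∂s.fullLaw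
        ≤ s.p0Ka A.card + β A.card) :
    (s.twoStageCode (numActive Q) hP hlu huK huM).expect Q φ ≤
      s.p0 (numActive Q) + ∑ k ∈ Finset.Icc s.Kl s.Ku, numActive Q k * β k := by
  classical
  have hM0 : (0 : ℝ) < s.M := by exact_mod_cast hM
  -- The cost for k active users: power violation, then the bound β or the trivial bound 1 outside
  -- `[Kl : Ku]`, then collision. Its average over k is the right-hand side.
  set G : ℕ → ℝ := fun k => s.p0Ka k + (if k ∈ Finset.Icc s.Kl s.Ku then β k else 1)
    + (k.choose 2 : ℝ) / s.M with hG
  have hite : ∀ k, 0 ≤ if k ∈ Finset.Icc s.Kl s.Ku then β k else 1 := fun k => by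
    split_ifs
    · exact hβ k
    · exact zero_le_one
  have hI : ∀ A w, ∫ q, φ A w (s.decode (numActive Q) q.1
      (received (s.encode q.1) A w q.2.1 q.2.2)) ∂s.fullLaw ≤ 1 := fun A w => by
    calc _ ≤ ∫ _, (1 : ℝ) ∂s.fullLaw :=
          integral_mono_of_nonneg (by filter_upwards with q using (hφ _ _ _).1)
            (integrable_const _) (by filter_upwards with q using (hφ _ _ _).2)
      _ = 1 := by simp
  have hw : ∀ A w, Q A ≠ 0 → ∫ q, φ A w (s.decode (numActive Q) q.1
      (received (s.encode q.1) A w q.2.1 q.2.2)) ∂s.fullLaw ≤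
      s.p0Ka A.card + (if A.card ∈ Finset.Icc s.Kl s.Ku then β A.card else 1)
        + if ¬ Set.InjOn w A then 1 else 0 := by
    intro A w hQ
    have h0 := s.p0Ka_nonneg hn A.card
    have h1 := hite A.card
    by_cases hinj : Set.InjOn w A
    · rw [if_neg (not_not.2 hinj), add_zero]
      by_cases hA : A.card ∈ Finset.Icc s.Kl s.Ku
      · rw [if_pos hA]
        exact h A w hQ hA hinj
      · rw [if_neg hA]
        linarith [hI A w]
    · rw [if_pos hinj]
      linarith [hI A w]
  have hA : ∀ A, (Q A).toReal * ∑ w : Fin s.K → Fin s.M, (1 / (s.M : ℝ) ^ s.K) *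
      ∫ q, φ A w (s.decode (numActive Q) q.1 (received (s.encode q.1) A w q.2.1 q.2.2))
        ∂s.fullLaw ≤ (Q A).toReal * G A.card := by
    intro A
    by_cases hQ : Q A = 0
    · simp [hQ]
    refine mul_le_mul_of_nonneg_left ?_ ENNReal.toReal_nonneg
    calc _ ≤ ∑ w : Fin s.K → Fin s.M, (1 / (s.M : ℝ) ^ s.K) * (s.p0Ka A.card
          + (if A.card ∈ Finset.Icc s.Kl s.Ku then β A.card else 1)
          + if ¬ Set.InjOn w A then 1 else 0) :=
          Finset.sum_le_sum fun w _ => mul_le_mul_of_nonneg_left (hw A w hQ) (by positivity)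
      _ = (s.p0Ka A.card + if A.card ∈ Finset.Icc s.Kl s.Ku then β A.card else 1)
          + (1 / (s.M : ℝ) ^ s.K) *
            ((Finset.univ.filter fun w : Fin s.K → Fin s.M => ¬ Set.InjOn w A).card : ℝ) := by
        rw [← Finset.mul_sum, Finset.sum_add_distrib, Finset.sum_const, Finset.card_univ,
          Fintype.card_fun, Fintype.card_fin, Fintype.card_fin, nsmul_eq_mul, mul_add,
          Finset.sum_boole]
        push_cast
        field_simp
      _ ≤ G A.card := by
        refine add_le_add le_rfl ?_
        rw [one_div, inv_mul_le_iff₀ (by positivity), ← mul_div_assoc, le_div_iff₀ hM0]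
        have := card_not_injOn_le (M := s.M) A
        rw [mul_comm (A.card.choose 2)] at this
        exact_mod_cast this
  have hsub : Finset.Icc s.Kl s.Ku ⊆ Finset.Icc 0 s.K :=
    Finset.Icc_subset_Icc (Nat.zero_le _) huK
  have hsplit : ∑ k ∈ Finset.Icc 0 s.K, numActive Q k *
      (if k ∈ Finset.Icc s.Kl s.Ku then β k else 1) =
      ∑ k ∈ (Finset.Icc 0 s.K).filter (fun k => k ∉ Finset.Icc s.Kl s.Ku), numActive Q k +
        ∑ k ∈ Finset.Icc s.Kl s.Ku, numActive Q k * β k := by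
    rw [← Finset.sum_filter_add_sum_filter_not (Finset.Icc 0 s.K) (· ∈ Finset.Icc s.Kl s.Ku),
      add_comm]
    congr 1
    · refine Finset.sum_congr rfl fun k hk => ?_
      rw [if_neg (Finset.mem_filter.1 hk).2, mul_one]
    · rw [Finset.filter_mem_eq_inter, Finset.inter_eq_right.2 hsub]
      exact Finset.sum_congr rfl fun k hk => by rw [if_pos hk]
  calc (s.twoStageCode (numActive Q) hP hlu huK huM).expect Q φ
      ≤ ∑ A, (Q A).toReal * G A.card := Finset.sum_le_sum fun A _ => hA A
    _ = _ := by
      rw [sum_mul_card]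
      simp only [hG, mul_add, Finset.sum_add_distrib]
      rw [hsplit, p0]
      ring

/-! ### Error fractions for given users and messages -/

variable {A : Finset (Fin s.K)} {w : Fin s.K → Fin s.M}

theorem min_pErr_pEst_nonneg (hn : 1 ≤ s.n) (hL : 1 ≤ s.L) {π : ℕ → ℝ} (hπ : ∀ k, 0 ≤ π k)
    (Ka K' t t' : ℕ) : 0 ≤ min 1 (min (s.pErr π Ka K' t t') (s.pEst Ka K')) :=
  le_min zero_le_one (le_min (s.pErr_nonneg hn hL hπ ..) (s.pEst_nonneg ..))

theorem min_sum_pErr_pEst_nonneg (hn : 1 ≤ s.n) (hL : 1 ≤ s.L) {π : ℕ → ℝ} (hπ : ∀ k, 0 ≤ π k)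
    (Ka K' t : ℕ) :
    0 ≤ min 1 (min (∑ t' ∈ s.TMD Ka K' t, s.pErr π Ka K' t t') (s.pEst Ka K')) :=
  le_min zero_le_one (le_min (Finset.sum_nonneg fun _ _ => s.pErr_nonneg hn hL hπ ..)
    (s.pEst_nonneg ..))

/-- The numbers of missed and of extra messages of an admissible list belong to the index sets. -/
theorem index_mem {Ka K' : ℕ} {W D : Finset (Fin s.M)} (hW : W.card = Ka)
    (hlh : s.lo K' ≤ s.hi K') (hD : D.card ∈ Finset.Icc (s.lo K') (s.hi K')) :
    ∃ t ∈ s.T Ka K', ∃ t' ∈ s.TMD Ka K' t, (W \ D).card = t + s.missed Ka K' ∧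
      (D \ W).card = t' + s.extra Ka K' ∧ s.listSize Ka K' t t' = D.card ∧
      (1 ≤ D.card → t' ∈ s.TFA Ka K' t) := by
  have h1 := Finset.card_sdiff_add_card_inter W D
  have h2 := Finset.card_sdiff_add_card_inter D W
  have h3 := Finset.card_sdiff_add_card W D
  rw [Finset.inter_comm] at h2
  have h4 := s.card_le_M (W ∪ D)
  rw [Finset.mem_Icc] at hD
  simp only [T, TMD, TFA, Tupper, listSize, missed, extra, Finset.mem_Icc]
  -- No subtraction truncates: |W \ D| ≥ Ka - |D| ≥ Ka - hi and |D \ W| ≥ |D| - Ka ≥ lo - Ka. The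
  -- remaining limits come from |W ∪ D| ≤ M and the bounds on |D|, with |D| ≥ 1 accounting for the
  -- maximum with 1 in `TFA`.
  refine ⟨(W \ D).card - (Ka - s.hi K'), ?_, (D \ W).card - (s.lo K' - Ka), ?_, ?_, ?_, ?_, ?_⟩
  all_goals omega

theorem sum_ite_not_mem (hw : Set.InjOn w A) (D : Finset (Fin s.M)) :
    (∑ k ∈ A, if w k ∉ D then (1 : ℝ) else 0) = ((A.image w \ D).card : ℝ) := by
  rw [← Finset.sum_image (s := A) (g := w) (f := fun m => if m ∉ D then (1 : ℝ) else 0) hw,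
    Finset.sum_boole, Finset.sdiff_eq_filter]

/-- The lists with given numbers of missed and of extra messages, as an event. -/
def errEvent (π : ℕ → ℝ) (A : Finset (Fin s.K)) (w : Fin s.K → Fin s.M) (K' t t' : ℕ) :
    Set (s.Codebook × ((Fin s.K → Fin s.L → ℂ) × (Fin s.n → Fin s.L → ℂ))) :=
  {p | ∃ D, s.IsOptimal π K' p.1 (received p.1 A w p.2.1 p.2.2) D ∧
    (A.image w \ D).card = t + s.missed A.card K' ∧ (D \ A.image w).card = t' + s.extra A.card K'}

/-- The event that the energy detector may output `K'`. -/
def estEvent (A : Finset (Fin s.K)) (w : Fin s.K → Fin s.M) (K' : ℕ) :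
    Set (s.Codebook × ((Fin s.K → Fin s.L → ℂ) × (Fin s.n → Fin s.L → ℂ))) :=
  {p | s.IsEstimate (received p.1 A w p.2.1 p.2.2) K'}

/-- Without a power violation the transmitted signal is that of the raw codebook, so the decoded
list realizes one of the events already bounded. Those events ask only for some optimal list, hence
do not depend on how ties are broken. -/
theorem decode_cases (hlu : s.Kl ≤ s.Ku) (huM : s.Ku ≤ s.M) (π : ℕ → ℝ) (hw : Set.InjOn w A)
    (q : s.Codebook × ((Fin s.K → Fin s.L → ℂ) × (Fin s.n → Fin s.L → ℂ))) :
    (∃ m ∈ A.image w, s.n * s.P < energy (q.1 m)) ∨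
    ∃ K' ∈ Finset.Icc s.Kl s.Ku, ∃ t ∈ s.T A.card K', ∃ t' ∈ s.TMD A.card K' t,
      q ∈ s.estEvent A w K' ∧ q ∈ s.errEvent π A w K' t t' ∧
      ∀ D, D = s.decode π q.1 (received (s.encode q.1) A w q.2.1 q.2.2) →
        (A.image w \ D).card = t + s.missed A.card K' ∧
        (D \ A.image w).card = t' + s.extra A.card K' ∧ s.listSize A.card K' t t' = D.card ∧
        (1 ≤ D.card → t' ∈ s.TFA A.card K' t) := by
  by_cases h : ∃ m ∈ A.image w, s.n * s.P < energy (q.1 m)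
  · exact Or.inl h
  right
  rw [s.received_encode h]
  obtain ⟨K', hK', hest, hopt⟩ :=
    s.isOutput_decode hlu huM π q.1 (received q.1 A w q.2.1 q.2.2)
  obtain ⟨t, ht, t', ht', h1, h2, h3, h4⟩ := s.index_mem (W := A.image w)
    (Finset.card_image_of_injOn hw) (s.lo_le_hi hlu hK') hopt.1
  exact ⟨K', hK', t, ht, t', ht', hest, ⟨_, hopt, h1, h2⟩, by rintro D rfl; exact ⟨h1, h2, h3, h4⟩⟩

theorem listPrior_numActive_ne_zero (hQ : Q A ≠ 0) (hA : A.card ≤ s.M) :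
    s.listPrior (numActive Q) A.card ≠ 0 := fun h =>
  numActive_card_ne_zero hQ ((s.listPrior_eq_zero_iff hA).1 h)

theorem fullLaw_power_event_le (hn : 1 ≤ s.n) (hP'0 : 0 ≤ s.P') (hP' : s.P' ≤ s.P)
    (hw : Set.InjOn w A) :
    s.fullLaw {q | ∃ m ∈ A.image w, s.n * s.P < energy (q.1 m)} ≤
      ENNReal.ofReal (s.p0Ka A.card) := by
  have := s.fullLaw_power_le hn hP'0 hP' (A.image w)
  rwa [Finset.card_image_of_injOn hw] at this

/-- The misdetection fraction. -/
def fracMD (A : Finset (Fin s.K)) (w : Fin s.K → Fin s.M) (D : Finset (Fin s.M)) : ℝ :=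
  if 1 ≤ A.card then (1 / (A.card : ℝ)) * ∑ k ∈ A, (if w k ∉ D then 1 else 0) else 0

/-- The false-alarm fraction. -/
def fracFA (A : Finset (Fin s.K)) (w : Fin s.K → Fin s.M) (D : Finset (Fin s.M)) : ℝ :=
  if 1 ≤ D.card then (1 / (D.card : ℝ)) * ∑ m ∈ D, (if m ∉ A.image w then 1 else 0) else 0

theorem average_ite_mem {α : Type*} (S : Finset α) (p : α → Prop) [DecidablePred p] :
    0 ≤ (if 1 ≤ S.card then (1 / (S.card : ℝ)) * ∑ k ∈ S, (if p k then 1 else 0) else 0) ∧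
    (if 1 ≤ S.card then (1 / (S.card : ℝ)) * ∑ k ∈ S, (if p k then 1 else 0) else 0) ≤ 1 := by
  split_ifs with h
  · rw [Finset.sum_boole, one_div, inv_mul_eq_div]
    refine ⟨by positivity, div_le_one_of_le₀ ?_ (Nat.cast_nonneg _)⟩
    exact_mod_cast Finset.card_filter_le _ _
  · simp

theorem fracMD_mem (A : Finset (Fin s.K)) (w : Fin s.K → Fin s.M) (D : Finset (Fin s.M)) :
    0 ≤ s.fracMD A w D ∧ s.fracMD A w D ≤ 1 := average_ite_mem A fun k => w k ∉ D

theorem fracFA_mem (A : Finset (Fin s.K)) (w : Fin s.K → Fin s.M) (D : Finset (Fin s.M)) :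
    0 ≤ s.fracFA A w D ∧ s.fracFA A w D ≤ 1 := average_ite_mem D fun m => m ∉ A.image w

theorem fracMD_le (hw : Set.InjOn w A) {D : Finset (Fin s.M)} {a : ℕ}
    (h : (A.image w \ D).card = a) : s.fracMD A w D ≤ (a : ℝ) / A.card := by
  unfold fracMD
  split_ifs
  · rw [s.sum_ite_not_mem hw, h, one_div, inv_mul_eq_div]
  · positivity

theorem fracFA_eq {D : Finset (Fin s.M)} {a : ℕ} (h : (D \ A.image w).card = a)
    (hD : 1 ≤ D.card) : s.fracFA A w D = (a : ℝ) / D.card := by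
  rw [fracFA, if_pos hD, Finset.sum_boole, ← Finset.sdiff_eq_filter, h, one_div, inv_mul_eq_div]

/-- The misdetection fraction depends on `K'` and t only, so the events for different t' are merged
before the minimum with 1 and `pEst` is taken. -/
theorem integral_fracMD_le (hn : 1 ≤ s.n) (hL : 1 ≤ s.L) (hP'0 : 0 ≤ s.P') (hP' : s.P' ≤ s.P)
    (hlu : s.Kl ≤ s.Ku) (huM : s.Ku ≤ s.M) (hQ : Q A ≠ 0)
    (hA : A.card ∈ Finset.Icc s.Kl s.Ku) (hw : Set.InjOn w A) :
    ∫ q, s.fracMD A w (s.decode (numActive Q) q.1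
        (received (s.encode q.1) A w q.2.1 q.2.2)) ∂s.fullLaw ≤
      s.p0Ka A.card + ∑ K' ∈ Finset.Icc s.Kl s.Ku, ∑ t ∈ s.T A.card K',
        ((t + s.missed A.card K' : ℕ) : ℝ) / A.card *
          min 1 (min (∑ t' ∈ s.TMD A.card K' t, s.pErr (numActive Q) A.card K' t t')
            (s.pEst A.card K')) := by
  have hπ := numActive_nonneg Q
  have hWK := Finset.card_image_of_injOn hw
  have hb := s.listPrior_numActive_ne_zero hQ ((Finset.mem_Icc.1 hA).2.trans huM)
  rw [Finset.sum_sigma']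
  refine integral_le_of_forall (fun q => (s.fracMD_mem ..).1) (s.p0Ka_nonneg hn A.card)
    (s.fullLaw_power_event_le hn hP'0 hP' hw)
    (E := fun i => s.estEvent A w i.1 ∩
      ⋃ t' ∈ s.TMD A.card i.1 i.2, s.errEvent (numActive Q) A w i.1 i.2 t')
    (fun i _ => by positivity) (fun i _ => s.min_sum_pErr_pEst_nonneg hn hL hπ ..)
    (fun i hi => ?_) fun q => ?_
  · have hi := (Finset.mem_sigma.1 hi).1
    rw [ENNReal.ofReal_min, ENNReal.ofReal_min, ENNReal.ofReal_one,
      ENNReal.ofReal_sum_of_nonneg fun t' _ => s.pErr_nonneg hn hL hπ ..]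
    refine le_min prob_le_one (le_min ?_ ?_)
    · refine (measure_mono Set.inter_subset_right).trans ((measure_biUnion_finset_le _ _).trans
        (Finset.sum_le_sum fun t' _ => ?_))
      exact s.fullLaw_err_le hn hL hπ hw i.1 i.2 t' hWK (s.lo_le_hi hlu hi) hb
    · exact (measure_mono Set.inter_subset_left).trans
        (s.fullLaw_isEstimate_le hn hL hP'0 hw hWK hA hi)
  · rcases s.decode_cases hlu huM (numActive Q) hw q with h |
      ⟨K', hK', t, ht, t', ht', hest, herr, hD⟩
    · exact Or.inl ⟨h, (s.fracMD_mem ..).2⟩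
    · exact Or.inr (Or.inr ⟨⟨K', t⟩, Finset.mem_sigma.2 ⟨hK', ht⟩,
        ⟨hest, Set.mem_biUnion ht' herr⟩, s.fracMD_le hw (hD _ rfl).1⟩)

/-- The false-alarm fraction involves t' and the list size, so each triple (K', t, t') is weighted
separately. An empty list has no false alarm, which is why t' may be restricted to `TFA`. -/
theorem integral_fracFA_le (hn : 1 ≤ s.n) (hL : 1 ≤ s.L) (hP'0 : 0 ≤ s.P') (hP' : s.P' ≤ s.P)
    (hlu : s.Kl ≤ s.Ku) (huM : s.Ku ≤ s.M) (hQ : Q A ≠ 0)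
    (hA : A.card ∈ Finset.Icc s.Kl s.Ku) (hw : Set.InjOn w A) :
    ∫ q, s.fracFA A w (s.decode (numActive Q) q.1
        (received (s.encode q.1) A w q.2.1 q.2.2)) ∂s.fullLaw ≤
      s.p0Ka A.card + ∑ K' ∈ Finset.Icc s.Kl s.Ku, ∑ t ∈ s.T A.card K',
        ∑ t' ∈ s.TFA A.card K' t,
          ((t' + s.extra A.card K' : ℕ) : ℝ) / (s.listSize A.card K' t t' : ℕ) *
            min 1 (min (s.pErr (numActive Q) A.card K' t t') (s.pEst A.card K')) := by
  have hπ := numActive_nonneg Q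
  have hWK := Finset.card_image_of_injOn hw
  have hb := s.listPrior_numActive_ne_zero hQ ((Finset.mem_Icc.1 hA).2.trans huM)
  simp_rw [Finset.sum_sigma']
  refine integral_le_of_forall (fun q => (s.fracFA_mem ..).1) (s.p0Ka_nonneg hn A.card)
    (s.fullLaw_power_event_le hn hP'0 hP' hw)
    (E := fun i => s.estEvent A w i.1 ∩ s.errEvent (numActive Q) A w i.1 i.2.1 i.2.2)
    (fun i _ => by positivity) (fun i _ => s.min_pErr_pEst_nonneg hn hL hπ ..)
    (fun i hi => ?_) fun q => ?_
  · have hi := (Finset.mem_sigma.1 hi).1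
    rw [ENNReal.ofReal_min, ENNReal.ofReal_min, ENNReal.ofReal_one]
    refine le_min prob_le_one (le_min ?_ ?_)
    · exact (measure_mono Set.inter_subset_right).trans
        (s.fullLaw_err_le hn hL hπ hw i.1 i.2.1 i.2.2 hWK (s.lo_le_hi hlu hi) hb)
    · exact (measure_mono Set.inter_subset_left).trans
        (s.fullLaw_isEstimate_le hn hL hP'0 hw hWK hA hi)
  · rcases s.decode_cases hlu huM (numActive Q) hw q with h |
      ⟨K', hK', t, ht, t', ht', hest, herr, hD⟩
    · exact Or.inl ⟨h, (s.fracFA_mem ..).2⟩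
    obtain ⟨-, h2, h3, h4⟩ := hD _ rfl
    by_cases hc : 1 ≤ (s.decode (numActive Q) q.1
        (received (s.encode q.1) A w q.2.1 q.2.2)).card
    · refine Or.inr (Or.inr ⟨⟨K', t, t'⟩, Finset.mem_sigma.2 ⟨hK', Finset.mem_sigma.2
        ⟨ht, h4 hc⟩⟩, ⟨hest, herr⟩, ?_⟩)
      rw [s.fracFA_eq h2 hc, h3]
    · exact Or.inr (Or.inl (if_neg hc))

theorem probMD_twoStageCode_le (Q : PMF (Finset (Fin s.K))) (hn : 1 ≤ s.n) (hL : 1 ≤ s.L)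
    (hM : 1 ≤ s.M) (hP'0 : 0 ≤ s.P') (hP' : s.P' ≤ s.P) (hlu : s.Kl ≤ s.Ku) (huK : s.Ku ≤ s.K)
    (huM : s.Ku ≤ s.M) :
    (s.twoStageCode (numActive Q) (hP'0.trans hP') hlu huK huM).probMD Q ≤
      s.boundMD (numActive Q) := by
  have hπ := numActive_nonneg Q
  have h := s.expect_le (Q := Q) (φ := s.fracMD)
    (β := fun Ka => ∑ K' ∈ Finset.Icc s.Kl s.Ku, ∑ t ∈ s.T Ka K',
      ((t + s.missed Ka K' : ℕ) : ℝ) / Ka *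
        min 1 (min (∑ t' ∈ s.TMD Ka K' t, s.pErr (numActive Q) Ka K' t t') (s.pEst Ka K')))
    hn hM hlu huK (hP'0.trans hP') huM s.fracMD_mem
    (fun k => Finset.sum_nonneg fun K' _ => Finset.sum_nonneg fun t _ =>
      mul_nonneg (by positivity) (s.min_sum_pErr_pEst_nonneg hn hL hπ ..))
    (fun A w hQ hA hw => s.integral_fracMD_le hn hL hP'0 hP' hlu huM hQ hA hw)
  refine h.trans_eq ?_
  rw [boundMD]
  congr 1
  -- The ranges differ at most by Ka = 0, whose term vanishes because division by 0 gives 0.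
  refine (Finset.sum_subset (Finset.Icc_subset_Icc_left (le_max_left _ _)) fun k hk hk' => ?_).symm
  have hk0 : k = 0 := by
    rw [Finset.mem_Icc] at hk hk'
    omega
  simp [hk0]

theorem probFA_twoStageCode_le (Q : PMF (Finset (Fin s.K))) (hn : 1 ≤ s.n) (hL : 1 ≤ s.L)
    (hM : 1 ≤ s.M) (hP'0 : 0 ≤ s.P') (hP' : s.P' ≤ s.P) (hlu : s.Kl ≤ s.Ku) (huK : s.Ku ≤ s.K)
    (huM : s.Ku ≤ s.M) :
    (s.twoStageCode (numActive Q) (hP'0.trans hP') hlu huK huM).probFA Q ≤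
      s.boundFA (numActive Q) := by
  have hπ := numActive_nonneg Q
  exact s.expect_le (Q := Q) (φ := s.fracFA)
    (β := fun Ka => ∑ K' ∈ Finset.Icc s.Kl s.Ku, ∑ t ∈ s.T Ka K', ∑ t' ∈ s.TFA Ka K' t,
      ((t' + s.extra Ka K' : ℕ) : ℝ) / (s.listSize Ka K' t t' : ℕ) *
        min 1 (min (s.pErr (numActive Q) Ka K' t t') (s.pEst Ka K')))
    hn hM hlu huK (hP'0.trans hP') huM s.fracFA_mem
    (fun k => Finset.sum_nonneg fun K' _ => Finset.sum_nonneg fun t _ =>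
      Finset.sum_nonneg fun t' _ =>
      mul_nonneg (by positivity) (s.min_pErr_pEst_nonneg hn hL hπ ..))
    (fun A w hQ hA hw => s.integral_fracFA_le hn hL hP'0 hP' hlu huM hQ hA hw)

end Params

end URA

end

theorem theorem4 (s : URA.Params) (Q : PMF (Finset (Fin s.K)))
    (hn : 1 ≤ s.n) (hL : 1 ≤ s.L) (hM : 2 ≤ s.M)
    (hP'0 : 0 ≤ s.P') (hP' : s.P' ≤ s.P)
    (hlu : s.Kl ≤ s.Ku) (huK : s.Ku ≤ s.K) (huM : s.Ku ≤ s.M) :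
    ∃ c : URA.Code s.n s.L s.M s.K s.P,
      s.IsTwoStage (URA.numActive Q) c ∧
      c.Achieves Q (s.boundMD (URA.numActive Q)) (s.boundFA (URA.numActive Q)) := by
  exact ⟨s.twoStageCode (URA.numActive Q) (hP'0.trans hP') hlu huK huM,
    s.isTwoStage_twoStageCode _ _ hlu huK huM,
    s.probMD_twoStageCode_le Q hn hL (one_le_two.trans hM) hP'0 hP' hlu huK huM,
    s.probFA_twoStageCode_le Q hn hL (one_le_two.trans hM) hP'0 hP' hlu huK huM⟩
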